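/- Let $\Im^-=\mathbb R\times\mathbb S^2$ with coordinates $(v,n)$ and measure $dv\,d\mathbb S^2$, let $\mathcal S$ be the real vector space of all $\Phi\in C^\infty(\Im^-,\mathbb R)$ such that $\Phi$ and $\partial_v\Phi$ lie in $L^2(\Im^-)$, with norm $\|\Phi\|_{\mathcal S}^2=\|\Phi\|_{L^2}^2+\|\partial_v\Phi\|_{L^2}^2$ and symplectic form $$\sigma(\Phi,\Psi)=-\int_{\Im^-}(\Phi\,\partial_v\Psi-\Psi\,\partial_v\Phi)\,dv\,d\mathbb S^2 ,$$ and let $\mathcal W$ be the Weyl $C^*$-algebra of $(\mathcal S,\sigma)$, with generators satisfying $W(\Phi)^*=W(-\Phi)$ and $W(\Phi)W(\Psi)=e^{\frac i2\sigma(\Phi,\Psi)}W(\Phi+\Psi)$. For $t\in\mathbb R$ and $R\in SO(3)$ let $g_{t,R}(v,n)=(v+t,Rn)$ and let $\alpha_{t,R}$ be the $*$-automorphism of $\mathcal W$ with $\alpha_{t,R}(W(\Phi))=W(\Phi\circ g_{t,R}^{-1})$; the $v$-translations are $\alpha_t=\alpha_{t,1}$. A two-point function is a map $\lambda=\mu-\frac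 i2\sigma$ on $\mathcal S\times\mathcal S$, where $\mu$ is a real scalar product on $\mathcal S$ with $|\sigma(\Phi,\Psi)|^2\le 4\mu(\Phi,\Phi)\mu(\Psi,\Psi)$. It is called continuous if $|\lambda(\Phi,\Psi)|\le C\|\Phi\|_{\mathcal S}\|\Psi\|_{\mathcal S}$ for some constant $C$. A state $\omega$ on $\mathcal W$ is quasifree with two-point function $\lambda$ if $\omega(W(\Phi))=e^{-\lambda(\Phi,\Phi)/2}$ for all $\Phi$. A state $\omega$ is a $\beta$-KMS state if for all $a,b\in\mathcal W$ there is a function $F$, bounded and continuous on $0\le\operatorname{Im}z\le\beta$ and holomorphic in the interior of this strip, with $F(t)=\omega(a\,\alpha_t(b))$ and $F(t+i\beta)=\omega(\alpha_t(b)\,a)$ for all real $t$. With the Fourier–Plancherel transform $\widehat\Phi(k,n)=\frac1{\sqrt{2\pi}}\int_{\mathbb R}e^{ikv}\Phi(v,n)\,dv$, put $$\mu_\beta(\Phi,\Psi)=\int_{\mathbb R\times\mathbb S^2}\frac{2k}{1-e^{-\beta k}}\,\overline{\widehat\Phi}\,\widehat\Psi\;dk\,d\mathbb S^2\quad(\beta>0),\qquad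 \mu_\infty(\Phi,\Psi)=\int_{(0,\infty)\times\mathbb S^2}2k\,\overline{\widehat\Phi}\,\widehat\Psi\;dk\,d\mathbb S^2 .$$ Proposition. For every $\beta>0$, $\mu_\beta$ is a two-point function and there is a unique state $\omega_\beta$ on $\mathcal W$ with $\omega_\beta(W(\Phi))=e^{-\mu_\beta(\Phi,\Phi)/2}$ for all $\Phi\in\mathcal S$. Moreover: a) $\omega_\beta$ is a $\beta$-KMS state. Its two-point function $\mu_\beta$ is continuous, and $\omega_\beta$ is the only quasifree $\beta$-KMS state with a continuous two-point function. Also, $\omega_\beta$ is an extreme point of the convex set of all $\beta$-KMS states (a pure thermodynamic phase), and it is the only quasifree state that is such an extreme point. b) $\omega_\beta\circ\alpha_{t,R}=\omega_\beta$ for all $t\in\mathbb R$ and $R\in SO(3)$. c) $\mu_\infty$ is the two-point function of a quasifree state on $\mathcal W$ (the ground state), and $\mu_\beta$ converges weakly to it: $\mu_\beta(\Phi,\Psi)\to\mu_\infty(\Phi,\Psi)$ as $\beta\to\infty$, for all $\Phi,\Psi\in\mathcal S$. -/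

import Mathlib

open MeasureTheory Filter Topology
open scoped Manifold ContDiff FourierTransform

noncomputable section

/-- The unitary `f ↦ (t ↦ c t * f (e⁻¹ t))` of `ℓ²(ι)`. -/
def weightedPerm {ι : Type*} (c : ι → Circle) (e : Equiv.Perm ι) :
    lp (fun _ : ι => ℂ) 2 ≃ₗᵢ[ℂ] lp (fun _ : ι => ℂ) 2 where
  toFun f := ⟨fun t => (c t : ℂ) * f (e.symm t), by
    refine memℓp_gen ?_
    have h := (lp.memℓp f).summable (by norm_num : (0 : ℝ) < (2 : ENNReal).toReal)
    simpa [Function.comp_def, Circle.norm_coe] using e.symm.summable_iff.mpr h⟩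
  invFun f := ⟨fun t => ((c (e t))⁻¹ : Circle) * f (e t), by
    refine memℓp_gen ?_
    have h := (lp.memℓp f).summable (by norm_num : (0 : ℝ) < (2 : ENNReal).toReal)
    simpa [Function.comp_def, Circle.norm_coe] using e.summable_iff.mpr h⟩
  map_add' f g := by
    ext t
    exact mul_add _ _ _
  map_smul' a f := by
    ext t
    simp
    ring
  left_inv f := by ext t; simp
  right_inv f := by ext t; simp
  norm_map' f := by
    have h2 : (0 : ℝ) < (2 : ENNReal).toReal := by norm_num
    rw [lp.norm_eq_tsum_rpow h2, lp.norm_eq_tsum_rpow h2]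
    congr 1
    simpa [Circle.norm_coe] using e.symm.tsum_eq (fun t => ‖f t‖ ^ (2 : ENNReal).toReal)

theorem weightedPerm_apply {ι : Type*} (c : ι → Circle) (e : Equiv.Perm ι)
    (f : lp (fun _ : ι => ℂ) 2) (t : ι) : weightedPerm c e f t = (c t : ℂ) * f (e.symm t) := rfl

section Weyl

variable {S : Type*} [AddCommGroup S] [Module ℝ S] (σ : LinearMap.BilinForm ℝ S)

/-- Bounded operators on the Hilbert space `ℓ²(S)`. -/
abbrev SOp (S : Type*) : Type _ := lp (fun _ : S => ℂ) 2 →L[ℂ] lp (fun _ : S => ℂ) 2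

/-- The Weyl operator `W(s) δ_u = exp (i σ(s,u) / 2) δ_{s + u}` on `ℓ²(S)`. -/
def weylOp (s : S) : SOp S :=
  (weightedPerm (fun t => Circle.exp (σ s t / 2)) (Equiv.addLeft s)).toContinuousLinearEquiv

theorem weylOp_apply (s : S) (f : lp (fun _ : S => ℂ) 2) (t : S) :
    weylOp σ s f t = (Circle.exp (σ s t / 2) : ℂ) * f (t - s) := by
  simp [weylOp, weightedPerm_apply, sub_eq_neg_add]

theorem weylOp_mul (hσ : σ.IsAlt) (s t : S) :
    weylOp σ s * weylOp σ t = Complex.exp (Complex.I / 2 * σ s t) • weylOp σ (s + t) := by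
  ext f u
  have h1 : σ s s = 0 := hσ s
  have h2 : σ t s = -σ s t := by rw [← hσ.neg_eq]
  simp only [mul_apply_eq_comp, smul_apply, weylOp_apply,
    lp.coeFn_smul, Pi.smul_apply, smul_eq_mul, map_add, map_sub, LinearMap.add_apply, h2]
  rw [← mul_assoc, ← mul_assoc, sub_sub]
  congr 1
  rw [Circle.coe_exp, Circle.coe_exp, Circle.coe_exp, ← Complex.exp_add, ← Complex.exp_add]
  congr 1
  push_cast
  ring

theorem weylOp_zero : weylOp σ 0 = 1 := by
  ext f u
  simp [weylOp_apply]

theorem star_weylOp (hσ : σ.IsAlt) (s : S) : star (weylOp σ s) = weylOp σ (-s) := by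
  have hU : star (weylOp σ s) * weylOp σ s = 1 := by
    have h := (Unitary.linearIsometryEquiv.symm
      (weightedPerm (fun t => Circle.exp (σ s t / 2)) (Equiv.addLeft s))).2
    exact (Unitary.mem_iff.mp h).1
  have h1 : weylOp σ s * weylOp σ (-s) = 1 := by
    rw [weylOp_mul σ hσ, map_neg, hσ s]
    simp [weylOp_zero]
  calc star (weylOp σ s) = star (weylOp σ s) * (weylOp σ s * weylOp σ (-s)) := by rw [h1, mul_one]
    _ = weylOp σ (-s) := by rw [← mul_assoc, hU, one_mul]

/-- The Weyl `C*`-algebra of `(S, σ)`, realised as the `C*`-algebra generated by the Weyl operators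
on `ℓ²(S)`. For nondegenerate `σ` it is, up to isometric `*`-isomorphism, the unique `C*`-algebra
generated by nonzero elements `W(s)` with `W(s)* = W(-s)` and
`W(s) W(t) = exp (i σ(s,t) / 2) W(s + t)`. -/
def WeylAlgebra : StarSubalgebra ℂ (SOp S) :=
  (StarAlgebra.adjoin ℂ (Set.range (weylOp σ))).topologicalClosure

instance : IsClosed (WeylAlgebra σ : Set (SOp S)) :=
  StarSubalgebra.isClosed_topologicalClosure _

/-- The generators `W(s)` of the Weyl algebra. -/
def weylGen (s : S) : WeylAlgebra σ :=
  ⟨weylOp σ s, StarSubalgebra.le_topologicalClosure _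
    (StarAlgebra.subset_adjoin ℂ _ ⟨s, rfl⟩)⟩

theorem weylGen_mul (hσ : σ.IsAlt) (s t : S) :
    weylGen σ s * weylGen σ t = Complex.exp (Complex.I / 2 * σ s t) • weylGen σ (s + t) :=
  Subtype.ext (weylOp_mul σ hσ s t)

theorem star_weylGen (hσ : σ.IsAlt) (s : S) : star (weylGen σ s) = weylGen σ (-s) :=
  Subtype.ext (star_weylOp σ hσ s)

variable {σ}

/-- Conjugation by the unitary `δ_s ↦ δ_{T s}`. -/
def permAut (T : S ≃ₗ[ℝ] S) : SOp S ≃⋆ₐ[ℂ] SOp S :=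
  Unitary.conjStarAlgAut ℂ (SOp S)
    (Unitary.linearIsometryEquiv.symm (weightedPerm (fun _ : S => 1) T.toEquiv))

theorem permAut_symm (T : S ≃ₗ[ℝ] S) : permAut T.symm = (permAut T).symm := by
  rw [permAut, permAut, Unitary.conjStarAlgAut_symm]
  congr 1
  have h : weightedPerm (fun _ : S => (1 : Circle)) T.symm.toEquiv =
      (weightedPerm (fun _ : S => (1 : Circle)) T.toEquiv)⁻¹ := by
    ext f t
    change _ = (weightedPerm (fun _ : S => (1 : Circle)) T.toEquiv).symm f t
    simp [weightedPerm]
    rfl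
  rw [h, map_inv]
  rfl

theorem permAut_weylOp {T : S ≃ₗ[ℝ] S} (hT : ∀ s t, σ (T s) (T t) = σ s t) (s : S) :
    permAut T (weylOp σ s) = weylOp σ (T s) := by
  set U := Unitary.linearIsometryEquiv.symm (weightedPerm (fun _ : S => 1) T.toEquiv) with hUdef
  have hU : (U : SOp S) * star (U : SOp S) = 1 := (Unitary.mem_iff.mp U.2).2
  have h : (U : SOp S) * weylOp σ s = weylOp σ (T s) * U := by
    ext f t
    have hUa : ∀ (g : lp (fun _ : S => ℂ) 2) (u : S), (U : SOp S) g u = g (T.symm u) := by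
      intro g u
      have : (U : SOp S) g u = weightedPerm (fun _ : S => 1) T.toEquiv g u := rfl
      rw [this, weightedPerm_apply]
      simp
    simp only [mul_apply_eq_comp, hUa, weylOp_apply, map_sub, LinearEquiv.symm_apply_apply]
    congr 4
    rw [← hT, LinearEquiv.apply_symm_apply]
  change (U : SOp S) * weylOp σ s * star (U : SOp S) = _
  rw [h, mul_assoc, hU, mul_one]

theorem permAut_mem {T : S ≃ₗ[ℝ] S} (hT : ∀ s t, σ (T s) (T t) = σ s t) {a : SOp S}
    (ha : a ∈ WeylAlgebra σ) : permAut T a ∈ WeylAlgebra σ := by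
  have hcont : Continuous (permAut T : SOp S → SOp S) := by
    change Continuous (fun x : SOp S => _ * x * _)
    fun_prop
  have hle : WeylAlgebra σ ≤ (WeylAlgebra σ).comap (permAut T).toStarAlgHom := by
    refine StarSubalgebra.topologicalClosure_minimal ?_ ?_
    · refine StarAlgebra.adjoin_le ?_
      rintro _ ⟨s, rfl⟩
      change permAut T (weylOp σ s) ∈ WeylAlgebra σ
      rw [permAut_weylOp hT]
      exact (weylGen σ (T s)).2
    · exact (StarSubalgebra.isClosed_topologicalClosure _).preimage hcont
  exact hle ha

/-- The `*`-automorphism of the Weyl algebra induced by a linear symplectic bijection `T`,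
determined by `W(s) ↦ W(T s)`. -/
def weylAut (T : S ≃ₗ[ℝ] S) (hT : ∀ s t, σ (T s) (T t) = σ s t) :
    WeylAlgebra σ ≃⋆ₐ[ℂ] WeylAlgebra σ where
  toFun a := ⟨permAut T a, permAut_mem hT a.2⟩
  invFun a := ⟨permAut T.symm a,
    permAut_mem (fun s t => by rw [← hT]; simp) a.2⟩
  left_inv a := Subtype.ext <| by
    simp [permAut_symm]
  right_inv a := Subtype.ext <| by
    simp [permAut_symm]
  map_mul' a b := Subtype.ext (map_mul (permAut T) _ _)
  map_add' a b := Subtype.ext (map_add (permAut T) _ _)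
  map_star' a := Subtype.ext (map_star (permAut T) _)
  map_smul' c a := Subtype.ext (map_smul (permAut T) _ _)

theorem weylAut_weylGen (T : S ≃ₗ[ℝ] S) (hT : ∀ s t, σ (T s) (T t) = σ s t) (s : S) :
    weylAut T hT (weylGen σ s) = weylGen σ (T s) :=
  Subtype.ext (permAut_weylOp hT s)

end Weyl

section States

variable {A : Type*} [NormedRing A] [StarRing A] [NormedAlgebra ℂ A]

/-- A state: a continuous, positive, normalised linear functional. -/
def IsState (φ : A →L[ℂ] ℂ) : Prop :=
  φ 1 = 1 ∧ ∀ a : A, 0 ≤ (φ (star a * a)).re ∧ (φ (star a * a)).im = 0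

/-- The KMS condition at inverse temperature `β > 0` for the one-parameter group `α`: for all
`a, b` there is a function `F`, bounded and continuous on the closed strip `0 ≤ Im z ≤ β` and
holomorphic in its interior, with `F(t) = φ(a α_t(b))` and `F(t + iβ) = φ(α_t(b) a)`. -/
def IsKMS (α : ℝ → A → A) (β : ℝ) (φ : A →L[ℂ] ℂ) : Prop :=
  ∀ a b : A, ∃ F : ℂ → ℂ,
    ContinuousOn F {z | 0 ≤ z.im ∧ z.im ≤ β} ∧
    DifferentiableOn ℂ F {z | 0 < z.im ∧ z.im < β} ∧
    (∃ C : ℝ, ∀ z : ℂ, 0 ≤ z.im → z.im ≤ β → ‖F z‖ ≤ C) ∧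
    ∀ t : ℝ, F t = φ (a * α t b) ∧ F (t + β * Complex.I) = φ (α t b * a)

/-- The convex set of KMS states. -/
def kmsStates (α : ℝ → A → A) (β : ℝ) : Set (A →L[ℂ] ℂ) :=
  {φ | IsState φ ∧ IsKMS α β φ}

end States

section Quasifree

variable {S : Type*} [AddCommGroup S] [Module ℝ S] (σ : LinearMap.BilinForm ℝ S)

/-- Two-point functions of quasifree states: `lam = μ - (i/2) σ`, where `μ` is a real scalar
product on `S` with `|σ(s,t)|² ≤ 4 μ(s,s) μ(t,t)`. (The relations of the Weyl generators
correspond to the commutator `[Φ(s), Φ(t)] = -i σ(s,t)` of the fields, `W(s) = exp (i Φ(s))`.) -/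
def IsTwoPointFunction (lam : S → S → ℂ) : Prop :=
  ∃ μ : LinearMap.BilinForm ℝ S,
    (∀ s t, μ s t = μ t s) ∧ (∀ s, s ≠ 0 → 0 < μ s s) ∧
    (∀ s t, σ s t ^ 2 ≤ 4 * (μ s s * μ t t)) ∧
    ∀ s t, lam s t = (μ s t : ℂ) - Complex.I / 2 * (σ s t : ℂ)

/-- `φ` is the quasifree state with two-point function `lam`:
`φ(W(s)) = exp (-lam(s,s) / 2)`. -/
def IsQuasifreeWith (lam : S → S → ℂ) (φ : WeylAlgebra σ →L[ℂ] ℂ) : Prop :=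
  IsState φ ∧ IsTwoPointFunction σ lam ∧
    ∀ s, φ (weylGen σ s) = Complex.exp (-lam s s / 2)

end Quasifree

/-- The unit sphere of `ℝ³`. -/
abbrev Sphere2 : Type := Metric.sphere (0 : EuclideanSpace ℝ (Fin 3)) 1

/-- The standard surface measure of the unit sphere, of total mass `4π`. -/
def sphereMeasure : Measure Sphere2 := (volume : Measure (EuclideanSpace ℝ (Fin 3))).toSphere

instance : IsFiniteMeasure sphereMeasure := by unfold sphereMeasure; infer_instance

/-- The boundary `ℝ × S²`, with points `(v, n)`. -/
abbrev Scri : Type := ℝ × Sphere2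

/-- The measure `dv dS²`. -/
def scriMeasure : Measure Scri := (volume : Measure ℝ).prod sphereMeasure

/-- The partial derivative `∂_v Φ`. -/
def vDeriv (Φ : Scri → ℝ) (p : Scri) : ℝ := deriv (fun v => Φ (v, p.2)) p.1

/-- `Φ ∈ C^∞(ℝ × S²)`. -/
def IsSmoothScri (Φ : Scri → ℝ) : Prop :=
  ContMDiff (𝓘(ℝ, ℝ).prod (𝓡 2)) 𝓘(ℝ, ℝ) ∞ Φ

theorem IsSmoothScri.differentiable {Φ : Scri → ℝ} (h : IsSmoothScri Φ) (n : Sphere2) :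
    Differentiable ℝ (fun v => Φ (v, n)) := by
  have h1 : ContMDiff 𝓘(ℝ, ℝ) 𝓘(ℝ, ℝ) ∞ (fun v : ℝ => Φ (v, n)) :=
    ContMDiff.comp h (contMDiff_id.prodMk contMDiff_const)
  exact h1.contDiff.differentiable (by simp)

/-- The real vector space of the smooth real functions `Φ` on `ℝ × S²` such that `Φ` and `∂_v Φ`
are square integrable. -/
def ScriSpace : Submodule ℝ (Scri → ℝ) where
  carrier := {Φ | IsSmoothScri Φ ∧ MemLp Φ 2 scriMeasure ∧ MemLp (vDeriv Φ) 2 scriMeasure}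
  add_mem' := by
    rintro Φ Ψ ⟨h1, h2, h3⟩ ⟨k1, k2, k3⟩
    refine ⟨ContMDiff.add h1 k1, h2.add k2, ?_⟩
    have : vDeriv (Φ + Ψ) = vDeriv Φ + vDeriv Ψ := by
      ext p
      exact deriv_add (h1.differentiable p.2 _) (k1.differentiable p.2 _)
    rw [this]
    exact h3.add k3
  zero_mem' := by
    refine ⟨contMDiff_const, MemLp.zero, ?_⟩
    have : vDeriv (0 : Scri → ℝ) = 0 := by
      ext p
      exact deriv_const _ _
    rw [this]
    exact MemLp.zero
  smul_mem' := by
    rintro c Φ ⟨h1, h2, h3⟩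
    refine ⟨ContMDiff.comp (g := fun x : ℝ => c • x) (I' := 𝓘(ℝ, ℝ))
      (contDiff_const_smul c).contMDiff (id h1 : ContMDiff _ _ _ Φ), h2.const_smul c, ?_⟩
    have : vDeriv (c • Φ) = c • vDeriv Φ := by
      ext p
      exact deriv_const_mul c (h1.differentiable p.2 _)
    rw [this]
    exact h3.const_smul c

theorem vDeriv_add (Φ Ψ : ScriSpace) :
    vDeriv (Φ + Ψ : ScriSpace) = vDeriv Φ + vDeriv Ψ := by
  ext p
  exact deriv_add (Φ.2.1.differentiable p.2 _) (Ψ.2.1.differentiable p.2 _)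

theorem vDeriv_smul (c : ℝ) (Φ : ScriSpace) :
    vDeriv (c • Φ : ScriSpace) = c • vDeriv Φ := by
  ext p
  exact deriv_const_mul c (Φ.2.1.differentiable p.2 _)

theorem integrable_scriSymp (Φ Ψ : ScriSpace) :
    Integrable (fun p => (Φ : Scri → ℝ) p * vDeriv Ψ p - (Ψ : Scri → ℝ) p * vDeriv Φ p)
      scriMeasure :=
  (Φ.2.2.1.integrable_mul Ψ.2.2.2).sub (Ψ.2.2.1.integrable_mul Φ.2.2.2)

/-- The symplectic form `σ(Φ, Ψ) = -∫ (Φ ∂_v Ψ - Ψ ∂_v Φ) dv dS²`. -/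
def scriSymp : LinearMap.BilinForm ℝ ScriSpace :=
  LinearMap.mk₂ ℝ
    (fun Φ Ψ => -∫ p, ((Φ : Scri → ℝ) p * vDeriv Ψ p - (Ψ : Scri → ℝ) p * vDeriv Φ p) ∂scriMeasure)
    (by
      intro Φ Φ' Ψ
      rw [← neg_add, ← integral_add (integrable_scriSymp Φ Ψ) (integrable_scriSymp Φ' Ψ)]
      congr 2
      ext p
      rw [vDeriv_add]
      simp
      ring)
    (by
      intro c Φ Ψ
      rw [smul_neg, ← integral_smul]
      congr 2
      ext p
      rw [vDeriv_smul]
      simp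
      ring)
    (by
      intro Φ Ψ Ψ'
      rw [← neg_add, ← integral_add (integrable_scriSymp Φ Ψ) (integrable_scriSymp Φ Ψ')]
      congr 2
      ext p
      rw [vDeriv_add]
      simp
      ring)
    (by
      intro c Φ Ψ
      rw [smul_neg, ← integral_smul]
      congr 2
      ext p
      rw [vDeriv_smul]
      simp
      ring)

theorem scriSymp_isAlt : scriSymp.IsAlt := by
  intro Φ
  simp [scriSymp]

/-- Linear isometries of `ℝ³`; rotations are those of determinant `1`. -/
abbrev Rot : Type := EuclideanSpace ℝ (Fin 3) ≃ₗᵢ[ℝ] EuclideanSpace ℝ (Fin 3)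

/-- The action of a linear isometry of `ℝ³` on the unit sphere. -/
def sphereMap (R : Rot) (n : Sphere2) : Sphere2 :=
  ⟨R n, by simp⟩

theorem contMDiff_sphereMap (R : Rot) : ContMDiff (𝓡 2) (𝓡 2) ∞ (sphereMap R) := by
  have : Fact (Module.finrank ℝ (EuclideanSpace ℝ (Fin 3)) = 2 + 1) := ⟨by simp⟩
  have h : ContMDiff (𝓡 2) 𝓘(ℝ, EuclideanSpace ℝ (Fin 3)) ∞
      (fun n : Sphere2 => R (n : EuclideanSpace ℝ (Fin 3))) :=
    R.toContinuousLinearEquiv.contDiff.contMDiff.comp (contMDiff_coe_sphere (n := 2))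
  exact h.codRestrict_sphere (fun n => (sphereMap R n).2)

open scoped Pointwise in
theorem measurePreserving_sphereMap (R : Rot) :
    MeasurePreserving (sphereMap R) sphereMeasure sphereMeasure := by
  have hm : Measurable (sphereMap R) := (contMDiff_sphereMap R).continuous.measurable
  refine ⟨hm, Measure.ext fun s hs => ?_⟩
  rw [Measure.map_apply hm hs, sphereMeasure, Measure.toSphere_apply' _ (hm hs),
    Measure.toSphere_apply' _ hs]
  congr 1
  have hpre : ⇑R ⁻¹' (Set.Ioo (0 : ℝ) 1 • (Subtype.val '' s)) =
      Set.Ioo (0 : ℝ) 1 • (Subtype.val '' (sphereMap R ⁻¹' s)) := by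
    ext x
    simp only [Set.mem_preimage, Set.mem_smul, Set.mem_image]
    constructor
    · rintro ⟨r, hr, _, ⟨n, hn, rfl⟩, hx⟩
      refine ⟨r, hr, _, ⟨sphereMap R.symm n, ?_, rfl⟩, ?_⟩
      · simpa [sphereMap] using hn
      · apply R.injective
        simp [sphereMap, hx]
    · rintro ⟨r, hr, _, ⟨n, hn, rfl⟩, rfl⟩
      exact ⟨r, hr, _, ⟨sphereMap R n, hn, rfl⟩, by simp [sphereMap]⟩
  rw [← hpre]
  exact R.measurePreserving.measure_preimage_emb R.toHomeomorph.measurableEmbedding _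

/-- The motion `(v, n) ↦ (v + t, R n)` of `Scri`. -/
def scriMotion (t : ℝ) (R : Rot) (p : Scri) : Scri := (p.1 + t, sphereMap R p.2)

theorem measurePreserving_scriMotion (t : ℝ) (R : Rot) :
    MeasurePreserving (scriMotion t R) scriMeasure scriMeasure :=
  (measurePreserving_add_right volume t).prod (measurePreserving_sphereMap R)

theorem scriMotion_inv (t : ℝ) (R : Rot) (p : Scri) :
    scriMotion (-t) R.symm (scriMotion t R p) = p := by
  simp [scriMotion, sphereMap]

theorem scriMotion_inv' (t : ℝ) (R : Rot) (p : Scri) :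
    scriMotion t R (scriMotion (-t) R.symm p) = p := by
  simp [scriMotion, sphereMap]

theorem contMDiff_scriMotion (t : ℝ) (R : Rot) :
    ContMDiff (𝓘(ℝ, ℝ).prod (𝓡 2)) (𝓘(ℝ, ℝ).prod (𝓡 2)) ∞ (scriMotion t R) := by
  have h : ContMDiff 𝓘(ℝ, ℝ) 𝓘(ℝ, ℝ) ∞ (fun v : ℝ => v + t) :=
    (contDiff_id.add contDiff_const).contMDiff
  exact h.prodMap (contMDiff_sphereMap R)

theorem vDeriv_comp_scriMotion (Φ : Scri → ℝ) (t : ℝ) (R : Rot) :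
    vDeriv (Φ ∘ scriMotion t R) = vDeriv Φ ∘ scriMotion t R := by
  ext p
  exact deriv_comp_add_const (f := fun v => Φ (v, sphereMap R p.2)) t p.1

theorem comp_scriMotion_mem {Φ : Scri → ℝ} (h : Φ ∈ ScriSpace) (t : ℝ) (R : Rot) :
    Φ ∘ scriMotion t R ∈ ScriSpace := by
  refine ⟨ContMDiff.comp h.1 (contMDiff_scriMotion t R),
    h.2.1.comp_measurePreserving (measurePreserving_scriMotion t R), ?_⟩
  rw [vDeriv_comp_scriMotion]
  exact h.2.2.comp_measurePreserving (measurePreserving_scriMotion t R)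

/-- The action `Φ ↦ Φ ∘ g⁻¹` of the motion `g = scriMotion t R`. -/
def scriAct (t : ℝ) (R : Rot) : ScriSpace ≃ₗ[ℝ] ScriSpace where
  toFun Φ := ⟨(Φ : Scri → ℝ) ∘ scriMotion (-t) R.symm, comp_scriMotion_mem Φ.2 _ _⟩
  invFun Φ := ⟨(Φ : Scri → ℝ) ∘ scriMotion t R, comp_scriMotion_mem Φ.2 _ _⟩
  map_add' _ _ := rfl
  map_smul' _ _ := rfl
  left_inv Φ := by
    ext p
    simp [scriMotion_inv]
  right_inv Φ := by
    ext p
    simp [scriMotion_inv']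

theorem scriAct_symp (t : ℝ) (R : Rot) (Φ Ψ : ScriSpace) :
    scriSymp (scriAct t R Φ) (scriAct t R Ψ) = scriSymp Φ Ψ := by
  have hme : MeasurableEmbedding (scriMotion (-t) R.symm) := by
    refine MeasurableEquiv.measurableEmbedding (α := Scri) (β := Scri)
      ⟨⟨scriMotion (-t) R.symm, scriMotion t R, fun p => ?_, scriMotion_inv t R⟩,
        (measurePreserving_scriMotion (-t) R.symm).measurable,
        (measurePreserving_scriMotion t R).measurable⟩
    simpa using scriMotion_inv' t R p
  have h := (measurePreserving_scriMotion (-t) R.symm).integral_comp hme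
    (fun p => (Φ : Scri → ℝ) p * vDeriv Ψ p - (Ψ : Scri → ℝ) p * vDeriv Φ p)
  simp only [scriSymp, LinearMap.mk₂_apply]
  rw [← h]
  congr 2
  ext p
  simp [scriAct, vDeriv_comp_scriMotion]

/-- `L²(S²; ℂ)`. -/
abbrev L2S : Type := Lp ℂ 2 sphereMeasure

theorem ScriSpace.continuous (Φ : ScriSpace) : Continuous (Φ : Scri → ℝ) :=
  ContMDiff.continuous Φ.2.1

/-- The class of `Φ(v, ·)` in `L²(S²; ℂ)`. -/
def sliceL2 (Φ : ScriSpace) (v : ℝ) : L2S :=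
  ContinuousMap.toLp 2 sphereMeasure ℂ
    ⟨fun n => ((Φ : Scri → ℝ) (v, n) : ℂ), by have := ScriSpace.continuous Φ; fun_prop⟩

theorem continuous_sliceL2 (Φ : ScriSpace) : Continuous (sliceL2 Φ) := by
  have h : Continuous (fun p : ℝ × Sphere2 => ((Φ : Scri → ℝ) p : ℂ)) :=
    Complex.continuous_ofReal.comp (ScriSpace.continuous Φ)
  exact (ContinuousMap.toLp (E := ℂ) 2 sphereMeasure ℂ).continuous.comp
    (ContinuousMap.curry ⟨_, h⟩).continuous

theorem memLp_sliceL2 (Φ : ScriSpace) : MemLp (sliceL2 Φ) 2 volume := by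
  refine ⟨(continuous_sliceL2 Φ).aestronglyMeasurable, ?_⟩
  have h2 : (2 : ENNReal) ≠ 0 := by norm_num
  have h2' : (2 : ENNReal) ≠ ⊤ := by norm_num
  have hΦ := Φ.2.2.1.eLpNorm_lt_top
  rw [eLpNorm_lt_top_iff_lintegral_rpow_enorm_lt_top h2 h2'] at hΦ ⊢
  refine lt_of_eq_of_lt ?_ hΦ
  rw [scriMeasure, lintegral_prod _ (by
    have := (ScriSpace.continuous Φ).measurable
    fun_prop)]
  refine lintegral_congr fun v => ?_
  rw [Lp.enorm_def, eLpNorm_eq_lintegral_rpow_enorm_toReal h2 h2', ← ENNReal.rpow_mul]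
  have h3 : 1 / (2 : ENNReal).toReal * (2 : ENNReal).toReal = 1 := by norm_num
  rw [h3, ENNReal.rpow_one]
  refine lintegral_congr_ae ?_
  filter_upwards [ContinuousMap.coeFn_toLp (p := 2) (𝕜 := ℂ) sphereMeasure
    ⟨fun n => ((Φ : Scri → ℝ) (v, n) : ℂ), by
      have := ScriSpace.continuous Φ
      fun_prop⟩] with n hn
  rw [sliceL2, hn]
  simp [enorm_eq_nnnorm]

/-- The Fourier-Plancherel transform `Φ̂(k, ·) = (2π)^(-1/2) ∫ exp (i k v) Φ(v, ·) dv` in the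
variable `v`, with values in `L²(S²; ℂ)` (Mathlib's transform has the kernel `exp (-2π i v w)`). -/
def scriFourier (Φ : ScriSpace) (k : ℝ) : L2S :=
  ((Real.sqrt (2 * Real.pi))⁻¹ : ℂ) •
    (𝓕 (memLp_sliceL2 Φ).toLp : Lp L2S 2 (volume : Measure ℝ)) (-k / (2 * Real.pi))

/-- `μ_β(Φ, Ψ) = ∫ 2k / (1 - exp (-β k)) conj(Φ̂(k, n)) Ψ̂(k, n) dk dS²(n)`. -/
def thermalTwoPoint (β : ℝ) (Φ Ψ : ScriSpace) : ℂ :=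
  ∫ k : ℝ, ((2 * k / (1 - Real.exp (-β * k)) : ℝ) : ℂ) *
    inner ℂ (scriFourier Φ k) (scriFourier Ψ k)

/-- `μ(Φ, Ψ) = ∫ 2k Θ(k) conj(Φ̂(k, n)) Ψ̂(k, n) dk dS²(n)`. -/
def groundTwoPoint (Φ Ψ : ScriSpace) : ℂ :=
  ∫ k in Set.Ioi (0 : ℝ), ((2 * k : ℝ) : ℂ) * inner ℂ (scriFourier Φ k) (scriFourier Ψ k)

/-- The norm `(‖Φ‖² + ‖∂_v Φ‖²)^(1/2)` of `ScriSpace`, with `L²` norms on the right. -/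
def scriNorm (Φ : ScriSpace) : ℝ :=
  Real.sqrt (∫ p, (Φ : Scri → ℝ) p ^ 2 ∂scriMeasure + ∫ p, vDeriv Φ p ^ 2 ∂scriMeasure)

/-- Continuity of a two-point function for the norm of `ScriSpace`. -/
def IsContinuousTwoPoint (lam : ScriSpace → ScriSpace → ℂ) : Prop :=
  ∃ C : ℝ, ∀ Φ Ψ, ‖lam Φ Ψ‖ ≤ C * scriNorm Φ * scriNorm Ψ

/-- The boundary Weyl algebra. -/
abbrev ScriWeyl : Type := WeylAlgebra scriSymp

/-- The automorphism of the boundary Weyl algebra with `W(Φ) ↦ W(Φ ∘ g⁻¹)`, for the motion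
`g(v, n) = (v + t, R n)`. -/
def scriAut (t : ℝ) (R : Rot) : ScriWeyl ≃⋆ₐ[ℂ] ScriWeyl :=
  weylAut (scriAct t R) (scriAct_symp t R)

/-- The one-parameter group of `v`-translations, `W(Φ) ↦ W(Φ(· - t, ·))`. -/
def vTranslation (t : ℝ) (a : ScriWeyl) : ScriWeyl :=
  scriAut t (LinearIsometryEquiv.refl ℝ _) a

end

/-! Write `Ψ_t` for the translate of `Ψ`, `λ` for the thermal form and `w(k) = 2k / (1 - exp(-βk))`
for its weight. The main device is to divide a functional `φ` by the thermal Gaussian: `r(Φ) =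
φ(W(Φ)) exp(λ(Φ,Φ)/2)`, which is `weylRatio`. The detailed balance relation `w(k) exp(-βk) = w(-k)`
makes `z ↦ ∫ w(k) exp(ikz) ⟨Φ̂(k), Ψ̂(k)⟩ dk` a bounded function on the strip, with edge values
`λ(Φ, Ψ_t)` and `λ(Ψ_t, Φ)`. Multiplying the KMS function of `W(Φ), W(Ψ)` by the exponential of this
kernel leaves a strip function with equal values on both edges, hence a constant
(`IsStripFun.eq_of_periodic`). So `φ` is KMS exactly when `r(Φ + Ψ_t) = r(Φ + Ψ)` for all `Φ, Ψ, t`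
(`weylRatio_add_scriShift`, `isKMS_of_weylRatio`). The thermal state has `r = 1` and is therefore
KMS.

The same invariance allows `Ψ` to be replaced by the averages `A_N Ψ` of its translates, which tend
to `0` in the norm of the space, as in the mean ergodic theorem (`tendsto_scriNorm_scriAverage`).
Thus `r(Φ) = r(A_N Φ) = lim φ(W(A_N Φ))`, and a KMS functional is the thermal state as soon as
`φ(W(A_N Φ)) → 1` (`eq_of_tendsto_one`). This limit holds for a quasifree state with continuous
two-point function, and by Cauchy-Schwarz for every component of a convex decomposition of the
thermal state. This gives uniqueness and extremality.

For a quasifree KMS state with covariance `μ` one has `r = exp(-D/2)`, where `D = μ - Re λ` is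
nonnegative by averaging. If `D(F,F) > 0`, conjugating by `1 ± W(A_N F)` and letting `N → ∞` gives
KMS states with ratios proportional to `2r(G) ± (r(G+F) + r(G-F))`. The state is a proper mixture of
the two, and extremality leads to a contradiction at `G = F`.

Existence rests on two facts. A normalised functional that is positive on the span of the Weyl
operators is bounded by the operator norm on `ℓ²(S)`, because powers of a finite combination have
supports of polynomial size (`IsPositiveOn.norm_le_of_weylSpan`). The Gaussian is positive because
entrywise exponentials of Gram matrices are positive semidefinite. The ground state arises in the
same way from the weight `2k` on `k > 0`, and the weak limit is dominated convergence. -/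

noncomputable section

/-! ### Positive functionals on a `*`-subalgebra -/

section PositiveFunctional

variable {A : Type*} [Ring A] [StarRing A] [Algebra ℂ A] [StarModule ℂ A]
  (g : A →ₗ[ℂ] ℂ) (B : StarSubalgebra ℂ A)

/-- Positivity of a linear functional on a `*`-subalgebra. -/
def IsPositiveOn : Prop :=
  ∀ x ∈ B, 0 ≤ (g (star x * x)).re ∧ (g (star x * x)).im = 0

variable {g B}

/-- Polarisation: only the reality of `g (y* y)` for `y = 1, x, 1 + x, 1 + i x` enters. -/
theorem IsPositiveOn.map_star (h : IsPositiveOn g B) {x : A} (hx : x ∈ B) :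
    g (star x) = starRingEnd ℂ (g x) := by
  have h0 := (h 1 B.one_mem).2
  have hxx := (h x hx).2
  have h1 := (h (1 + x) (B.add_mem B.one_mem hx)).2
  have h2 := (h (1 + Complex.I • x) (B.add_mem B.one_mem (B.smul_mem hx _))).2
  simp only [star_one, mul_one, star_add, star_smul, add_mul, mul_add, one_mul, map_add,
    smul_mul_assoc, mul_smul_comm, map_smul, smul_eq_mul, Complex.star_def, Complex.conj_I,
    Complex.add_im, Complex.mul_im, Complex.mul_re, Complex.neg_re, Complex.neg_im, Complex.I_re,
    Complex.I_im] at h0 h1 h2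
  apply Complex.ext
  · rw [Complex.conj_re]; linarith
  · rw [Complex.conj_im]; linarith

/-- Expand positivity at `x - g(x) 1`. -/
theorem IsPositiveOn.norm_sq_le (h : IsPositiveOn g B) (h1 : g 1 = 1) {x : A} (hx : x ∈ B) :
    ‖g x‖ ^ 2 ≤ (g (star x * x)).re := by
  have hp := (h (x - g x • 1) (B.sub_mem hx (B.smul_mem B.one_mem _))).1
  have hs := h.map_star hx
  simp only [star_sub, star_smul, star_one, sub_mul, mul_sub, smul_mul_assoc, mul_smul_comm, one_mul,
    mul_one, map_sub, map_smul, smul_eq_mul, h1, hs, Complex.star_def] at hp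
  rw [← Complex.normSq_eq_norm_sq, Complex.normSq_apply]
  simp only [Complex.sub_re, Complex.mul_re, Complex.conj_re, Complex.conj_im] at hp
  linarith

end PositiveFunctional

/-! ### The span of the Weyl generators -/

section WeylBasic

variable {S : Type*} [AddCommGroup S] [Module ℝ S] {σ : LinearMap.BilinForm ℝ S}

theorem weylGen_zero : weylGen σ 0 = 1 := Subtype.ext (weylOp_zero σ)

theorem weylGen_star_mul (hσ : σ.IsAlt) (s t : S) :
    star (weylGen σ s) * weylGen σ t =
      Complex.exp (-(Complex.I / 2 * σ s t)) • weylGen σ (t - s) := by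
  rw [star_weylGen σ hσ, weylGen_mul σ hσ, map_neg, LinearMap.neg_apply, neg_add_eq_sub]
  simp

theorem star_weylGen_mul_self (hσ : σ.IsAlt) (s : S) : star (weylGen σ s) * weylGen σ s = 1 := by
  rw [weylGen_star_mul hσ, hσ s]
  simp [weylGen_zero]

variable (σ) in
/-- The linear combinations of the Weyl generators. -/
noncomputable def weylSum : (S →₀ ℂ) →ₗ[ℂ] WeylAlgebra σ := Finsupp.linearCombination ℂ (weylGen σ)

@[simp]
theorem weylSum_single (s : S) (c : ℂ) : weylSum σ (Finsupp.single s c) = c • weylGen σ s := by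
  simp [weylSum]

theorem range_weylSum : LinearMap.range (weylSum σ) = Submodule.span ℂ (Set.range (weylGen σ)) :=
  Finsupp.range_linearCombination ℂ

variable (σ) in
/-- The `*`-subalgebra spanned by the Weyl generators. -/
def weylSpan (hσ : σ.IsAlt) : StarSubalgebra ℂ (WeylAlgebra σ) where
  carrier := Submodule.span ℂ (Set.range (weylGen σ))
  mul_mem' {a b} ha hb := by
    have h := Submodule.mul_mem_mul (M := Submodule.span ℂ (Set.range (weylGen σ)))
      (N := Submodule.span ℂ (Set.range (weylGen σ))) ha hb
    rw [Submodule.span_mul_span] at h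
    refine Submodule.span_le.mpr ?_ h
    rintro _ ⟨_, ⟨s, rfl⟩, _, ⟨t, rfl⟩, rfl⟩
    change weylGen σ s * weylGen σ t ∈ Submodule.span ℂ (Set.range (weylGen σ))
    rw [weylGen_mul σ hσ]
    exact Submodule.smul_mem _ _ (Submodule.subset_span ⟨_, rfl⟩)
  add_mem' ha hb := Submodule.add_mem _ ha hb
  algebraMap_mem' c := by
    rw [Algebra.algebraMap_eq_smul_one, ← weylGen_zero]
    exact Submodule.smul_mem _ _ (Submodule.subset_span ⟨_, rfl⟩)
  star_mem' {a} ha := by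
    change star a ∈ Submodule.span ℂ (Set.range (weylGen σ))
    induction ha using Submodule.span_induction with
    | mem x hx =>
      obtain ⟨s, rfl⟩ := hx
      rw [star_weylGen σ hσ]
      exact Submodule.subset_span ⟨_, rfl⟩
    | zero => simp
    | add x y _ _ hx hy => rw [star_add]; exact Submodule.add_mem _ hx hy
    | smul c x _ hx => rw [star_smul]; exact Submodule.smul_mem _ _ hx

theorem mem_weylSpan {hσ : σ.IsAlt} {a : WeylAlgebra σ} :
    a ∈ weylSpan σ hσ ↔ ∃ c, weylSum σ c = a := by
  rw [← LinearMap.mem_range, range_weylSum]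
  rfl

theorem weylGen_mem_weylSpan (hσ : σ.IsAlt) (s : S) : weylGen σ s ∈ weylSpan σ hσ :=
  Submodule.subset_span ⟨s, rfl⟩

/-- The span is already a `*`-algebra, so it contains the algebra whose closure is the Weyl algebra.
-/
theorem denseRange_weylSum (hσ : σ.IsAlt) : DenseRange (weylSum σ) := by
  have hle : StarAlgebra.adjoin ℂ (Set.range (weylOp σ)) ≤
      (weylSpan σ hσ).map (WeylAlgebra σ).subtype := by
    refine StarAlgebra.adjoin_le ?_
    rintro _ ⟨s, rfl⟩
    exact ⟨weylGen σ s, weylGen_mem_weylSpan hσ s, rfl⟩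
  intro a
  rw [Metric.mem_closure_iff]
  intro ε hε
  obtain ⟨b, hb, hab⟩ := Metric.mem_closure_iff.mp
    (show (a : SOp S) ∈ closure (StarAlgebra.adjoin ℂ (Set.range (weylOp σ)) : Set (SOp S))
      from a.2) ε hε
  obtain ⟨b', hb', rfl⟩ := hle hb
  obtain ⟨c, rfl⟩ := mem_weylSpan.mp hb'
  exact ⟨_, ⟨c, rfl⟩, hab⟩

theorem weyl_induction (hσ : σ.IsAlt) {p : WeylAlgebra σ → Prop} (a : WeylAlgebra σ)
    (hp : IsClosed {a | p a}) (h : ∀ a ∈ weylSpan σ hσ, p a) : p a :=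
  (denseRange_weylSum hσ).induction_on (p := p) a hp fun c => h _ (mem_weylSpan.mpr ⟨c, rfl⟩)

theorem ext_weylGen (hσ : σ.IsAlt) {φ ψ : WeylAlgebra σ →L[ℂ] ℂ}
    (h : ∀ s, φ (weylGen σ s) = ψ (weylGen σ s)) : φ = ψ := by
  ext a
  refine (denseRange_weylSum hσ).induction_on (p := fun a => φ a = ψ a) a
    (isClosed_eq φ.continuous ψ.continuous) fun c => ?_
  simp only [weylSum, Finsupp.linearCombination_apply, map_finsuppSum, map_smul, h]

open Classical in
-- On `δ_0` the operator `W(s)` gives `δ_s`, with trivial phase as `σ(s,s) = 0`. The coefficients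
-- can thus be read off from one vector, which yields linear independence and the `ℓ²` bound.
theorem weylSum_apply_single (hσ : σ.IsAlt) (c : S →₀ ℂ) (t : S) :
    ((weylSum σ c : WeylAlgebra σ) : SOp S) (lp.single 2 (0 : S) (1 : ℂ)) t = c t := by
  induction c using Finsupp.induction_linear with
  | zero => simp
  | add c d hc hd =>
    rw [map_add, Finsupp.add_apply, ← hc, ← hd]
    rfl
  | single s a =>
    rw [weylSum_single]
    change a * (weylOp σ s (lp.single 2 (0 : S) (1 : ℂ)) t) = _
    rw [weylOp_apply, lp.single_apply, Finsupp.single_apply, Pi.single_apply]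
    by_cases h : s = t
    · subst h
      simp [hσ s]
    · have h' : t - s ≠ 0 := fun h' => h (sub_eq_zero.mp h').symm
      simp [h, h']

theorem weylSum_injective (hσ : σ.IsAlt) : Function.Injective (weylSum σ) := fun c d h => by
  ext t
  rw [← weylSum_apply_single hσ, ← weylSum_apply_single hσ, h]

/-- The coefficients are the coordinates of the image of the unit vector `δ_0`. -/
theorem sum_norm_sq_le (hσ : σ.IsAlt) (c : S →₀ ℂ) :
    ∑ t ∈ c.support, ‖c t‖ ^ 2 ≤ ‖weylSum σ c‖ ^ 2 := by
  classical
  set x : SOp S := ((weylSum σ c : WeylAlgebra σ) : SOp S) with hx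
  set δ : lp (fun _ : S => ℂ) 2 := lp.single 2 (0 : S) (1 : ℂ)
  have hδ : ‖δ‖ = 1 := by simp [δ, lp.norm_single]
  have h2 : (0 : ℝ) < (2 : ENNReal).toReal := by norm_num
  have h1 := lp.sum_rpow_le_norm_rpow h2 (x δ) c.support
  have h3 : ‖x δ‖ ≤ ‖x‖ := by simpa [hδ] using x.le_opNorm δ
  have h4 : ‖x δ‖ ^ 2 ≤ ‖x‖ ^ 2 := by gcongr
  refine le_trans ?_ h4
  simpa [x, δ, weylSum_apply_single hσ] using h1

theorem sum_norm_le (hσ : σ.IsAlt) (c : S →₀ ℂ) (U : Finset S) (hU : c.support ⊆ U) :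
    (∑ t ∈ c.support, ‖c t‖) ^ 2 ≤ U.card * ‖weylSum σ c‖ ^ 2 := by
  calc (∑ t ∈ c.support, ‖c t‖) ^ 2 ≤ c.support.card * ∑ t ∈ c.support, ‖c t‖ ^ 2 :=
        sq_sum_le_card_mul_sum_sq
    _ ≤ U.card * ‖weylSum σ c‖ ^ 2 := by
        have := Finset.card_le_card hU
        gcongr
        exact sum_norm_sq_le hσ c

/-- Powers of an element of the span are supported on sets of polynomial size. -/
theorem exists_weylSum_pow (hσ : σ.IsAlt) (c : S →₀ ℂ) (n : ℕ) :
    ∃ (d : S →₀ ℂ) (U : Finset S), weylSum σ d = weylSum σ c ^ n ∧ d.support ⊆ U ∧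
      U.card ≤ (n + 1) ^ c.support.card := by
  classical
  -- All sums of support points with multiplicities from `0` to `n`: more than the `n`-fold sums,
  -- but counted at once by `(n + 1) ^ card`.
  set U : ℕ → Finset S := fun n => Finset.univ.image
    (fun m : c.support → Fin (n + 1) => ∑ t, (m t : ℕ) • (t : S)) with hUdef
  have key : ∀ n, weylSum σ c ^ n ∈ Submodule.span ℂ (weylGen σ '' (U n : Set S)) := by
    intro n
    induction n with
    | zero =>
      rw [pow_zero, ← weylGen_zero]
      refine Submodule.subset_span ⟨0, ?_, rfl⟩
      simp [hUdef]
    | succ n ih =>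
      rw [pow_succ]
      have hc : weylSum σ c ∈ Submodule.span ℂ (weylGen σ '' (c.support : Set S)) := by
        rw [Finsupp.mem_span_image_iff_linearCombination]
        exact ⟨c, by simp [Finsupp.mem_supported], rfl⟩
      have h := Submodule.mul_mem_mul ih hc
      rw [Submodule.span_mul_span] at h
      refine Submodule.span_le.mpr ?_ h
      rintro _ ⟨_, ⟨u, hu, rfl⟩, _, ⟨t, ht, rfl⟩, rfl⟩
      change weylGen σ u * weylGen σ t ∈ Submodule.span ℂ (weylGen σ '' (U (n + 1) : Set S))
      rw [weylGen_mul σ hσ]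
      refine Submodule.smul_mem _ _ (Submodule.subset_span ⟨_, ?_, rfl⟩)
      simp only [hUdef, Finset.coe_image, Finset.coe_univ, Set.image_univ, Set.mem_range] at hu ⊢
      obtain ⟨m, rfl⟩ := hu
      refine ⟨fun t' => ⟨m t' + if t' = ⟨t, ht⟩ then 1 else 0, ?_⟩, ?_⟩
      · have := (m t').2
        split_ifs <;> omega
      · simp [add_smul, Finset.sum_add_distrib]
  obtain ⟨d, hd, hd'⟩ := (Finsupp.mem_span_image_iff_linearCombination ℂ).mp (key n)
  refine ⟨d, U n, hd', by simpa [Finsupp.mem_supported] using hd, ?_⟩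
  refine Finset.card_image_le.trans ?_
  simp

end WeylBasic

/-! ### Boundedness of positive functionals, and states from positive definite functions -/

section WeylStates

open scoped ComplexOrder

variable {S : Type*} [AddCommGroup S] [Module ℝ S] {σ : LinearMap.BilinForm ℝ S}

/-- The `2^k`-th root of a polynomial in `2^k` tends to `1`. -/
theorem le_of_pow_two_pow_le {y r : ℝ} (hr : 0 ≤ r) (d : ℕ)
    (h : ∀ k : ℕ, y ^ 2 ^ k ≤ (2 ^ k + 1 : ℝ) ^ d * r ^ 2 ^ k) : y ≤ r := by
  by_contra! hlt
  have hy : 0 < y := hr.trans_lt hlt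
  -- Divide by some `q` strictly between, since `r` may vanish.
  obtain ⟨q, hrq, hqy⟩ := exists_between hlt
  have hq : 0 < q := hr.trans_lt hrq
  have h1 : 1 < y / q := (one_lt_div hq).mpr hqy
  have hbound : ∀ k : ℕ, (1 : ℝ) ≤ (2 ^ d) * (((2 ^ k : ℕ) : ℝ) ^ d / (y / q) ^ 2 ^ k) := by
    intro k
    have h2 : y ^ 2 ^ k ≤ (2 ^ k + 1 : ℝ) ^ d * q ^ 2 ^ k := (h k).trans (by gcongr)
    have h3 : (2 ^ k + 1 : ℝ) ≤ 2 * 2 ^ k := by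
      have : (1 : ℝ) ≤ 2 ^ k := one_le_pow₀ (by norm_num)
      linarith
    have h4 : (2 ^ k + 1 : ℝ) ^ d ≤ 2 ^ d * (2 ^ k) ^ d := by
      rw [← mul_pow]; gcongr
    rw [div_pow, div_div_eq_mul_div, mul_div_assoc', one_le_div (by positivity)]
    push_cast
    calc y ^ 2 ^ k ≤ (2 ^ k + 1 : ℝ) ^ d * q ^ 2 ^ k := h2
      _ ≤ (2 ^ d * (2 ^ k) ^ d) * q ^ 2 ^ k := by gcongr
      _ = _ := by ring
  have hlim : Tendsto (fun k : ℕ => (2 ^ d : ℝ) * (((2 ^ k : ℕ) : ℝ) ^ d / (y / q) ^ 2 ^ k)) atTop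
      (𝓝 (2 ^ d * 0)) :=
    ((tendsto_pow_const_div_const_pow_of_one_lt d h1).comp
      (tendsto_pow_atTop_atTop_of_one_lt (by norm_num : 1 < 2))).const_mul _
  have := ge_of_tendsto' hlim hbound
  norm_num at this

/-- A spectral radius argument. For `b = x* x`, iterated Cauchy-Schwarz bounds `g(b)^(2^k)` by
`|g(b^(2^k))|`. Since `|g(W(s))| ≤ 1`, the latter is at most the `ℓ¹` norm of the coefficients,
hence at most the square root of the support size times the operator norm. The support of the power
grows polynomially in `2^k`, so this factor disappears in the limit of roots. -/
theorem IsPositiveOn.norm_le_of_weylSpan {hσ : σ.IsAlt} {g : WeylAlgebra σ →ₗ[ℂ] ℂ}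
    (h : IsPositiveOn g (weylSpan σ hσ)) (h1 : g 1 = 1) {x : WeylAlgebra σ}
    (hx : x ∈ weylSpan σ hσ) : ‖g x‖ ≤ ‖x‖ := by
  have hgen : ∀ s, ‖g (weylGen σ s)‖ ≤ 1 := fun s => by
    have := h.norm_sq_le h1 (weylGen_mem_weylSpan hσ s)
    rw [star_weylGen_mul_self hσ, h1, Complex.one_re] at this
    exact (sq_le_one_iff₀ (norm_nonneg _)).mp this
  set b := star x * x with hb
  have hbm : b ∈ weylSpan σ hσ := mul_mem (star_mem hx) hx
  have hbs : star b = b := by simp [hb]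
  obtain ⟨c, hc⟩ := mem_weylSpan.mp hbm
  have hpow : ∀ k : ℕ, (g b).re ^ 2 ^ k ≤ ‖g (b ^ 2 ^ k)‖ := by
    intro k
    induction k with
    | zero => simpa using (le_abs_self _).trans (Complex.abs_re_le_norm (g b))
    | succ k ih =>
      have h2 := h.norm_sq_le h1 (pow_mem hbm (2 ^ k))
      rw [star_pow, hbs, ← pow_add, ← mul_two, ← pow_succ] at h2
      calc (g b).re ^ 2 ^ (k + 1) = ((g b).re ^ 2 ^ k) ^ 2 := by rw [← pow_mul, pow_succ]
        _ ≤ ‖g (b ^ 2 ^ k)‖ ^ 2 := by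
          have := pow_nonneg (h x hx).1 (2 ^ k)
          gcongr
        _ ≤ _ := h2.trans ((le_abs_self _).trans (Complex.abs_re_le_norm _))
  -- Squared throughout, so that the support size enters without a square root.
  have hle : ∀ k : ℕ, ((g b).re ^ 2) ^ 2 ^ k ≤
      (2 ^ k + 1 : ℝ) ^ c.support.card * (‖b‖ ^ 2) ^ 2 ^ k := by
    intro k
    obtain ⟨d, U, hd, hdU, hU⟩ := exists_weylSum_pow hσ c (2 ^ k)
    have h3 : ‖g (b ^ 2 ^ k)‖ ≤ ∑ t ∈ d.support, ‖d t‖ := by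
      rw [← hc, ← hd, weylSum, Finsupp.linearCombination_apply, Finsupp.sum, map_sum]
      refine norm_sum_le_of_le _ fun t _ => ?_
      rw [map_smul, norm_smul]
      exact mul_le_of_le_one_right (norm_nonneg _) (hgen t)
    have h4 := sum_norm_le hσ d U hdU
    rw [hd, hc] at h4
    have h5 : ‖b ^ 2 ^ k‖ ≤ ‖b‖ ^ 2 ^ k := norm_pow_le' b (by positivity)
    calc ((g b).re ^ 2) ^ 2 ^ k = ((g b).re ^ 2 ^ k) ^ 2 := by rw [← pow_mul, ← pow_mul, mul_comm]
      _ ≤ (∑ t ∈ d.support, ‖d t‖) ^ 2 := by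
        have := pow_nonneg (h x hx).1 (2 ^ k)
        have := (hpow k).trans h3
        gcongr
      _ ≤ U.card * ‖b ^ 2 ^ k‖ ^ 2 := h4
      _ ≤ (2 ^ k + 1 : ℝ) ^ c.support.card * (‖b‖ ^ 2 ^ k) ^ 2 := by
        have : (U.card : ℝ) ≤ (2 ^ k + 1 : ℝ) ^ c.support.card := by exact_mod_cast hU
        gcongr
      _ = _ := by rw [← pow_mul, ← pow_mul, mul_comm (2 ^ k) 2]
  have h6 := le_of_pow_two_pow_le (by positivity) _ hle
  have h7 : (g b).re ≤ ‖b‖ := le_of_sq_le_sq h6 (norm_nonneg _)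
  have h8 : ‖g x‖ ^ 2 ≤ ‖x‖ ^ 2 := (h.norm_sq_le h1 hx).trans (h7.trans (by
    refine (norm_mul_le _ _).trans ?_
    have : ‖star x‖ = ‖x‖ := norm_star (x : SOp S)
    rw [this, sq]))
  exact le_of_sq_le_sq h8 (norm_nonneg _)

variable (σ) in
/-- Positive definiteness of a function on `S`, twisted by the cocycle of the Weyl relations. -/
def IsTwistedPosDef (f : S → ℂ) : Prop :=
  (Matrix.of fun s t => Complex.exp (-(Complex.I / 2 * σ s t)) * f (t - s)).PosSemidef

theorem isPositiveOn_weylSpan (hσ : σ.IsAlt) {f : S → ℂ} (hf : IsTwistedPosDef σ f)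
    {g : WeylAlgebra σ →ₗ[ℂ] ℂ} (hg : ∀ s, g (weylGen σ s) = f s) :
    IsPositiveOn g (weylSpan σ hσ) := by
  intro x hx
  obtain ⟨c, rfl⟩ := mem_weylSpan.mp hx
  have h := hf.2 c
  have heq : g (star (weylSum σ c) * weylSum σ c) = c.sum fun i xi => c.sum fun j xj =>
      star xi * (Matrix.of (fun s t => Complex.exp (-(Complex.I / 2 * σ s t)) * f (t - s))) i j * xj := by
    simp only [weylSum, Finsupp.linearCombination_apply, Finsupp.sum, star_sum, star_smul,
      Finset.sum_mul_sum, map_sum, smul_mul_assoc, mul_smul_comm, map_smul, weylGen_star_mul hσ, hg,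
      smul_eq_mul, Matrix.of_apply]
    refine Finset.sum_congr rfl fun i _ => Finset.sum_congr rfl fun j _ => ?_
    ring
  rw [heq]
  have := Complex.le_def.mp h
  simpa [eq_comm] using this

/-- In this form positivity depends only on the values on generators and survives pointwise limits
there. -/
theorem IsPositiveOn.isTwistedPosDef (hσ : σ.IsAlt) {g : WeylAlgebra σ →ₗ[ℂ] ℂ}
    (h : IsPositiveOn g (weylSpan σ hσ)) : IsTwistedPosDef σ fun s => g (weylGen σ s) := by
  have hent : ∀ s t, Complex.exp (-(Complex.I / 2 * σ s t)) * g (weylGen σ (t - s)) =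
      g (star (weylGen σ s) * weylGen σ t) := fun s t => by
    rw [weylGen_star_mul hσ, map_smul, smul_eq_mul]
  refine ⟨?_, fun c => ?_⟩
  · ext s t
    simp only [Matrix.conjTranspose_apply, Matrix.of_apply, hent]
    rw [Complex.star_def, ← h.map_star (mul_mem (star_mem (weylGen_mem_weylSpan hσ t))
      (weylGen_mem_weylSpan hσ s))]
    simp
  · have hx := h (weylSum σ c) (mem_weylSpan.mpr ⟨c, rfl⟩)
    have heq : g (star (weylSum σ c) * weylSum σ c) = c.sum fun i xi => c.sum fun j xj =>
        star xi * (Matrix.of (fun s t => Complex.exp (-(Complex.I / 2 * σ s t)) *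
          g (weylGen σ (t - s)))) i j * xj := by
      simp only [weylSum, Finsupp.linearCombination_apply, Finsupp.sum, star_sum, star_smul,
        Finset.sum_mul_sum, map_sum, smul_mul_assoc, mul_smul_comm, map_smul, hent,
        smul_eq_mul, Matrix.of_apply]
      refine Finset.sum_congr rfl fun i _ => Finset.sum_congr rfl fun j _ => ?_
      ring
    rw [← heq, Complex.le_def]
    simpa [eq_comm] using hx

/-- Linear independence of the generators defines the functional on the span, the norm bound extends
it, and density carries positivity over. -/
theorem exists_isState (hσ : σ.IsAlt) {f : S → ℂ} (h0 : f 0 = 1) (hf : IsTwistedPosDef σ f) :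
    ∃ φ : WeylAlgebra σ →L[ℂ] ℂ, IsState φ ∧ ∀ s, φ (weylGen σ s) = f s := by
  obtain ⟨l, hl⟩ := LinearMap.exists_leftInverse_of_injective (weylSum σ)
    (LinearMap.ker_eq_bot.mpr (weylSum_injective hσ))
  set g : WeylAlgebra σ →ₗ[ℂ] ℂ := Finsupp.linearCombination ℂ f ∘ₗ l with hg
  have hgs : ∀ c, g (weylSum σ c) = Finsupp.linearCombination ℂ f c := fun c => by
    have : l (weylSum σ c) = c := DFunLike.congr_fun hl c
    simp [hg, this]
  have hgen : ∀ s, g (weylGen σ s) = f s := fun s => by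
    simpa using hgs (Finsupp.single s 1)
  have hpos := isPositiveOn_weylSpan hσ hf hgen
  have h1 : g 1 = 1 := by rw [← weylGen_zero, hgen, h0]
  have hb : ∀ c, ‖Finsupp.linearCombination ℂ f c‖ ≤ 1 * ‖weylSum σ c‖ := fun c => by
    rw [← hgs, one_mul]
    exact hpos.norm_le_of_weylSpan h1 (mem_weylSpan.mpr ⟨c, rfl⟩)
  set φ : WeylAlgebra σ →L[ℂ] ℂ := (Finsupp.linearCombination ℂ f).extendOfNorm (weylSum σ) with hφ
  have hφs : ∀ c, φ (weylSum σ c) = g (weylSum σ c) := fun c => by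
    rw [hgs]
    exact LinearMap.extendOfNorm_eq (denseRange_weylSum hσ) ⟨1, hb⟩ c
  have hφg : ∀ a ∈ weylSpan σ hσ, φ a = g a := fun a ha => by
    obtain ⟨c, rfl⟩ := mem_weylSpan.mp ha
    exact hφs c
  refine ⟨φ, ⟨?_, fun a => ?_⟩, fun s => ?_⟩
  · rw [hφg 1 (one_mem _), h1]
  · have hcont : Continuous fun a : WeylAlgebra σ => φ (star a * a) := by
      refine φ.continuous.comp ((Continuous.mul ?_ continuous_id))
      exact Continuous.subtype_mk (continuous_star.comp continuous_subtype_val) _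
    refine weyl_induction hσ (p := fun a => 0 ≤ (φ (star a * a)).re ∧ (φ (star a * a)).im = 0) a
      ?_ fun a ha => ?_
    · exact (isClosed_le continuous_const (Complex.continuous_re.comp hcont)).inter
        (isClosed_eq (Complex.continuous_im.comp hcont) continuous_const)
    · rw [hφg _ (mul_mem (star_mem ha) ha)]
      exact hpos a ha
  · rw [hφg _ (weylGen_mem_weylSpan hσ s), hgen]

/-- The test vectors are finitely supported, so each inequality involves finitely many entries. -/
theorem Matrix.PosSemidef.of_tendsto {ι : Type*} {K : ℕ → Matrix ι ι ℂ} {L : Matrix ι ι ℂ}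
    (hK : ∀ n, (K n).PosSemidef) (hL : ∀ i j, Tendsto (fun n => K n i j) atTop (𝓝 (L i j))) :
    L.PosSemidef := by
  refine ⟨?_, fun x => ?_⟩
  · ext i j
    rw [Matrix.conjTranspose_apply]
    refine tendsto_nhds_unique ((continuous_star.tendsto _).comp (hL j i)) ?_
    refine (hL i j).congr fun n => ?_
    exact ((hK n).1.apply i j).symm
  · have hlim : Tendsto (fun n => x.sum fun i xi => x.sum fun j xj => star xi * K n i j * xj) atTop
        (𝓝 (x.sum fun i xi => x.sum fun j xj => star xi * L i j * xj)) :=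
      tendsto_finsetSum _ fun i _ => tendsto_finsetSum _ fun j _ =>
        ((hL i j).const_mul _).mul_const _
    rw [Complex.le_def]
    have h := fun n => Complex.le_def.mp ((hK n).2 x)
    exact ⟨ge_of_tendsto' ((Complex.continuous_re.tendsto _).comp hlim) fun n => (h n).1,
      tendsto_nhds_unique (tendsto_const_nhds.congr fun n => (h n).2)
        ((Complex.continuous_im.tendsto _).comp hlim)⟩

/-- The entrywise exponential of a positive semidefinite matrix is positive semidefinite. -/
theorem Matrix.PosSemidef.exp_entries {ι : Type*} {K : Matrix ι ι ℂ} (hK : K.PosSemidef) :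
    (Matrix.of fun i j => Complex.exp (K i j)).PosSemidef := by
  -- Schur's product theorem for the entrywise powers; the zeroth one is the all-ones matrix, of
  -- rank one.
  have hpow : ∀ n : ℕ, (Matrix.of fun i j => K i j ^ n).PosSemidef := by
    intro n
    induction n with
    | zero =>
      refine ⟨by ext i j; simp, fun x => ?_⟩
      have : (x.sum fun i xi => x.sum fun j xj =>
          star xi * (Matrix.of fun i j => K i j ^ 0) i j * xj) =
          star (x.sum fun _ xi => xi) * (x.sum fun _ xi => xi) := by
        simp [Finsupp.sum, star_sum, Finset.sum_mul_sum]
      rw [this]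
      exact star_mul_self_nonneg _
    | succ n ih =>
      have := ih.hadamard hK
      convert! this using 1
  have hsum : ∀ N : ℕ, (∑ n ∈ Finset.range N,
      ((n.factorial : ℝ)⁻¹) • (Matrix.of fun i j => K i j ^ n)).PosSemidef := by
    intro N
    induction N with
    | zero => simpa using Matrix.PosSemidef.zero
    | succ N ih =>
      rw [Finset.sum_range_succ]
      exact ih.add ((hpow N).smul (by positivity))
  refine Matrix.PosSemidef.of_tendsto hsum fun i j => ?_
  have h := (NormedSpace.expSeries_div_hasSum_exp (K i j)).tendsto_sum_nat
  rw [← Complex.exp_eq_exp_ℂ] at h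
  refine h.congr fun N => ?_
  rw [Matrix.sum_apply]
  refine Finset.sum_congr rfl fun n _ => ?_
  simp [div_eq_inv_mul]

/-- A positive semidefinite kernel `μ - (i/2) σ` gives a quasifree state. -/
theorem exists_quasifree (hσ : σ.IsAlt) {lam : S → S → ℂ} (h2 : IsTwoPointFunction σ lam)
    (hpos : (Matrix.of lam).PosSemidef) :
    ∃ φ : WeylAlgebra σ →L[ℂ] ℂ, IsQuasifreeWith σ lam φ := by
  obtain ⟨μ, hsymm, -, -, hμ⟩ := id h2
  have hdiag : ∀ s, lam s s = μ s s := fun s => by rw [hμ, hσ s]; simp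
  obtain ⟨φ, hφ, hφs⟩ := exists_isState hσ (f := fun s => Complex.exp (-lam s s / 2))
    (by simp [hdiag]) (by
      have h1 := hpos.exp_entries
      set v : S → ℂ := fun s => Complex.exp (-lam s s / 2) with hv
      have h3 : (Matrix.of fun s t => star (v s) * v t).PosSemidef := by
        refine ⟨by ext i j; simp [mul_comm], fun x => ?_⟩
        have : (x.sum fun i xi => x.sum fun j xj =>
            star xi * (Matrix.of fun s t => star (v s) * v t) i j * xj) =
            star (x.sum fun i xi => v i * xi) * (x.sum fun i xi => v i * xi) := by
          simp only [Finsupp.sum, star_sum, Finset.sum_mul_sum, star_mul', Matrix.of_apply]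
          refine Finset.sum_congr rfl fun i _ => Finset.sum_congr rfl fun j _ => ?_
          ring
        rw [this]
        exact star_mul_self_nonneg _
      have h4 := h1.hadamard h3
      -- Since `μ(t-s,t-s) = μ(s,s) + μ(t,t) - 2μ(s,t)`, the kernel is `exp lam(s,t)` times the
      -- rank-one kernel `v(s) v(t)`; the Weyl cocycle is exactly the imaginary part of `lam`.
      have h5 : (Matrix.of fun s t => Complex.exp (-(Complex.I / 2 * σ s t)) *
          Complex.exp (-lam (t - s) (t - s) / 2)) =
          (Matrix.of fun i j => Complex.exp (Matrix.of lam i j)).hadamard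
            (Matrix.of fun s t => star (v s) * v t) := by
        ext s t
        have hvs : star (v s) = v s := by
          simp only [hv, hdiag, Complex.star_def, ← Complex.exp_conj]
          have h22 : starRingEnd ℂ 2 = 2 := Complex.conj_ofNat 2
          simp [h22]
        simp only [Matrix.hadamard_apply, Matrix.of_apply, hvs]
        simp only [hv, ← Complex.exp_add]
        congr 1
        simp only [hdiag, hμ s t, map_sub, LinearMap.sub_apply, hsymm t s]
        push_cast
        ring
      rw [IsTwistedPosDef, h5]
      exact h4)
  exact ⟨φ, hφ, h2, hφs⟩

end WeylStates

/-! ### Bounded holomorphic functions on the strip -/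

section Strip

/-- Bounded continuous functions on the strip `0 ≤ Im z ≤ β`, holomorphic in its interior. -/
def IsStripFun (β : ℝ) (F : ℂ → ℂ) : Prop :=
  ContinuousOn F {z | 0 ≤ z.im ∧ z.im ≤ β} ∧
  DifferentiableOn ℂ F {z | 0 < z.im ∧ z.im < β} ∧
  ∃ C : ℝ, ∀ z : ℂ, 0 ≤ z.im → z.im ≤ β → ‖F z‖ ≤ C

variable {β : ℝ} {F G : ℂ → ℂ}

theorem IsStripFun.add (hF : IsStripFun β F) (hG : IsStripFun β G) :
    IsStripFun β (fun z => F z + G z) := by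
  obtain ⟨h1, h2, C, h3⟩ := hF
  obtain ⟨k1, k2, D, k3⟩ := hG
  exact ⟨h1.add k1, h2.add k2, C + D, fun z a b =>
    (norm_add_le _ _).trans (add_le_add (h3 z a b) (k3 z a b))⟩

theorem IsStripFun.mul (hF : IsStripFun β F) (hG : IsStripFun β G) :
    IsStripFun β (fun z => F z * G z) := by
  obtain ⟨h1, h2, C, h3⟩ := hF
  obtain ⟨k1, k2, D, k3⟩ := hG
  refine ⟨h1.mul k1, h2.mul k2, C * D, fun z a b => ?_⟩
  rw [norm_mul]
  exact mul_le_mul (h3 z a b) (k3 z a b) (norm_nonneg _) ((norm_nonneg _).trans (h3 z a b))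

theorem isStripFun_const (c : ℂ) : IsStripFun β (fun _ => c) :=
  ⟨continuousOn_const, differentiableOn_const c, ‖c‖, fun _ _ _ => le_rfl⟩

theorem IsStripFun.exp (hF : IsStripFun β F) : IsStripFun β (fun z => Complex.exp (F z)) := by
  obtain ⟨h1, h2, C, h3⟩ := hF
  refine ⟨h1.cexp, h2.cexp, Real.exp C, fun z a b => ?_⟩
  rw [Complex.norm_exp]
  exact Real.exp_le_exp.mpr (((le_abs_self _).trans (Complex.abs_re_le_norm _)).trans (h3 z a b))

/-- The maximum principle on the strip. -/
theorem IsStripFun.norm_le (hβ : 0 < β) (hF : IsStripFun β F) {C : ℝ}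
    (h0 : ∀ t : ℝ, ‖F t‖ ≤ C) (h1 : ∀ t : ℝ, ‖F (t + β * Complex.I)‖ ≤ C) {z : ℂ}
    (hz : 0 ≤ z.im) (hz' : z.im ≤ β) : ‖F z‖ ≤ C := by
  obtain ⟨hc, hd, D, hD⟩ := hF
  have hcl : closure (Complex.im ⁻¹' Set.Ioo 0 β) = {z | 0 ≤ z.im ∧ z.im ≤ β} := by
    rw [Complex.closure_preimage_im, closure_Ioo hβ.ne]
    rfl
  refine PhragmenLindelof.horizontal_strip (a := 0) (b := β) (C := C) ⟨hd, ?_⟩ ?_ ?_ ?_ hz hz'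
  · rwa [hcl]
  · refine ⟨0, by simp; positivity, 0, ?_⟩
    refine Asymptotics.IsBigO.of_bound D ?_
    filter_upwards [mem_inf_of_right (mem_principal_self _)] with z hz
    simpa using hD z hz.1.le hz.2.le
  · intro z hz
    have : z = (z.re : ℂ) := Complex.ext (by simp) (by simp [hz])
    rw [this]
    exact h0 _
  · intro z hz
    have : z = (z.re : ℂ) + β * Complex.I := Complex.ext (by simp) (by simp [hz])
    rw [this]
    exact h1 _

/-- Limits of strip functions, controlled on the boundary. -/
theorem exists_isStripFun_of_boundary (hβ : 0 < β) {F : ℕ → ℂ → ℂ} (hF : ∀ n, IsStripFun β (F n))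
    {u v : ℝ → ℂ} {ε : ℕ → ℝ} (hε : Tendsto ε atTop (𝓝 0))
    (hu : ∀ n (t : ℝ), ‖F n t - u t‖ ≤ ε n) (hv : ∀ n (t : ℝ), ‖F n (t + β * Complex.I) - v t‖ ≤ ε n) :
    ∃ G, IsStripFun β G ∧ ∀ t : ℝ, G t = u t ∧ G (t + β * Complex.I) = v t := by
  set s : Set ℂ := {z | 0 ≤ z.im ∧ z.im ≤ β}
  -- The maximum principle spreads the closeness from the edges over the whole strip.
  have hdist : ∀ m n, ∀ z ∈ s, ‖F m z - F n z‖ ≤ ε m + ε n := by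
    intro m n z hz
    have hsub : IsStripFun β (fun z => F m z - F n z) := by
      simpa [sub_eq_add_neg] using (hF m).add ((isStripFun_const (-1)).mul (hF n))
    have tri : ∀ a b c : ℂ, ‖a - c‖ ≤ ε m → ‖b - c‖ ≤ ε n → ‖a - b‖ ≤ ε m + ε n := by
      intro a b c ha hb
      rw [← norm_neg, neg_sub] at hb
      calc ‖a - b‖ = ‖(a - c) + (c - b)‖ := by ring_nf
        _ ≤ _ := (norm_add_le _ _).trans (add_le_add ha hb)
    exact hsub.norm_le hβ (fun t => tri _ _ _ (hu m t) (hu n t))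
      (fun t => tri _ _ _ (hv m t) (hv n t)) hz.1 hz.2
  have hcau : UniformCauchySeqOn F atTop s := by
    rw [Metric.uniformCauchySeqOn_iff]
    intro δ hδ
    obtain ⟨N, hN⟩ := (hε.eventually (gt_mem_nhds (half_pos hδ))).exists_forall_of_atTop
    refine ⟨N, fun m hm n hn z hz => ?_⟩
    rw [dist_eq_norm]
    have := hN m hm
    have := hN n hn
    linarith [hdist m n z hz]
  -- Off the strip the value of the limit function is irrelevant.
  have hlim : ∀ z, ∃ w, z ∈ s → Tendsto (fun n => F n z) atTop (𝓝 w) := by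
    intro z
    by_cases hz : z ∈ s
    · obtain ⟨w, hw⟩ := cauchySeq_tendsto_of_complete (hcau.cauchySeq hz)
      exact ⟨w, fun _ => hw⟩
    · exact ⟨0, fun h => absurd h hz⟩
  choose G hG using hlim
  have hunif : TendstoUniformlyOn F G atTop s :=
    hcau.tendstoUniformlyOn_of_tendsto fun z hz => hG z hz
  have hsub : {z : ℂ | 0 < z.im ∧ z.im < β} ⊆ s := fun z hz => ⟨hz.1.le, hz.2.le⟩
  have hopen : IsOpen {z : ℂ | 0 < z.im ∧ z.im < β} :=
    (isOpen_lt continuous_const Complex.continuous_im).inter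
      (isOpen_lt Complex.continuous_im continuous_const)
  refine ⟨G, ⟨?_, ?_, ?_⟩, fun t => ⟨?_, ?_⟩⟩
  · exact hunif.continuousOn (Frequently.of_forall fun n => (hF n).1)
  · exact (hunif.mono hsub).tendstoLocallyUniformlyOn.differentiableOn
      (Eventually.of_forall fun n => (hF n).2.1) hopen
  · obtain ⟨C, hC⟩ := (hF 0).2.2
    refine ⟨C + (ε 0 + 0), fun z h1 h2 => ?_⟩
    have h3 : Tendsto (fun n => ‖F 0 z - F n z‖) atTop (𝓝 ‖F 0 z - G z‖) :=
      ((hG z ⟨h1, h2⟩).const_sub _).norm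
    have h4 : ‖F 0 z - G z‖ ≤ ε 0 + 0 :=
      le_of_tendsto_of_tendsto' h3 (hε.const_add _) fun n => hdist 0 n z ⟨h1, h2⟩
    calc ‖G z‖ = ‖F 0 z - (F 0 z - G z)‖ := by ring_nf
      _ ≤ _ := (norm_sub_le _ _).trans (add_le_add (hC z h1 h2) h4)
  · have hz : (t : ℂ) ∈ s := by simp [s, hβ.le]
    refine tendsto_nhds_unique (hG t hz) ?_
    rw [tendsto_iff_norm_sub_tendsto_zero]
    exact squeeze_zero (fun _ => norm_nonneg _) (fun n => hu n t) hε
  · have hz : (t : ℂ) + β * Complex.I ∈ s := by simp [s, hβ.le]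
    refine tendsto_nhds_unique (hG _ hz) ?_
    rw [tendsto_iff_norm_sub_tendsto_zero]
    exact squeeze_zero (fun _ => norm_nonneg _) (fun n => hv n t) hε

/-- A strip function with equal values on the two edges is constant. -/
theorem IsStripFun.eq_of_periodic (hβ : 0 < β) (hF : IsStripFun β F)
    (hper : ∀ t : ℝ, F (t + β * Complex.I) = F t) (t : ℝ) : F t = F 0 := by
  obtain ⟨hc, hd, C, hC⟩ := hF
  have hβ' : (β : ℂ) ≠ 0 := by exact_mod_cast hβ.ne'
  -- Up to the factor `1/β`, the Fourier coefficients of `F` on the vertical segment over `x`.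
  set a : ℤ → ℝ → ℂ := fun n x => ∫ y in (0 : ℝ)..β,
    Complex.exp (-(2 * Real.pi * n / β * Complex.I) * y) * F (x + y * Complex.I) with ha
  set e : ℤ → ℝ → ℂ := fun n x => Complex.exp (-(2 * Real.pi * n / β) * x)
  -- Cauchy's theorem for `exp(-2πnz/β) F(z)` on the rectangle between `0` and `x`: the horizontal
  -- sides cancel by periodicity.
  have hea : ∀ n x, e n x * a n x = a n 0 := by
    intro n x
    set G : ℂ → ℂ := fun z => Complex.exp (-(2 * Real.pi * n / β) * z) * F z with hG
    have h := Complex.integral_boundary_rect_eq_zero_of_continuousOn_of_differentiableOn G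
      (0 : ℂ) (x + β * Complex.I) ?_ ?_
    · simp only [Complex.add_re, Complex.ofReal_re, Complex.mul_re, Complex.I_re, Complex.I_im,
        Complex.ofReal_im, Complex.add_im, Complex.mul_im, Complex.zero_re, Complex.zero_im] at h
      have h1 : ∀ s : ℝ, G (s + β * Complex.I) = G s := by
        intro s
        simp only [hG, hper]
        congr 1
        rw [Complex.exp_eq_exp_iff_exists_int]
        refine ⟨-n, ?_⟩
        field_simp
        push_cast
        ring
      have h2 : ∀ s : ℝ, (∫ y in (0 : ℝ)..β, G (s + y * Complex.I)) = e n s * a n s := by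
        intro s
        rw [ha, ← intervalIntegral.integral_const_mul]
        refine intervalIntegral.integral_congr fun y _ => ?_
        simp only [hG, e]
        rw [← mul_assoc, ← Complex.exp_add]
        congr 2
        ring
      have h3 := h2 x
      have h4 := h2 0
      have h5 : e n 0 = 1 := by simp [e]
      rw [h5, one_mul] at h4
      simp only [mul_zero, mul_one, zero_mul, sub_zero, add_zero, zero_add, Complex.ofReal_zero, h1]
        at h h4
      rw [h4, h3, sub_self, zero_add, sub_eq_zero] at h
      simpa using h
    · refine ContinuousOn.mul (by fun_prop) (hc.mono fun z hz => ?_)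
      rw [Complex.mem_reProdIm] at hz
      simpa [Set.uIcc_of_le hβ.le] using hz.2
    · refine DifferentiableOn.mul (by fun_prop) (hd.mono fun z hz => ?_)
      rw [Complex.mem_reProdIm] at hz
      simpa [hβ.le] using hz.2
  have hab : ∀ n x, ‖a n x‖ ≤ C * β := by
    intro n x
    have := intervalIntegral.norm_integral_le_of_norm_le_const (a := 0) (b := β) (C := C)
      (f := fun y : ℝ => Complex.exp (-(2 * Real.pi * n / β * Complex.I) * y) *
        F (x + y * Complex.I)) (fun y hy => by
          rw [Set.uIoc_of_le hβ.le] at hy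
          have h1 : ‖Complex.exp (-(2 * Real.pi * n / β * Complex.I) * y)‖ = 1 := by
            have : -(2 * Real.pi * n / β * Complex.I) * y =
              ((-(2 * Real.pi * n / β * y) : ℝ) : ℂ) * Complex.I := by push_cast; ring
            rw [this, Complex.norm_exp_ofReal_mul_I]
          rw [norm_mul, h1, one_mul]
          exact hC _ (by simpa using hy.1.le) (by simpa using hy.2))
    rwa [sub_zero, abs_of_pos hβ] at this
  -- The coefficients are bounded in `x`, while `e n x` tends to `0` at one end of the line.
  have ha0 : ∀ n : ℤ, n ≠ 0 → ∀ x, a n x = 0 := by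
    intro n hn
    have hnorm : ∀ x : ℝ, ‖e n x‖ = Real.exp (-(2 * Real.pi * n / β) * x) := by
      intro x
      have : (-(2 * Real.pi * n / β) * x : ℂ) = ((-(2 * Real.pi * n / β) * x : ℝ) : ℂ) := by
        push_cast; ring
      simp only [e]
      rw [this, Complex.norm_exp_ofReal]
    have hle : ∀ x, ‖a n 0‖ ≤ Real.exp (-(2 * Real.pi * n / β) * x) * (C * β) := by
      intro x
      rw [← hea n x, norm_mul, hnorm]
      have := hab n x
      gcongr
    have hz : a n 0 = 0 := by
      have hne : 2 * Real.pi * n / β ≠ 0 := by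
        have : (n : ℝ) ≠ 0 := by exact_mod_cast hn
        positivity
      have hlim : Tendsto (fun r : ℝ => Real.exp (-r) * (C * β)) atTop (𝓝 (0 * (C * β))) :=
        (Real.tendsto_exp_neg_atTop_nhds_zero).mul_const _
      rw [zero_mul] at hlim
      refine norm_le_zero_iff.mp (ge_of_tendsto' hlim fun r => ?_)
      have := hle (r / (2 * Real.pi * n / β))
      rwa [neg_mul, mul_div_cancel₀ _ hne] at this
    intro x
    have := hea n x
    rw [hz] at this
    exact (mul_eq_zero.mp this).resolve_left (Complex.exp_ne_zero _)
  -- Only the zeroth coefficient is left, and it does not depend on `x`; sum the Fourier series at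
  -- `y = 0`.
  have hval : ∀ x : ℝ, F x = (1 / β : ℝ) • a 0 0 := by
    intro x
    have : Fact (0 < β) := ⟨hβ⟩
    set f : ℝ → ℂ := fun y => F (x + y * Complex.I) with hf
    have hfc : ContinuousOn f (Set.Icc 0 (0 + β)) := by
      refine hc.comp (by fun_prop) fun y hy => ?_
      simpa using hy
    have hf0 : f 0 = f (0 + β) := by simp [hf, hper]
    set g : C(AddCircle β, ℂ) := ⟨AddCircle.liftIco β 0 f, AddCircle.liftIco_continuous hf0 hfc⟩
    have hcoef : ∀ n, fourierCoeff g n = (1 / β : ℝ) • a n x := by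
      intro n
      have h1 : fourierCoeff g n = fourierCoeffOn (lt_add_of_pos_right 0 hβ) f n :=
        fourierCoeff_liftIco_eq f n
      rw [h1, fourierCoeffOn_eq_integral]
      simp only [zero_add, sub_zero, ha]
      congr 1
      refine intervalIntegral.integral_congr fun y _ => ?_
      simp only [fourier_coe_apply, smul_eq_mul, hf]
      congr 2
      push_cast
      rw [zero_add, sub_zero]
      field_simp
    have hsum : Summable (fourierCoeff g) := by
      refine summable_of_ne_finset_zero (s := {0}) fun n hn => ?_
      rw [hcoef, ha0 n (by simpa using hn), smul_zero]
    have h2 := has_pointwise_sum_fourier_series_of_summable hsum ((0 : ℝ) : AddCircle β)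
    have h3 : HasSum (fun i => fourierCoeff g i • fourier i ((0 : ℝ) : AddCircle β))
        ((1 / β : ℝ) • a 0 x) := by
      convert hasSum_single (0 : ℤ) _ using 1
      · simp [hcoef]
      · intro n hn
        rw [hcoef, ha0 n hn, smul_zero, zero_smul]
    have h4 : g ((0 : ℝ) : AddCircle β) = F x := by
      change AddCircle.liftIco β 0 f ((0 : ℝ) : AddCircle β) = F x
      rw [AddCircle.liftIco_coe_apply (by simp [hβ])]
      simp [hf]
    rw [← h4, h2.unique h3]
    congr 1
    have := hea 0 x
    simpa [e] using this
  rw [hval t]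
  exact_mod_cast (hval 0).symm

end Strip

/-! ### The KMS condition on a total set -/

section KMS

variable {A : Type*} [NormedRing A] [NormedAlgebra ℂ A]

theorem isKMS_iff {α : ℝ → A → A} {β : ℝ} {φ : A →L[ℂ] ℂ} :
    IsKMS α β φ ↔ ∀ a b : A, ∃ F, IsStripFun β F ∧
      ∀ t : ℝ, F t = φ (a * α t b) ∧ F (t + β * Complex.I) = φ (α t b * a) := by
  simp only [IsKMS, IsStripFun, and_assoc]

/-- The KMS condition has to be checked on a total set only. -/
theorem isKMS_of_dense {β : ℝ} (hβ : 0 < β) {α : ℝ → A →ₗ[ℂ] A} (hα : ∀ t a, ‖α t a‖ = ‖a‖)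
    {φ : A →L[ℂ] ℂ} {X : Set A} (hX : Dense (Submodule.span ℂ X : Set A))
    (h : ∀ a ∈ X, ∀ b ∈ X, ∃ F, IsStripFun β F ∧
      ∀ t : ℝ, F t = φ (a * α t b) ∧ F (t + β * Complex.I) = φ (α t b * a)) :
    IsKMS (fun t => α t) β φ := by
  rw [isKMS_iff]
  -- `q` collects the two edge values as a function linear in one argument. The step is applied
  -- twice, first to extend the second algebra element and then the first.
  have key : ∀ (q : ℝ → A → A → ℂ × ℂ),
      (∀ t b, ∀ a a', q t b (a + a') = q t b a + q t b a') →
      (∀ t b, ∀ (c : ℂ) a, q t b (c • a) = c • q t b a) →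
      (∀ b, ∃ D : ℝ, ∀ t a, ‖q t b a‖ ≤ D * ‖a‖) → ∀ b,
      (∀ a ∈ X, ∃ F, IsStripFun β F ∧
        ∀ t : ℝ, F t = (q t b a).1 ∧ F (t + β * Complex.I) = (q t b a).2) →
      ∀ a, ∃ F, IsStripFun β F ∧
        ∀ t : ℝ, F t = (q t b a).1 ∧ F (t + β * Complex.I) = (q t b a).2 := by
    intro q hadd hsmul hbd b hb
    have hspan : ∀ a ∈ Submodule.span ℂ X, ∃ F, IsStripFun β F ∧
        ∀ t : ℝ, F t = (q t b a).1 ∧ F (t + β * Complex.I) = (q t b a).2 := by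
      intro a ha
      induction ha using Submodule.span_induction with
      | mem a ha => exact hb a ha
      | zero =>
        have h0 : ∀ t, q t b 0 = 0 := fun t => by simpa using hsmul t b 0 0
        exact ⟨fun _ => 0, isStripFun_const 0, fun t => by simp [h0]⟩
      | add a a' _ _ h1 h2 =>
        obtain ⟨F, hF, hF'⟩ := h1
        obtain ⟨G, hG, hG'⟩ := h2
        exact ⟨_, hF.add hG, fun t => by simp [hadd, hF', hG']⟩
      | smul c a _ h1 =>
        obtain ⟨F, hF, hF'⟩ := h1
        exact ⟨_, (isStripFun_const c).mul hF, fun t => by simp [hsmul, hF']⟩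
    intro a
    obtain ⟨x, hx, hxa⟩ := mem_closure_iff_seq_limit.mp (hX a)
    choose F hF hF' using fun n => hspan (x n) (hx n)
    obtain ⟨D, hD⟩ := hbd b
    have hsub : ∀ t n, q t b (x n) - q t b a = q t b (x n - a) := fun t n => by
      rw [sub_eq_add_neg (x n), hadd, ← neg_one_smul ℂ a, hsmul, neg_one_smul, sub_eq_add_neg]
    refine exists_isStripFun_of_boundary hβ hF (ε := fun n => D * ‖x n - a‖)
      (u := fun t => (q t b a).1) (v := fun t => (q t b a).2) ?_ ?_ ?_
    · have := (tendsto_iff_norm_sub_tendsto_zero.mp hxa).const_mul D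
      rwa [mul_zero] at this
    · intro n t
      rw [(hF' n t).1, ← Prod.fst_sub, hsub]
      exact (norm_fst_le _).trans (hD t _)
    · intro n t
      rw [(hF' n t).2, ← Prod.snd_sub, hsub]
      exact (norm_snd_le _).trans (hD t _)
  have hφ : ∀ x y : A, ‖φ (x * y)‖ ≤ ‖φ‖ * (‖x‖ * ‖y‖) := fun x y =>
    (φ.le_opNorm _).trans (by gcongr; exact norm_mul_le _ _)
  have h1 : ∀ a ∈ X, ∀ b, ∃ F, IsStripFun β F ∧
      ∀ t : ℝ, F t = φ (a * α t b) ∧ F (t + β * Complex.I) = φ (α t b * a) := by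
    intro a ha
    refine key (fun t a b => (φ (a * α t b), φ (α t b * a))) ?_ ?_ ?_ a (h a ha)
    · intro t b a a'
      simp [mul_add, add_mul]
    · intro t b c a
      simp
    · intro a
      refine ⟨‖φ‖ * ‖a‖, fun t b => norm_prod_le_iff.mpr ⟨(hφ _ _).trans ?_, (hφ _ _).trans ?_⟩⟩
      · rw [hα, mul_assoc]
      · rw [hα, mul_assoc, mul_comm ‖b‖]
  intro a b
  refine key (fun t b a => (φ (a * α t b), φ (α t b * a))) ?_ ?_ ?_ b (fun a ha => h1 a ha b) a
  · intro t b a a'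
    simp [mul_add, add_mul]
  · intro t b c a
    simp
  · intro b
    refine ⟨‖φ‖ * ‖b‖, fun t a => norm_prod_le_iff.mpr ⟨(hφ _ _).trans ?_, (hφ _ _).trans ?_⟩⟩
    · rw [hα, mul_assoc, mul_comm ‖b‖]
    · rw [hα, mul_assoc]

end KMS

/-! ### Transformation rules for the Fourier-Plancherel transform of vector-valued functions -/

section FourierL2

variable {H : Type*} [NormedAddCommGroup H] [InnerProductSpace ℂ H] [CompleteSpace H]

omit [CompleteSpace H] in
theorem integrable_smul_of_memLp_two {c : ℝ → ℂ} {u : ℝ → H} (hc : MemLp c 2 volume)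
    (hu : MemLp u 2 volume) : Integrable (fun x => c x • u x) :=
  memLp_one_iff_integrable.mp (hu.smul (r := 1) hc)

theorem memLp_two_of_compact {φ : ℝ → ℂ} (hφ : ContDiff ℝ ∞ φ) (hc : HasCompactSupport φ) :
    MemLp φ 2 (volume : Measure ℝ) := by
  have h := (hc.toSchwartzMap hφ).memLp 2 (volume : Measure ℝ)
  exact h

theorem memLp_two_fourier_of_compact {φ : ℝ → ℂ} (hφ : ContDiff ℝ ∞ φ)
    (hc : HasCompactSupport φ) : MemLp (𝓕 φ) 2 (volume : Measure ℝ) := by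
  have h := (𝓕 (hc.toSchwartzMap hφ) : SchwartzMap ℝ ℂ).memLp 2 (volume : Measure ℝ)
  exact h

/-- The transform on `L²` is compatible with the one on tempered distributions, which is defined by
duality. -/
theorem integral_schwartz_smul_fourier (f : Lp H 2 (volume : Measure ℝ)) (φ : SchwartzMap ℝ ℂ) :
    ∫ x, φ x • (𝓕 f : Lp H 2 (volume : Measure ℝ)) x = ∫ x, (𝓕 φ) x • f x := by
  rw [← Lp.toTemperedDistribution_apply, ← Lp.fourier_toTemperedDistribution_eq,
    TemperedDistribution.fourier_apply, Lp.toTemperedDistribution_apply]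

theorem integral_smul_fourier (f : Lp H 2 (volume : Measure ℝ)) {φ : ℝ → ℂ} (hφ : ContDiff ℝ ∞ φ)
    (hc : HasCompactSupport φ) :
    ∫ x, φ x • (𝓕 f : Lp H 2 (volume : Measure ℝ)) x = ∫ x, (𝓕 φ) x • f x :=
  integral_schwartz_smul_fourier f (hc.toSchwartzMap hφ)

/-- There is no pointwise formula for the transform on `L²`, so the rules below are checked weakly,
with the transform moved to the test function. -/
theorem fourier_ae_eq_of_test {f : Lp H 2 (volume : Measure ℝ)} {u : ℝ → H}
    (hu : LocallyIntegrable u)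
    (h : ∀ g : ℝ → ℝ, ContDiff ℝ ∞ g → HasCompactSupport g →
      ∫ x, (𝓕 (fun x => (g x : ℂ))) x • f x = ∫ x, g x • u x) :
    (𝓕 f : Lp H 2 (volume : Measure ℝ)) =ᵐ[volume] u := by
  refine ae_eq_of_integral_contDiff_smul_eq ((Lp.memLp _).locallyIntegrable (by norm_num)) hu
    fun g hg hc => ?_
  have hc' : HasCompactSupport (fun x => (g x : ℂ)) := hc.comp_left (g := Complex.ofReal) rfl
  have hg' : ContDiff ℝ ∞ (fun x => (g x : ℂ)) := Complex.ofRealCLM.contDiff.comp hg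
  rw [← h g hg hc, ← integral_smul_fourier f hg' hc']
  rfl

theorem fourier_ae_eq_mul {f f' : Lp H 2 (volume : Measure ℝ)} {m : ℝ → ℂ} (hm : ContDiff ℝ ∞ m)
    (h : ∀ φ : ℝ → ℂ, ContDiff ℝ ∞ φ → HasCompactSupport φ →
      ∫ x, (𝓕 φ) x • f' x = ∫ x, (𝓕 (fun x => φ x * m x)) x • f x) :
    (𝓕 f' : Lp H 2 (volume : Measure ℝ)) =ᵐ[volume]
      fun x => m x • (𝓕 f : Lp H 2 (volume : Measure ℝ)) x := by
  refine fourier_ae_eq_of_test ?_ fun g hg hc => ?_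
  · exact ((Lp.memLp _).locallyIntegrable (by norm_num)).continuous_smul hm.continuous
  · have hg' : ContDiff ℝ ∞ (fun x => (g x : ℂ)) := Complex.ofRealCLM.contDiff.comp hg
    have hc' : HasCompactSupport (fun x => (g x : ℂ)) := hc.comp_left (g := Complex.ofReal) rfl
    rw [h _ hg' hc', ← integral_smul_fourier f (hg'.mul hm) hc'.mul_right]
    refine integral_congr_ae (Eventually.of_forall fun x => ?_)
    simp [mul_smul]

theorem fourier_ae_eq_translate {f f' : Lp H 2 (volume : Measure ℝ)} (s : ℝ)
    (h : f' =ᵐ[volume] fun x => f (x - s)) :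
    (𝓕 f' : Lp H 2 (volume : Measure ℝ)) =ᵐ[volume]
      fun x => Complex.exp ((-(2 * Real.pi * s * x) : ℝ) * Complex.I) •
        (𝓕 f : Lp H 2 (volume : Measure ℝ)) x := by
  refine fourier_ae_eq_mul ?_ fun φ hφ hc => ?_
  · have h1 : ContDiff ℝ ∞ (fun x : ℝ => -(2 * Real.pi * s * x)) := by fun_prop
    exact ((Complex.ofRealCLM.contDiff.comp h1).mul contDiff_const).cexp
  · have h0 : ∫ x, (𝓕 φ) x • f' x = ∫ x, (𝓕 φ) x • f (x - s) :=
      integral_congr_ae (h.mono fun x hx => congrArg ((𝓕 φ) x • ·) hx)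
    rw [h0, ← integral_add_right_eq_self (μ := volume) (fun x : ℝ => (𝓕 φ : ℝ → ℂ) x • f (x - s)) s]
    simp only [add_sub_cancel_right]
    refine integral_congr_ae (Eventually.of_forall fun x => ?_)
    simp only
    congr 1
    simp only [Real.fourier_real_eq_integral_exp_smul, smul_eq_mul]
    refine integral_congr_ae (Eventually.of_forall fun y => ?_)
    simp only
    rw [mul_left_comm, mul_comm, ← Complex.exp_add]
    congr 2
    push_cast
    ring

/-- Integration by parts against `𝓕 φ`. No decay of `γ` is needed: square integrability of `γ` and
`γ'` makes all the products integrable, and this already removes the boundary terms. -/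
theorem fourier_ae_eq_deriv {f f' : Lp H 2 (volume : Measure ℝ)} {γ γ' : ℝ → H}
    (hf : f =ᵐ[volume] γ) (hf' : f' =ᵐ[volume] γ') (hγ : ∀ x, HasDerivAt γ (γ' x) x) :
    (𝓕 f' : Lp H 2 (volume : Measure ℝ)) =ᵐ[volume]
      fun x => ((2 * Real.pi * x : ℝ) * Complex.I) • (𝓕 f : Lp H 2 (volume : Measure ℝ)) x := by
  have hγm : MemLp γ 2 volume := (Lp.memLp f).ae_eq hf
  have hγm' : MemLp γ' 2 volume := (Lp.memLp f').ae_eq hf'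
  refine fourier_ae_eq_mul ?_ fun φ hφ hc => ?_
  · have h1 : ContDiff ℝ ∞ (fun x : ℝ => 2 * Real.pi * x) := by fun_prop
    exact (Complex.ofRealCLM.contDiff.comp h1).mul contDiff_const
  · set φs : SchwartzMap ℝ ℂ := hc.toSchwartzMap hφ
    set m : ℝ → ℂ := fun x => ((2 * Real.pi * x : ℝ) : ℂ) * Complex.I with hm
    have hmr : ContDiff ℝ ∞ (fun x : ℝ => 2 * Real.pi * x) := by fun_prop
    have hmc : ContDiff ℝ ∞ m := (Complex.ofRealCLM.contDiff.comp hmr).mul contDiff_const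
    set ψs : SchwartzMap ℝ ℂ := (hc.mul_right (f' := m)).toSchwartzMap (hφ.mul hmc)
    have hd : ∀ x, HasDerivAt (𝓕 φs : SchwartzMap ℝ ℂ) (-((𝓕 ψs : SchwartzMap ℝ ℂ) x)) x := by
      intro x
      have h1 := (Real.hasDerivAt_fourier (f := φ)
        (φs.integrable (μ := volume)) (by
          have := (ψs.integrable (μ := volume)).const_mul ((2 * Real.pi * Complex.I)⁻¹)
          refine this.congr (Eventually.of_forall fun y => ?_)
          change (2 * Real.pi * Complex.I)⁻¹ * (φ y * m y) = _
          simp only [hm, Complex.real_smul]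
          push_cast
          have : (Real.pi : ℂ) ≠ 0 := by exact_mod_cast Real.pi_ne_zero
          field_simp [Complex.I_ne_zero]) x)
      refine h1.congr_deriv ?_
      have h2 : (𝓕 ψs : SchwartzMap ℝ ℂ) x = (𝓕 (fun x => φ x * m x)) x := rfl
      rw [h2]
      simp only [Real.fourier_real_eq_integral_exp_smul]
      rw [← integral_neg]
      refine integral_congr_ae (Eventually.of_forall fun y => ?_)
      simp only [hm, smul_eq_mul]
      push_cast
      ring
    have key := integral_bilinear_hasDerivAt_right_eq_neg_left_of_integrable
      (L := (ContinuousLinearMap.lsmul ℝ ℂ : ℂ →L[ℝ] H →L[ℝ] H)) (u := fun x => (𝓕 φs : SchwartzMap ℝ ℂ) x)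
      (u' := fun x => -((𝓕 ψs : SchwartzMap ℝ ℂ) x)) (v := γ) (v' := γ') (fun x _ => hd x) (fun x _ => hγ x) ?_ ?_ ?_
    · simp only [ContinuousLinearMap.lsmul_apply, neg_smul, integral_neg, neg_neg] at key
      have e1 : ∫ x, (𝓕 φ) x • f' x = ∫ x, (𝓕 φ) x • γ' x :=
        integral_congr_ae (hf'.mono fun x hx => congrArg ((𝓕 φ) x • ·) hx)
      have e2 : ∫ x, (𝓕 (fun x => φ x * m x)) x • f x = ∫ x, (𝓕 (fun x => φ x * m x)) x • γ x :=
        integral_congr_ae (hf.mono fun x hx => congrArg ((𝓕 (fun x => φ x * m x)) x • ·) hx)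
      rw [e1, e2]
      exact key
    · exact integrable_smul_of_memLp_two (memLp_two_fourier_of_compact hφ hc) hγm'
    · exact integrable_smul_of_memLp_two (memLp_two_fourier_of_compact (hφ.mul hmc) hc.mul_right).neg hγm
    · exact integrable_smul_of_memLp_two (memLp_two_fourier_of_compact hφ hc) hγm

theorem fourier_ae_eq_comp {f f' : Lp H 2 (volume : Measure ℝ)} (U : H →L[ℂ] H)
    (h : f' =ᵐ[volume] fun x => U (f x)) :
    (𝓕 f' : Lp H 2 (volume : Measure ℝ)) =ᵐ[volume]
      fun x => U ((𝓕 f : Lp H 2 (volume : Measure ℝ)) x) := by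
  refine fourier_ae_eq_of_test ?_ fun g hg hc => ?_
  · exact (U.comp_memLp (𝓕 f : Lp H 2 (volume : Measure ℝ))).locallyIntegrable (by norm_num)
  · have hg' : ContDiff ℝ ∞ (fun x => (g x : ℂ)) := Complex.ofRealCLM.contDiff.comp hg
    have hc' : HasCompactSupport (fun x => (g x : ℂ)) := hc.comp_left (g := Complex.ofReal) rfl
    have h1 : ∀ x, g x • U ((𝓕 f : Lp H 2 (volume : Measure ℝ)) x) =
        U ((g x : ℂ) • (𝓕 f : Lp H 2 (volume : Measure ℝ)) x) := fun x => by
      rw [map_smul]; rfl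
    have h2 : ∀ (c : ℝ → ℂ) x, c x • U (f x) = U (c x • f x) := fun c x => by rw [map_smul]
    rw [integral_congr_ae (h.mono fun x hx => congrArg ((𝓕 (fun x => (g x : ℂ))) x • ·) hx)]
    simp only [h1, h2]
    rw [ContinuousLinearMap.integral_comp_comm, ContinuousLinearMap.integral_comp_comm,
      integral_smul_fourier f hg' hc']
    · exact integrable_smul_of_memLp_two (memLp_two_of_compact hg' hc') (Lp.memLp _)
    · exact integrable_smul_of_memLp_two (memLp_two_fourier_of_compact hg' hc') (Lp.memLp _)

/-- For real `g`, the conjugate of the transform of `x ↦ g(-x)` is the transform of `g`; the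
antilinear `J` plays the role of conjugation on `H`. -/
theorem fourier_ae_eq_conj {f : Lp H 2 (volume : Measure ℝ)} (J : H →L[ℝ] H)
    (hJ : ∀ (c : ℂ) x, J (c • x) = starRingEnd ℂ c • J x) (h : f =ᵐ[volume] fun x => J (f x)) :
    (𝓕 f : Lp H 2 (volume : Measure ℝ)) =ᵐ[volume]
      fun x => J ((𝓕 f : Lp H 2 (volume : Measure ℝ)) (-x)) := by
  refine fourier_ae_eq_of_test ?_ fun g hg hc => ?_
  · refine MemLp.locallyIntegrable (p := 2) ?_ (by norm_num)
    exact (J.comp_memLp (𝓕 f : Lp H 2 (volume : Measure ℝ))).comp_measurePreserving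
      (Measure.measurePreserving_neg volume)
  · have hg' : ContDiff ℝ ∞ (fun x => ((g (-x) : ℝ) : ℂ)) :=
      Complex.ofRealCLM.contDiff.comp (hg.comp contDiff_neg)
    have hc' : HasCompactSupport (fun x => ((g (-x) : ℝ) : ℂ)) :=
      (hc.comp_left (g := Complex.ofReal) rfl).comp_homeomorph (Homeomorph.neg ℝ)
    have h1 : ∀ x, g x • J ((𝓕 f : Lp H 2 (volume : Measure ℝ)) (-x)) =
        J ((g x : ℂ) • (𝓕 f : Lp H 2 (volume : Measure ℝ)) (-x)) := fun x => by
      rw [hJ, Complex.conj_ofReal]; rfl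
    have h2 : ∀ x, (𝓕 (fun x => (g x : ℂ))) x • J (f x) =
        J ((𝓕 (fun x => ((g (-x) : ℝ) : ℂ))) x • f x) := fun x => by
      rw [hJ]
      congr 1
      simp only [Real.fourier_real_eq_integral_exp_smul, ← integral_conj]
      rw [← integral_neg_eq_self]
      refine integral_congr_ae (Eventually.of_forall fun y => ?_)
      simp only [smul_eq_mul, map_mul, Complex.conj_ofReal, ← Complex.exp_conj, Complex.conj_I]
      congr 2
      push_cast
      ring
    rw [integral_congr_ae (h.mono fun x hx => congrArg ((𝓕 (fun x => (g x : ℂ))) x • ·) hx)]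
    simp only [h1, h2]
    have h3 : ∫ x, (g x : ℂ) • (𝓕 f : Lp H 2 (volume : Measure ℝ)) (-x) =
        ∫ x, ((g (-x) : ℝ) : ℂ) • (𝓕 f : Lp H 2 (volume : Measure ℝ)) x := by
      rw [← integral_neg_eq_self]
      simp
    rw [ContinuousLinearMap.integral_comp_comm, ContinuousLinearMap.integral_comp_comm,
      ← integral_smul_fourier f hg' hc', h3]
    · refine integrable_smul_of_memLp_two ?_ ((Lp.memLp
        (𝓕 f : Lp H 2 (volume : Measure ℝ))).comp_measurePreserving
          (Measure.measurePreserving_neg volume))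
      have := (memLp_two_of_compact hg' hc').comp_measurePreserving
        (Measure.measurePreserving_neg volume)
      refine this.ae_eq (Eventually.of_forall fun x => ?_)
      change ((g (- -x) : ℝ) : ℂ) = _
      rw [neg_neg]
    · exact integrable_smul_of_memLp_two (memLp_two_fourier_of_compact hg' hc') (Lp.memLp _)

end FourierL2

/-! ### Functions on `ℝ × S²` as curves in `L²(S²)` -/

section Slices

/-- The class of `g(v, ·)` in `L²(S²; ℂ)`. -/
def contSlice (g : C(Scri, ℝ)) (v : ℝ) : L2S :=
  ContinuousMap.toLp 2 sphereMeasure ℂ ⟨fun n => (g (v, n) : ℂ), by fun_prop⟩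

/-- The curve `v ↦ g(v, ·)` of continuous functions on the sphere. -/
def sliceCurve (g : C(Scri, ℝ)) : C(ℝ, C(Sphere2, ℂ)) :=
  ContinuousMap.curry ⟨fun p => (g p : ℂ), by fun_prop⟩

theorem coeFn_contSlice (g : C(Scri, ℝ)) (v : ℝ) :
    contSlice g v =ᵐ[sphereMeasure] fun n => (g (v, n) : ℂ) :=
  ContinuousMap.coeFn_toLp (p := 2) (𝕜 := ℂ) sphereMeasure _

theorem continuous_contSlice (g : C(Scri, ℝ)) : Continuous (contSlice g) :=
  (ContinuousMap.toLp (E := ℂ) 2 sphereMeasure ℂ).continuous.comp (sliceCurve g).continuous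

theorem memLp_contSlice {g : C(Scri, ℝ)} (hg : MemLp g 2 scriMeasure) :
    MemLp (contSlice g) 2 volume := by
  refine ⟨(continuous_contSlice g).aestronglyMeasurable, ?_⟩
  have h2 : (2 : ENNReal) ≠ 0 := by norm_num
  have h2' : (2 : ENNReal) ≠ ⊤ := by norm_num
  have hΦ := hg.eLpNorm_lt_top
  rw [eLpNorm_lt_top_iff_lintegral_rpow_enorm_lt_top h2 h2'] at hΦ ⊢
  refine lt_of_eq_of_lt ?_ hΦ
  rw [scriMeasure, lintegral_prod _ (by have := g.continuous.measurable; fun_prop)]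
  refine lintegral_congr fun v => ?_
  rw [Lp.enorm_def, eLpNorm_eq_lintegral_rpow_enorm_toReal h2 h2', ← ENNReal.rpow_mul]
  have h3 : 1 / (2 : ENNReal).toReal * (2 : ENNReal).toReal = 1 := by norm_num
  rw [h3, ENNReal.rpow_one]
  refine lintegral_congr_ae ?_
  filter_upwards [coeFn_contSlice g v] with n hn
  rw [hn]
  simp [enorm_eq_nnnorm]

theorem inner_contSlice (g g' : C(Scri, ℝ)) (v : ℝ) :
    inner ℂ (contSlice g v) (contSlice g' v) = ((∫ n, g (v, n) * g' (v, n) ∂sphereMeasure : ℝ) : ℂ) := by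
  rw [contSlice, contSlice, ContinuousMap.inner_toLp, ← integral_complex_ofReal]
  refine integral_congr_ae (Eventually.of_forall fun n => ?_)
  simp [mul_comm]

theorem integral_inner_contSlice {g g' : C(Scri, ℝ)} (hg : MemLp g 2 scriMeasure)
    (hg' : MemLp g' 2 scriMeasure) :
    ∫ v, inner ℂ (contSlice g v) (contSlice g' v) = ((∫ p, g p * g' p ∂scriMeasure : ℝ) : ℂ) := by
  simp only [inner_contSlice]
  rw [integral_complex_ofReal, scriMeasure, integral_prod (fun p => g p * g' p) (hg.integrable_mul hg')]

/-- In a chart of the sphere, `∂_v` is the Fréchet derivative in the direction `(1, 0)`, jointly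
continuous by smoothness. -/
theorem IsSmoothScri.continuous_vDeriv {Φ : Scri → ℝ} (h : IsSmoothScri Φ) :
    Continuous (vDeriv Φ) := by
  rw [continuous_iff_continuousAt]
  rintro ⟨v₀, n₀⟩
  set e := extChartAt (𝓡 2) n₀ with he
  set g : ℝ × EuclideanSpace ℝ (Fin 2) → ℝ := fun q => Φ (q.1, e.symm q.2) with hg
  have hopen : IsOpen (Set.univ ×ˢ e.target : Set (ℝ × EuclideanSpace ℝ (Fin 2))) :=
    isOpen_univ.prod (isOpen_extChartAt_target n₀)
  have hgs : ContDiffOn ℝ ∞ g (Set.univ ×ˢ e.target) := by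
    have hm : ContMDiffOn (𝓘(ℝ, ℝ).prod 𝓘(ℝ, EuclideanSpace ℝ (Fin 2))) 𝓘(ℝ, ℝ) ∞ g
        (Set.univ ×ˢ e.target) :=
      ContMDiff.comp_contMDiffOn h
        ((contMDiffOn_id (s := Set.univ)).prodMap (contMDiffOn_extChartAt_symm n₀))
    rw [← contMDiffOn_iff_contDiffOn]
    rw [modelWithCornersSelf_prod, ← chartedSpaceSelf_prod]
    exact hm
  have hfd : ContinuousOn (fderiv ℝ g) (Set.univ ×ˢ e.target) :=
    hgs.continuousOn_fderiv_of_isOpen hopen (by simp)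
  have hsrc : ∀ᶠ p : Scri in 𝓝 (v₀, n₀), p.2 ∈ e.source :=
    continuous_snd.continuousAt.eventually (extChartAt_source_mem_nhds n₀)
  have heq : ∀ p : Scri, p.2 ∈ e.source → vDeriv Φ p = fderiv ℝ g (p.1, e p.2) (1, 0) := by
    intro p hp
    have hmem : (p.1, e p.2) ∈ (Set.univ ×ˢ e.target : Set (ℝ × EuclideanSpace ℝ (Fin 2))) :=
      ⟨trivial, e.map_source hp⟩
    have hd : HasFDerivAt g (fderiv ℝ g (p.1, e p.2)) (p.1, e p.2) :=
      ((hgs.differentiableOn (by simp)).differentiableAt (hopen.mem_nhds hmem)).hasFDerivAt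
    have hcurve : HasDerivAt (fun v : ℝ => (v, e p.2)) ((1 : ℝ), (0 : EuclideanSpace ℝ (Fin 2))) p.1 :=
      (hasDerivAt_id p.1).prodMk (hasDerivAt_const p.1 (e p.2))
    have hcomp := hd.comp_hasDerivAt p.1 hcurve
    have hfun : (g ∘ fun v : ℝ => (v, e p.2)) = fun v => Φ (v, p.2) := by
      ext v
      simp [hg, e.left_inv hp]
    rw [hfun] at hcomp
    exact hcomp.deriv
  refine ContinuousAt.congr (f := fun p : Scri => fderiv ℝ g (p.1, e p.2) (1, 0)) ?_
    (hsrc.mono fun p hp => (heq p hp).symm)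
  have hmem₀ : (v₀, e n₀) ∈ (Set.univ ×ˢ e.target : Set (ℝ × EuclideanSpace ℝ (Fin 2))) :=
    ⟨trivial, e.map_source (mem_extChartAt_source n₀)⟩
  have h1 : ContinuousAt (fderiv ℝ g) (v₀, e n₀) := hfd.continuousAt (hopen.mem_nhds hmem₀)
  have h2 : ContinuousAt (fun p : Scri => (p.1, e p.2)) (v₀, n₀) :=
    continuousAt_fst.prodMk ((continuousAt_extChartAt n₀).comp_of_eq continuousAt_snd rfl)
  have h3 : ContinuousAt (fun p : Scri => fderiv ℝ g (p.1, e p.2)) (v₀, n₀) :=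
    ContinuousAt.comp_of_eq h1 h2 rfl
  exact h3.clm_apply continuousAt_const

/-- An element of `ScriSpace` as a continuous function. -/
def scriCont (Φ : ScriSpace) : C(Scri, ℝ) := ⟨Φ, ScriSpace.continuous Φ⟩

/-- The `v`-derivative of an element of `ScriSpace` as a continuous function. -/
def scriContDeriv (Φ : ScriSpace) : C(Scri, ℝ) :=
  ⟨vDeriv Φ, IsSmoothScri.continuous_vDeriv Φ.2.1⟩

theorem sliceL2_eq (Φ : ScriSpace) : sliceL2 Φ = contSlice (scriCont Φ) := rfl

theorem memLp_scriCont (Φ : ScriSpace) : MemLp (scriCont Φ) 2 scriMeasure := Φ.2.2.1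

theorem memLp_scriContDeriv (Φ : ScriSpace) : MemLp (scriContDeriv Φ) 2 scriMeasure := Φ.2.2.2

/-- Differentiation takes place in the sup norm of `C(S²)`. There `γ(w) = γ(0) + ∫ γ'`, as one sees
at each point of the sphere, and the integrand is continuous; the embedding into `L²` then preserves
the derivative. -/
theorem hasDerivAt_sliceL2 (Φ : ScriSpace) (v : ℝ) :
    HasDerivAt (sliceL2 Φ) (contSlice (scriContDeriv Φ) v) v := by
  set γ := sliceCurve (scriCont Φ)
  set γ' := sliceCurve (scriContDeriv Φ)
  have hint : ∀ a b, IntervalIntegrable γ' volume a b := fun a b =>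
    γ'.continuous.intervalIntegrable a b
  have hFTC : ∀ w, γ w = γ 0 + ∫ s in (0 : ℝ)..w, γ' s := by
    intro w
    ext n
    have h1 : (∫ s in (0 : ℝ)..w, γ' s) n = ∫ s in (0 : ℝ)..w, γ' s n :=
      ((ContinuousMap.evalCLM ℂ n).intervalIntegral_comp_comm (hint 0 w)).symm
    have h2 : ∀ s, HasDerivAt (fun s => γ s n) (γ' s n) s := fun s =>
      ((Φ.2.1.differentiable n s).hasDerivAt).ofReal_comp
    have hc : Continuous fun s => γ' s n :=
      (ContinuousMap.evalCLM ℂ n).continuous.comp γ'.continuous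
    have h3 : ∫ s in (0 : ℝ)..w, γ' s n = γ w n - γ 0 n :=
      intervalIntegral.integral_eq_sub_of_hasDerivAt (fun s _ => h2 s) (hc.intervalIntegrable 0 w)
    rw [ContinuousMap.add_apply, h1, h3]
    ring
  have hd : HasDerivAt γ (γ' v) v := by
    have h4 := (intervalIntegral.integral_hasDerivAt_right (hint 0 v)
      (γ'.continuous.stronglyMeasurableAtFilter _ _) γ'.continuous.continuousAt).const_add (γ 0)
    exact h4.congr_of_eventuallyEq (Eventually.of_forall hFTC)
  have := ((ContinuousMap.toLp (E := ℂ) 2 sphereMeasure ℂ).restrictScalars ℝ).hasFDerivAt.comp_hasDerivAt v hd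
  exact this

end Slices

/-! ### The substitution `w = -k / 2π` between the two Fourier conventions -/

section SpectralVariable

theorem ae_comp_spectral {p : ℝ → Prop} (h : ∀ᵐ w, p w) :
    ∀ᵐ k : ℝ, p (-k / (2 * Real.pi)) := by
  have hπ := Real.pi_pos
  have hq : Measure.QuasiMeasurePreserving (fun k : ℝ => (-1 / (2 * Real.pi)) * k) volume volume := by
    refine ⟨by fun_prop, ?_⟩
    rw [Real.map_volume_mul_left (by simp [Real.pi_ne_zero])]
    exact Measure.smul_absolutelyContinuous
  have := hq.ae h
  refine this.mono fun k hk => ?_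
  rwa [neg_div, one_div, neg_mul, inv_mul_eq_div, ← neg_div] at hk

theorem ae_neg {p : ℝ → Prop} (h : ∀ᵐ w, p w) : ∀ᵐ k : ℝ, p (-k) :=
  (Measure.measurePreserving_neg (volume : Measure ℝ)).quasiMeasurePreserving.ae h

variable {E : Type*} [NormedAddCommGroup E]

theorem integral_comp_spectral [NormedSpace ℝ E] (g : ℝ → E) :
    ∫ k : ℝ, g (-k / (2 * Real.pi)) = (2 * Real.pi) • ∫ w, g w := by
  have h := Measure.integral_comp_mul_left g (-1 / (2 * Real.pi))
  have hπ := Real.pi_pos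
  have h2 : |(-1 / (2 * Real.pi))⁻¹| = 2 * Real.pi := by
    rw [inv_div, div_neg, div_one, abs_neg, abs_of_pos (by positivity)]
  rw [h2] at h
  rw [← h]
  congr 1
  ext k
  congr 1
  ring

theorem memLp_comp_spectral {g : ℝ → E} (hg : MemLp g 2 volume) :
    MemLp (fun k : ℝ => g (-k / (2 * Real.pi))) 2 volume := by
  have hmap : Measure.map (fun k : ℝ => (-1 / (2 * Real.pi)) * k) volume =
      ENNReal.ofReal |(-1 / (2 * Real.pi))⁻¹| • (volume : Measure ℝ) :=
    Real.map_volume_mul_left (by simp [Real.pi_ne_zero])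
  have h1 : MemLp g 2 (Measure.map (fun k : ℝ => (-1 / (2 * Real.pi)) * k) volume) := by
    rw [hmap]
    exact hg.smul_measure ENNReal.ofReal_ne_top
  have h2 := h1.comp_of_map (by fun_prop)
  refine h2.ae_eq (Eventually.of_forall fun k => ?_)
  simp only [Function.comp_apply]
  congr 1
  ring

end SpectralVariable

/-! ### Plancherel and the transformation rules in the variable `k` -/

section SpectralTransform

/-- The transform `(2π)^(-1/2) ∫ exp (i k v) f(v) dv` on `L²(ℝ; L²(S²))`. -/
def spectralTransform (f : Lp L2S 2 (volume : Measure ℝ)) (k : ℝ) : L2S :=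
  ((Real.sqrt (2 * Real.pi))⁻¹ : ℂ) • (𝓕 f : Lp L2S 2 (volume : Measure ℝ)) (-k / (2 * Real.pi))

theorem scriFourier_eq (Φ : ScriSpace) :
    scriFourier Φ = spectralTransform (memLp_sliceL2 Φ).toLp := rfl

theorem memLp_spectralTransform (f : Lp L2S 2 (volume : Measure ℝ)) :
    MemLp (spectralTransform f) 2 volume :=
  (memLp_comp_spectral (Lp.memLp (𝓕 f : Lp L2S 2 (volume : Measure ℝ)))).const_smul
    ((Real.sqrt (2 * Real.pi))⁻¹ : ℂ)

/-- Plancherel's theorem. -/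
theorem integral_inner_spectralTransform (f g : Lp L2S 2 (volume : Measure ℝ)) :
    ∫ k, inner ℂ (spectralTransform f k) (spectralTransform g k) = ∫ v, inner ℂ (f v) (g v) := by
  have hπ := Real.pi_pos
  have h := Lp.inner_fourier_eq f g
  rw [L2.inner_def, L2.inner_def] at h
  rw [← h]
  simp only [spectralTransform, inner_smul_left, inner_smul_right]
  rw [integral_comp_spectral (fun w => ((Real.sqrt (2 * Real.pi))⁻¹ : ℂ) *
    ((starRingEnd ℂ) ((Real.sqrt (2 * Real.pi))⁻¹ : ℂ) * inner ℂ ((𝓕 f : Lp L2S 2 (volume : Measure ℝ)) w)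
      ((𝓕 g : Lp L2S 2 (volume : Measure ℝ)) w)))]
  rw [integral_const_mul, integral_const_mul, Complex.real_smul, ← mul_assoc, ← mul_assoc]
  have h1 : ((2 * Real.pi : ℝ) : ℂ) * ((Real.sqrt (2 * Real.pi))⁻¹ : ℂ) *
      (starRingEnd ℂ) ((Real.sqrt (2 * Real.pi))⁻¹ : ℂ) = 1 := by
    rw [map_inv₀, Complex.conj_ofReal, mul_assoc, ← mul_inv, ← Complex.ofReal_mul,
      Real.mul_self_sqrt (by positivity), mul_inv_cancel₀]
    exact_mod_cast (by positivity : (2 * Real.pi : ℝ) ≠ 0)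
  rw [h1, one_mul]

theorem spectralTransform_add (f g : Lp L2S 2 (volume : Measure ℝ)) :
    ∀ᵐ k, spectralTransform (f + g) k = spectralTransform f k + spectralTransform g k := by
  filter_upwards [ae_comp_spectral (Lp.coeFn_add (𝓕 f : Lp L2S 2 (volume : Measure ℝ)) (𝓕 g))]
    with k hk
  simp only [spectralTransform, FourierTransform.fourier_add, hk, Pi.add_apply, smul_add]

theorem spectralTransform_smul (c : ℂ) (f : Lp L2S 2 (volume : Measure ℝ)) :
    ∀ᵐ k, spectralTransform (c • f) k = c • spectralTransform f k := by
  filter_upwards [ae_comp_spectral (Lp.coeFn_smul c (𝓕 f : Lp L2S 2 (volume : Measure ℝ)))] with k hk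
  simp only [spectralTransform, FourierTransform.fourier_smul, hk, Pi.smul_apply]
  rw [smul_comm]

theorem spectralTransform_translate {f f' : Lp L2S 2 (volume : Measure ℝ)} (s : ℝ)
    (h : f' =ᵐ[volume] fun x => f (x - s)) :
    ∀ᵐ k, spectralTransform f' k = Complex.exp (Complex.I * k * s) • spectralTransform f k := by
  filter_upwards [ae_comp_spectral (fourier_ae_eq_translate s h)] with k hk
  simp only [spectralTransform, hk]
  rw [smul_comm]
  congr 2
  have : (Real.pi : ℂ) ≠ 0 := by exact_mod_cast Real.pi_ne_zero
  push_cast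
  field_simp

theorem spectralTransform_deriv {f f' : Lp L2S 2 (volume : Measure ℝ)} {γ γ' : ℝ → L2S}
    (hf : f =ᵐ[volume] γ) (hf' : f' =ᵐ[volume] γ') (hγ : ∀ x, HasDerivAt γ (γ' x) x) :
    ∀ᵐ k : ℝ, spectralTransform f' k = (-(Complex.I * k)) • spectralTransform f k := by
  filter_upwards [ae_comp_spectral (fourier_ae_eq_deriv hf hf' hγ)] with k hk
  simp only [spectralTransform, hk]
  rw [smul_comm]
  congr 1
  have : (Real.pi : ℂ) ≠ 0 := by exact_mod_cast Real.pi_ne_zero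
  push_cast
  field_simp

theorem spectralTransform_comp {f f' : Lp L2S 2 (volume : Measure ℝ)} (U : L2S →L[ℂ] L2S)
    (h : f' =ᵐ[volume] fun x => U (f x)) :
    ∀ᵐ k : ℝ, spectralTransform f' k = U (spectralTransform f k) := by
  filter_upwards [ae_comp_spectral (fourier_ae_eq_comp U h)] with k hk
  simp only [spectralTransform, hk, map_smul]

theorem spectralTransform_conj {f : Lp L2S 2 (volume : Measure ℝ)} (J : L2S →L[ℝ] L2S)
    (hJ : ∀ (c : ℂ) x, J (c • x) = starRingEnd ℂ c • J x) (h : f =ᵐ[volume] fun x => J (f x)) :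
    ∀ᵐ k : ℝ, spectralTransform f (-k) = J (spectralTransform f k) := by
  filter_upwards [ae_neg (ae_comp_spectral (fourier_ae_eq_conj J hJ h))] with k hk
  have h1 : -(- -k / (2 * Real.pi)) = -k / (2 * Real.pi) := by ring
  rw [h1] at hk
  rw [spectralTransform, hk, spectralTransform, hJ, map_inv₀, Complex.conj_ofReal]
  rfl

end SpectralTransform

/-! ### Conjugation and rotations on `L²(S²)` -/

section Conjugation

/-- Complex conjugation on `L²(S²; ℂ)`. -/
def conjL2S : L2S →L[ℝ] L2S := (Complex.conjCLE : ℂ →L[ℝ] ℂ).compLpL 2 sphereMeasure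

theorem coeFn_conjL2S (f : L2S) : conjL2S f =ᵐ[sphereMeasure] fun n => starRingEnd ℂ (f n) :=
  ContinuousLinearMap.coeFn_compLpL _ f

theorem conjL2S_smul (c : ℂ) (f : L2S) : conjL2S (c • f) = starRingEnd ℂ c • conjL2S f := by
  refine Lp.ext ?_
  filter_upwards [coeFn_conjL2S (c • f), coeFn_conjL2S f, Lp.coeFn_smul c f,
    Lp.coeFn_smul (starRingEnd ℂ c) (conjL2S f)] with n h1 h2 h3 h4
  simp [h1, h2, h3, h4]

theorem inner_conjL2S (f g : L2S) :
    inner ℂ (conjL2S f) (conjL2S g) = starRingEnd ℂ (inner ℂ f g) := by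
  rw [L2.inner_def, L2.inner_def, ← integral_conj]
  refine integral_congr_ae ?_
  filter_upwards [coeFn_conjL2S f, coeFn_conjL2S g] with n h1 h2
  simp [h1, h2]

theorem conjL2S_contSlice (g : C(Scri, ℝ)) (v : ℝ) : conjL2S (contSlice g v) = contSlice g v := by
  refine Lp.ext ?_
  filter_upwards [coeFn_conjL2S (contSlice g v), coeFn_contSlice g v] with n h1 h2
  simp [h1, h2]

end Conjugation

section Rotation

theorem measurePreserving_sphereMap_symm (R : Rot) :
    MeasurePreserving (sphereMap R.symm) sphereMeasure sphereMeasure :=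
  measurePreserving_sphereMap R.symm

/-- The action of rotations on `L²(S²; ℂ)`. -/
def rotL2S (R : Rot) : L2S →ₗᵢ[ℂ] L2S :=
  Lp.compMeasurePreservingₗᵢ ℂ (sphereMap R.symm) (measurePreserving_sphereMap_symm R)

theorem coeFn_rotL2S (R : Rot) (f : L2S) : rotL2S R f =ᵐ[sphereMeasure] f ∘ sphereMap R.symm :=
  Lp.coeFn_compMeasurePreserving f (measurePreserving_sphereMap_symm R)

theorem rotL2S_refl (f : L2S) : rotL2S (LinearIsometryEquiv.refl ℝ _) f = f := by
  refine Lp.ext ?_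
  filter_upwards [coeFn_rotL2S (LinearIsometryEquiv.refl ℝ _) f] with n hn
  rw [hn]
  rfl

theorem sliceL2_scriAct (t : ℝ) (R : Rot) (Φ : ScriSpace) (v : ℝ) :
    sliceL2 (scriAct t R Φ) v = rotL2S R (sliceL2 Φ (v - t)) := by
  refine Lp.ext ?_
  have h1 := (measurePreserving_sphereMap_symm R).quasiMeasurePreserving.ae
    (coeFn_contSlice (scriCont Φ) (v - t))
  filter_upwards [coeFn_contSlice (scriCont (scriAct t R Φ)) v,
    coeFn_rotL2S R (sliceL2 Φ (v - t)), h1] with n h2 h3 h4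
  rw [sliceL2_eq, h2, h3, Function.comp_apply, sliceL2_eq, h4]
  rfl

end Rotation

/-! ### The transform on the symplectic space -/

section ScriFourier

theorem coeFn_slice (Φ : ScriSpace) : (memLp_sliceL2 Φ).toLp =ᵐ[volume] sliceL2 Φ :=
  MemLp.coeFn_toLp _

theorem memLp_scriFourier (Φ : ScriSpace) : MemLp (scriFourier Φ) 2 volume :=
  memLp_spectralTransform _

theorem scriFourier_add (Φ Ψ : ScriSpace) :
    ∀ᵐ k, scriFourier (Φ + Ψ) k = scriFourier Φ k + scriFourier Ψ k := by
  have h : (memLp_sliceL2 (Φ + Ψ)).toLp = (memLp_sliceL2 Φ).toLp + (memLp_sliceL2 Ψ).toLp := by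
    rw [← MemLp.toLp_add]
    congr 1
    ext1 v
    change ContinuousMap.toLp 2 sphereMeasure ℂ _ = ContinuousMap.toLp 2 sphereMeasure ℂ _ +
      ContinuousMap.toLp 2 sphereMeasure ℂ _
    rw [← map_add]
    congr 1
    ext n
    simp
  rw [scriFourier_eq, h]
  exact spectralTransform_add _ _

theorem scriFourier_smul (c : ℝ) (Φ : ScriSpace) :
    ∀ᵐ k, scriFourier (c • Φ) k = (c : ℂ) • scriFourier Φ k := by
  have h : (memLp_sliceL2 (c • Φ)).toLp = (c : ℂ) • (memLp_sliceL2 Φ).toLp := by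
    rw [← MemLp.toLp_const_smul]
    congr 1
    ext1 v
    refine Eq.trans ?_ ((ContinuousMap.toLp (E := ℂ) 2 sphereMeasure ℂ).map_smul (c : ℂ)
      (sliceCurve (scriCont Φ) v))
    change ContinuousMap.toLp 2 sphereMeasure ℂ _ = _
    congr 1
    ext n
    change (((c • (Φ : Scri → ℝ)) (v, n) : ℝ) : ℂ) = (c : ℂ) * ((Φ : Scri → ℝ) (v, n) : ℂ)
    simp
  rw [scriFourier_eq, h]
  exact spectralTransform_smul _ _

theorem scriFourier_scriAct (t : ℝ) (R : Rot) (Φ : ScriSpace) :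
    ∀ᵐ k : ℝ, scriFourier (scriAct t R Φ) k =
      Complex.exp (Complex.I * k * t) • rotL2S R (scriFourier Φ k) := by
  have hcomp : MemLp (fun v => rotL2S R (sliceL2 Φ v)) 2 volume := by
    refine (memLp_sliceL2 Φ).of_le
      ((rotL2S R).continuous.comp (continuous_sliceL2 Φ)).aestronglyMeasurable
      (Eventually.of_forall fun v => ?_)
    rw [LinearIsometry.norm_map]
  have h1 : ∀ᵐ k, spectralTransform hcomp.toLp k = rotL2S R (scriFourier Φ k) :=
    spectralTransform_comp (f := (memLp_sliceL2 Φ).toLp) (f' := hcomp.toLp)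
    (rotL2S R).toContinuousLinearMap (by
      filter_upwards [hcomp.coeFn_toLp, coeFn_slice Φ] with v h1 h2
      rw [h1, h2]
      rfl)
  have h2 := spectralTransform_translate (f := hcomp.toLp)
    (f' := (memLp_sliceL2 (scriAct t R Φ)).toLp) t (by
      have hq := (measurePreserving_sub_right (volume : Measure ℝ) t).quasiMeasurePreserving.ae
        hcomp.coeFn_toLp
      filter_upwards [coeFn_slice (scriAct t R Φ), hq] with v h1 h2
      rw [h1, h2, sliceL2_scriAct])
  filter_upwards [h1, h2] with k h3 h4
  rw [scriFourier_eq, h4, h3]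

theorem scriFourier_neg (Φ : ScriSpace) :
    ∀ᵐ k : ℝ, scriFourier Φ (-k) = conjL2S (scriFourier Φ k) :=
  spectralTransform_conj conjL2S conjL2S_smul (by
    filter_upwards [coeFn_slice Φ] with v hv
    rw [hv, sliceL2_eq, conjL2S_contSlice])

theorem integral_inner_scriFourier (Φ Ψ : ScriSpace) :
    ∫ k, inner ℂ (scriFourier Φ k) (scriFourier Ψ k) =
      ((∫ p, (Φ : Scri → ℝ) p * (Ψ : Scri → ℝ) p ∂scriMeasure : ℝ) : ℂ) := by
  rw [scriFourier_eq, scriFourier_eq, integral_inner_spectralTransform]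
  have h := integral_inner_contSlice (memLp_scriCont Φ) (memLp_scriCont Ψ)
  refine Eq.trans (integral_congr_ae ?_) h
  filter_upwards [coeFn_slice Φ, coeFn_slice Ψ] with v h1 h2
  rw [h1, h2]
  rfl

/-- The transform of `∂_v Φ` is `-i k Φ̂`. -/
theorem spectralTransform_vDeriv (Φ : ScriSpace) :
    ∀ᵐ k : ℝ, spectralTransform (memLp_contSlice (memLp_scriContDeriv Φ)).toLp k =
      (-(Complex.I * k)) • scriFourier Φ k :=
  spectralTransform_deriv (coeFn_slice Φ) (MemLp.coeFn_toLp _) (hasDerivAt_sliceL2 Φ)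

theorem memLp_mul_scriFourier (Φ : ScriSpace) :
    MemLp (fun k : ℝ => (-(Complex.I * k)) • scriFourier Φ k) 2 volume :=
  (memLp_spectralTransform (memLp_contSlice (memLp_scriContDeriv Φ)).toLp).ae_eq
    (spectralTransform_vDeriv Φ)

theorem integral_inner_scriFourier_deriv (Φ Ψ : ScriSpace) :
    ∫ k : ℝ, inner ℂ (scriFourier Φ k) ((-(Complex.I * k)) • scriFourier Ψ k) =
      ((∫ p, (Φ : Scri → ℝ) p * vDeriv Ψ p ∂scriMeasure : ℝ) : ℂ) := by
  refine Eq.trans ?_ (integral_inner_contSlice (memLp_scriCont Φ) (memLp_scriContDeriv Ψ))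
  rw [integral_congr_ae (g := fun k => inner ℂ (scriFourier Φ k) (spectralTransform
    (memLp_contSlice (memLp_scriContDeriv Ψ)).toLp k))
    ((spectralTransform_vDeriv Ψ).mono fun k hk => by simp only [hk]),
    scriFourier_eq, integral_inner_spectralTransform]
  refine integral_congr_ae ?_
  filter_upwards [coeFn_slice Φ, (memLp_contSlice (memLp_scriContDeriv Ψ)).coeFn_toLp] with v h1 h2
  rw [h1, h2]
  rfl

/-- Plancherel for the derivative. With `integral_norm_sq_scriFourier` it turns the square of
`scriNorm` into `∫ (1 + k²) ‖Φ̂(k)‖² dk`. -/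
theorem integral_sq_mul_scriFourier (Φ : ScriSpace) :
    ∫ k : ℝ, k ^ 2 * ‖scriFourier Φ k‖ ^ 2 = ∫ p, vDeriv Φ p ^ 2 ∂scriMeasure := by
  set f := (memLp_contSlice (memLp_scriContDeriv Φ)).toLp with hf
  have h := integral_inner_contSlice (memLp_scriContDeriv Φ) (memLp_scriContDeriv Φ)
  have h2 := integral_inner_spectralTransform f f
  have h3 : ∫ v, inner ℂ (f v) (f v) = ∫ v, inner ℂ (contSlice (scriContDeriv Φ) v)
      (contSlice (scriContDeriv Φ) v) := integral_congr_ae (by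
    filter_upwards [(memLp_contSlice (memLp_scriContDeriv Φ)).coeFn_toLp] with v h1
    rw [hf, h1])
  have h4 : ∫ k, inner ℂ (spectralTransform f k) (spectralTransform f k) =
      ∫ k : ℝ, ((k ^ 2 * ‖scriFourier Φ k‖ ^ 2 : ℝ) : ℂ) := integral_congr_ae (by
    filter_upwards [spectralTransform_vDeriv Φ] with k hk
    have hn : ‖(-(Complex.I * k)) • scriFourier Φ k‖ = |k| * ‖scriFourier Φ k‖ := by
      simp [norm_smul]
    rw [hk, inner_self_eq_norm_sq_to_K, hn]
    change ((|k| * ‖scriFourier Φ k‖ : ℝ) : ℂ) ^ 2 = _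
    rw [← Complex.ofReal_pow, mul_pow, sq_abs])
  rw [h3, h, h4, integral_complex_ofReal] at h2
  rw [Complex.ofReal_injective h2]
  refine integral_congr_ae (Eventually.of_forall fun p => ?_)
  exact (sq _).symm

theorem integral_norm_sq_scriFourier (Φ : ScriSpace) :
    ∫ k : ℝ, ‖scriFourier Φ k‖ ^ 2 = ∫ p, (Φ : Scri → ℝ) p ^ 2 ∂scriMeasure := by
  have h := integral_inner_scriFourier Φ Φ
  simp only [inner_self_eq_norm_sq_to_K] at h
  have h2 : ∫ k : ℝ, ((‖scriFourier Φ k‖ ^ 2 : ℝ) : ℂ) =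
    ((∫ p, (Φ : Scri → ℝ) p * (Φ : Scri → ℝ) p ∂scriMeasure : ℝ) : ℂ) := by
    rw [← h]
    refine integral_congr_ae (Eventually.of_forall fun k => ?_)
    simp
  rw [integral_complex_ofReal] at h2
  rw [Complex.ofReal_injective h2]
  simp only [sq]

instance : sphereMeasure.IsOpenPosMeasure := by
  unfold sphereMeasure
  infer_instance

/-- Plancherel gives `Φ = 0` almost everywhere, and a continuous function that vanishes almost
everywhere for a measure charging open sets is zero. -/
theorem eq_zero_of_scriFourier {Φ : ScriSpace} (h : ∀ᵐ k, scriFourier Φ k = 0) : Φ = 0 := by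
  have h1 : ∫ p, (Φ : Scri → ℝ) p ^ 2 ∂scriMeasure = 0 := by
    rw [← integral_norm_sq_scriFourier, integral_congr_ae (g := fun _ => 0)
      (h.mono fun k hk => by simp [hk])]
    simp
  have h2 : Integrable (fun p => (Φ : Scri → ℝ) p ^ 2) scriMeasure := Φ.2.2.1.integrable_sq
  rw [integral_eq_zero_iff_of_nonneg (fun p => sq_nonneg _) h2] at h1
  have h3 : (fun p => (Φ : Scri → ℝ) p ^ 2) = fun _ => 0 := by
    have : scriMeasure.IsOpenPosMeasure := by unfold scriMeasure; infer_instance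
    exact Continuous.ae_eq_iff_eq scriMeasure ((ScriSpace.continuous Φ).pow 2) continuous_const
      |>.mp h1
  ext p
  simpa using congrFun h3 p

end ScriFourier

/-! ### The spectral density and its moments -/

section SpectralDensity

/-- The spectral density `⟨Φ̂(k), Ψ̂(k)⟩` in `L²(S²)`. -/
def spectralDensity (Φ Ψ : ScriSpace) (k : ℝ) : ℂ :=
  inner ℂ (scriFourier Φ k) (scriFourier Ψ k)

/-- Reality of `Φ` and `Ψ`. Both the value of the imaginary part of the forms and the KMS boundary
condition come from this exchange. -/
theorem spectralDensity_neg (Φ Ψ : ScriSpace) :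
    ∀ᵐ k : ℝ, spectralDensity Φ Ψ (-k) = spectralDensity Ψ Φ k := by
  filter_upwards [scriFourier_neg Φ, scriFourier_neg Ψ] with k h1 h2
  rw [spectralDensity, h1, h2, inner_conjL2S, inner_conj_symm, spectralDensity]

theorem aestronglyMeasurable_spectralDensity (Φ Ψ : ScriSpace) :
    AEStronglyMeasurable (spectralDensity Φ Ψ) volume :=
  (memLp_scriFourier Φ).1.inner (memLp_scriFourier Ψ).1

/-- `Φ̂` and `k Φ̂` are both square integrable. Hence symbols of up to quadratic growth can be
integrated against the density. -/
theorem integrable_sq_spectralDensity (Φ Ψ : ScriSpace) :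
    Integrable (fun k : ℝ => (1 + k ^ 2) * ‖spectralDensity Φ Ψ k‖) := by
  have h1 : Integrable (fun k => ‖scriFourier Φ k‖ * ‖scriFourier Ψ k‖) :=
    (memLp_scriFourier Φ).norm.integrable_mul (memLp_scriFourier Ψ).norm
  have h2 : Integrable (fun k : ℝ => ‖(-(Complex.I * k)) • scriFourier Φ k‖ *
      ‖(-(Complex.I * k)) • scriFourier Ψ k‖) :=
    (memLp_mul_scriFourier Φ).norm.integrable_mul (memLp_mul_scriFourier Ψ).norm
  refine (h1.add h2).mono' ?_ (Eventually.of_forall fun k => ?_)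
  · exact (by fun_prop : Continuous fun k : ℝ => 1 + k ^ 2).aestronglyMeasurable.mul
      (aestronglyMeasurable_spectralDensity Φ Ψ).norm
  · have h3 : ‖spectralDensity Φ Ψ k‖ ≤ ‖scriFourier Φ k‖ * ‖scriFourier Ψ k‖ :=
      norm_inner_le_norm _ _
    have h4 : 0 ≤ 1 + k ^ 2 := by positivity
    rw [norm_mul, norm_norm, Real.norm_of_nonneg h4]
    refine (mul_le_mul_of_nonneg_left h3 h4).trans (le_of_eq ?_)
    simp only [Pi.add_apply, norm_smul, norm_neg, norm_mul, Complex.norm_I, Complex.norm_real,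
      Real.norm_eq_abs, one_mul]
    rw [← sq_abs k]
    ring

theorem integrable_mul_spectralDensity (Φ Ψ : ScriSpace) {m : ℝ → ℂ}
    (hm : AEStronglyMeasurable m volume) {C : ℝ} (hC : ∀ k, ‖m k‖ ≤ C * (1 + k ^ 2)) :
    Integrable (fun k => m k * spectralDensity Φ Ψ k) := by
  refine ((integrable_sq_spectralDensity Φ Ψ).const_mul C).mono'
    (hm.mul (aestronglyMeasurable_spectralDensity Φ Ψ)) (Eventually.of_forall fun k => ?_)
  rw [norm_mul, ← mul_assoc]
  exact mul_le_mul_of_nonneg_right (hC k) (norm_nonneg _)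

theorem spectralDensity_scriAct (t : ℝ) (R : Rot) (Φ Ψ : ScriSpace) :
    ∀ᵐ k : ℝ, spectralDensity (scriAct t R Φ) (scriAct t R Ψ) k = spectralDensity Φ Ψ k := by
  filter_upwards [scriFourier_scriAct t R Φ, scriFourier_scriAct t R Ψ] with k h1 h2
  rw [spectralDensity, h1, h2, inner_smul_left, inner_smul_right, LinearIsometry.inner_map_map,
    ← mul_assoc, ← Complex.exp_conj, ← Complex.exp_add]
  simp [spectralDensity]

theorem spectralDensity_translate (t : ℝ) (Φ Ψ : ScriSpace) :
    ∀ᵐ k : ℝ, spectralDensity Φ (scriAct t (LinearIsometryEquiv.refl ℝ _) Ψ) k =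
      Complex.exp (Complex.I * k * t) * spectralDensity Φ Ψ k := by
  filter_upwards [scriFourier_scriAct t (LinearIsometryEquiv.refl ℝ _) Ψ] with k h1
  rw [spectralDensity, h1, inner_smul_right, rotL2S_refl]
  rfl

theorem spectralDensity_self (Φ : ScriSpace) (k : ℝ) :
    spectralDensity Φ Φ k = ((‖scriFourier Φ k‖ ^ 2 : ℝ) : ℂ) := by
  rw [spectralDensity, inner_self_eq_norm_sq_to_K]
  norm_cast

theorem one_add_abs_le (k : ℝ) : 1 + |k| ≤ 2 * (1 + k ^ 2) := by
  rw [← sq_abs k]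
  nlinarith [sq_nonneg (|k| - 1)]

end SpectralDensity

/-! ### Two-point functions from spectral weights -/

section Weights

/-- Weights `w ≥ 0` of at most linear growth with `w(k) - w(-k) = 2k`. -/
structure IsSpectralWeight (w : ℝ → ℝ) : Prop where
  measurable : Measurable w
  nonneg : ∀ k, 0 ≤ w k
  bound : ∃ C, 0 ≤ C ∧ ∀ k, w k ≤ C * (1 + |k|)
  sub_neg : ∀ k, w k - w (-k) = 2 * k

/-- The two-point function with spectral weight `w`. -/
def weightedForm (w : ℝ → ℝ) (Φ Ψ : ScriSpace) : ℂ :=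
  ∫ k, (w k : ℂ) * spectralDensity Φ Ψ k

variable {w : ℝ → ℝ}

theorem IsSpectralWeight.integrable (hw : IsSpectralWeight w) (Φ Ψ : ScriSpace) :
    Integrable (fun k => (w k : ℂ) * spectralDensity Φ Ψ k) := by
  obtain ⟨C, hC0, hC⟩ := hw.bound
  refine integrable_mul_spectralDensity Φ Ψ (C := C * 2)
    (Complex.measurable_ofReal.comp hw.measurable).aestronglyMeasurable fun k => ?_
  rw [Complex.norm_real, Real.norm_of_nonneg (hw.nonneg k), mul_assoc]
  exact (hC k).trans (mul_le_mul_of_nonneg_left (one_add_abs_le k) hC0)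

theorem IsSpectralWeight.memLp (hw : IsSpectralWeight w) (Φ : ScriSpace) :
    MemLp (fun k => ((Real.sqrt (w k) : ℝ) : ℂ) • scriFourier Φ k) 2 volume := by
  have hm : AEStronglyMeasurable (fun k => ((Real.sqrt (w k) : ℝ) : ℂ) • scriFourier Φ k) volume :=
    (Complex.measurable_ofReal.comp hw.measurable.sqrt).aestronglyMeasurable.smul
      (memLp_scriFourier Φ).1
  rw [memLp_two_iff_integrable_sq_norm hm]
  refine (hw.integrable Φ Φ).norm.congr (Eventually.of_forall fun k => ?_)
  simp only [norm_smul, norm_mul, spectralDensity_self, Complex.norm_real, mul_pow, Real.norm_eq_abs,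
    sq_abs, Real.sq_sqrt (hw.nonneg k), abs_of_nonneg (hw.nonneg k)]
  rw [abs_of_nonneg (by positivity)]

/-- The vector `√w Φ̂` of `L²(ℝ; L²(S²))`. -/
def IsSpectralWeight.vec (hw : IsSpectralWeight w) (Φ : ScriSpace) :
    Lp L2S 2 (volume : Measure ℝ) := (hw.memLp Φ).toLp

theorem IsSpectralWeight.coeFn_vec (hw : IsSpectralWeight w) (Φ : ScriSpace) :
    ∀ᵐ k, hw.vec Φ k = ((Real.sqrt (w k) : ℝ) : ℂ) • scriFourier Φ k :=
  MemLp.coeFn_toLp _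

theorem IsSpectralWeight.inner_vec (hw : IsSpectralWeight w) (Φ Ψ : ScriSpace) :
    inner ℂ (hw.vec Φ) (hw.vec Ψ) = weightedForm w Φ Ψ := by
  rw [L2.inner_def]
  refine integral_congr_ae ?_
  filter_upwards [hw.coeFn_vec Φ, hw.coeFn_vec Ψ] with k h1 h2
  rw [h1, h2, inner_smul_left, inner_smul_right, ← mul_assoc, Complex.conj_ofReal,
    ← Complex.ofReal_mul, Real.mul_self_sqrt (hw.nonneg k)]
  rfl

theorem IsSpectralWeight.vec_add (hw : IsSpectralWeight w) (Φ Ψ : ScriSpace) :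
    hw.vec (Φ + Ψ) = hw.vec Φ + hw.vec Ψ := by
  refine Lp.ext ?_
  filter_upwards [hw.coeFn_vec Φ, hw.coeFn_vec Ψ, hw.coeFn_vec (Φ + Ψ), scriFourier_add Φ Ψ,
    Lp.coeFn_add (hw.vec Φ) (hw.vec Ψ)] with k h1 h2 h3 h4 h5
  rw [h3, h4, h5, Pi.add_apply, h1, h2, smul_add]

theorem IsSpectralWeight.vec_smul (hw : IsSpectralWeight w) (c : ℝ) (Φ : ScriSpace) :
    hw.vec (c • Φ) = (c : ℂ) • hw.vec Φ := by
  refine Lp.ext ?_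
  filter_upwards [hw.coeFn_vec Φ, hw.coeFn_vec (c • Φ), scriFourier_smul c Φ,
    Lp.coeFn_smul (c : ℂ) (hw.vec Φ)] with k h1 h2 h3 h4
  rw [h2, h3, h4, Pi.smul_apply, h1, smul_comm]

theorem IsSpectralWeight.pos (hw : IsSpectralWeight w) {k : ℝ} (hk : 0 < k) : 0 < w k := by
  have h1 := hw.sub_neg k
  have h2 := hw.nonneg (-k)
  linarith

/-- The weight may vanish for `k < 0`, as for the ground state, but it is positive for `k > 0`, and
the values of `Φ̂` there determine the others by conjugation. -/
theorem IsSpectralWeight.vec_ne_zero (hw : IsSpectralWeight w) {Φ : ScriSpace} (hΦ : Φ ≠ 0) :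
    hw.vec Φ ≠ 0 := by
  intro h0
  refine hΦ (eq_zero_of_scriFourier ?_)
  have h1 : ∀ᵐ k : ℝ, 0 < k → scriFourier Φ k = 0 := by
    filter_upwards [hw.coeFn_vec Φ, Lp.coeFn_zero L2S 2 (volume : Measure ℝ)] with k h1 h2 hk
    rw [h0, h2] at h1
    have h3 : ((Real.sqrt (w k) : ℝ) : ℂ) ≠ 0 := by
      exact_mod_cast (Real.sqrt_pos.mpr (hw.pos hk)).ne'
    exact (smul_eq_zero.mp h1.symm).resolve_left h3
  have h2 : ∀ᵐ k : ℝ, k ≠ 0 := by simp [ae_iff]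
  filter_upwards [h1, ae_neg h1, ae_neg (scriFourier_neg Φ), h2] with k h3 h4 h5 h6
  rcases lt_or_gt_of_ne h6 with hk | hk
  · rw [neg_neg] at h5
    rw [h5, h4 (by linarith), map_zero]
  · exact h3 hk

/-- The imaginary part of a weighted form is `-σ/2`. -/
theorem IsSpectralWeight.im_weightedForm (hw : IsSpectralWeight w) (Φ Ψ : ScriSpace) :
    (weightedForm w Φ Ψ).im = -(scriSymp Φ Ψ) / 2 := by
  have key : ∀ Φ Ψ : ScriSpace, (weightedForm w Φ Ψ).im =
      ∫ p, (Φ : Scri → ℝ) p * vDeriv Ψ p ∂scriMeasure := by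
    intro Φ Ψ
    have h1 : weightedForm w Ψ Φ = ∫ k : ℝ, (w (-k) : ℂ) * spectralDensity Φ Ψ k := by
      rw [weightedForm, ← integral_neg_eq_self]
      refine integral_congr_ae ?_
      filter_upwards [spectralDensity_neg Ψ Φ] with k hk
      rw [hk]
    have hint : Integrable fun k : ℝ => (w (-k) : ℂ) * spectralDensity Φ Ψ k := by
      refine (hw.integrable Ψ Φ).comp_neg.congr ?_
      filter_upwards [spectralDensity_neg Ψ Φ] with k hk
      rw [hk]
    -- Only `w(k) - w(-k) = 2k` enters, and `k` becomes `∂_v`: the antisymmetric part is the same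
    -- for all weights.
    have h2 : weightedForm w Φ Ψ - weightedForm w Ψ Φ =
        2 * Complex.I * ((∫ p, (Φ : Scri → ℝ) p * vDeriv Ψ p ∂scriMeasure : ℝ) : ℂ) := by
      rw [h1, weightedForm, ← integral_sub (hw.integrable Φ Ψ) hint,
        ← integral_inner_scriFourier_deriv, ← integral_const_mul]
      refine integral_congr_ae (Eventually.of_forall fun k => ?_)
      have h3 : (w k : ℂ) - w (-k) = 2 * k := by exact_mod_cast hw.sub_neg k
      simp only
      rw [inner_smul_right, ← sub_mul, h3, spectralDensity]
      linear_combination (2 * k * inner ℂ (scriFourier Φ k) (scriFourier Ψ k)) * Complex.I_mul_I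
    have h4 : weightedForm w Ψ Φ = starRingEnd ℂ (weightedForm w Φ Ψ) := by
      rw [← hw.inner_vec, ← hw.inner_vec, inner_conj_symm]
    have h5 := congrArg Complex.im h2
    rw [h4] at h5
    simp at h5
    linarith
  have h6 : (weightedForm w Ψ Φ).im = -(weightedForm w Φ Ψ).im := by
    rw [← hw.inner_vec, ← hw.inner_vec, ← inner_conj_symm, Complex.conj_im]
  have h7 : scriSymp Φ Ψ = -((∫ p, (Φ : Scri → ℝ) p * vDeriv Ψ p ∂scriMeasure) -
      ∫ p, (Ψ : Scri → ℝ) p * vDeriv Φ p ∂scriMeasure) := by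
    have h8 := integral_sub (Φ.2.2.1.integrable_mul Ψ.2.2.2) (Ψ.2.2.1.integrable_mul Φ.2.2.2)
    exact congrArg Neg.neg h8
  rw [h7, ← key, ← key, h6]
  ring

/-- The real part of a weighted form. -/
def IsSpectralWeight.realForm (hw : IsSpectralWeight w) : LinearMap.BilinForm ℝ ScriSpace :=
  LinearMap.mk₂ ℝ (fun Φ Ψ => (inner ℂ (hw.vec Φ) (hw.vec Ψ)).re)
    (fun Φ Φ' Ψ => by rw [hw.vec_add, inner_add_left, Complex.add_re])
    (fun c Φ Ψ => by rw [hw.vec_smul, inner_smul_left]; simp)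
    (fun Φ Ψ Ψ' => by rw [hw.vec_add, inner_add_right, Complex.add_re])
    (fun c Φ Ψ => by rw [hw.vec_smul, inner_smul_right]; simp)

theorem IsSpectralWeight.realForm_apply (hw : IsSpectralWeight w) (Φ Ψ : ScriSpace) :
    hw.realForm Φ Ψ = (weightedForm w Φ Ψ).re := by
  rw [← hw.inner_vec]
  rfl

theorem IsSpectralWeight.weightedForm_eq (hw : IsSpectralWeight w) (Φ Ψ : ScriSpace) :
    weightedForm w Φ Ψ = (hw.realForm Φ Ψ : ℂ) - Complex.I / 2 * (scriSymp Φ Ψ : ℂ) := by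
  rw [hw.realForm_apply]
  apply Complex.ext
  · simp
  · rw [hw.im_weightedForm]
    simp
    ring

theorem IsSpectralWeight.realForm_symm (hw : IsSpectralWeight w) (Φ Ψ : ScriSpace) :
    hw.realForm Φ Ψ = hw.realForm Ψ Φ := by
  change (inner ℂ (hw.vec Φ) (hw.vec Ψ)).re = (inner ℂ (hw.vec Ψ) (hw.vec Φ)).re
  rw [← inner_conj_symm, Complex.conj_re]

theorem IsSpectralWeight.realForm_self (hw : IsSpectralWeight w) (Φ : ScriSpace) :
    hw.realForm Φ Φ = ‖hw.vec Φ‖ ^ 2 :=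
  inner_self_eq_norm_sq (𝕜 := ℂ) (hw.vec Φ)

/-- The inequality for `σ` is Cauchy-Schwarz for the vectors `√w Φ̂`, as `σ` is `-2` times the
imaginary part of their inner product. -/
theorem IsSpectralWeight.isTwoPointFunction (hw : IsSpectralWeight w) :
    IsTwoPointFunction scriSymp (weightedForm w) := by
  refine ⟨hw.realForm, hw.realForm_symm, fun Φ hΦ => ?_, fun Φ Ψ => ?_, hw.weightedForm_eq⟩
  · rw [hw.realForm_self]
    have := norm_pos_iff.mpr (hw.vec_ne_zero hΦ)
    positivity
  · have h1 : scriSymp Φ Ψ = -2 * (weightedForm w Φ Ψ).im := by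
      rw [hw.im_weightedForm]; ring
    have h2 : |(weightedForm w Φ Ψ).im| ≤ ‖hw.vec Φ‖ * ‖hw.vec Ψ‖ := by
      rw [← hw.inner_vec]
      exact (Complex.abs_im_le_norm _).trans (norm_inner_le_norm _ _)
    have h3 := pow_le_pow_left₀ (abs_nonneg _) h2 2
    rw [sq_abs] at h3
    rw [h1, hw.realForm_self, hw.realForm_self]
    nlinarith

open scoped ComplexOrder in
-- It is the Gram matrix of the vectors `√w Φ̂`.
theorem IsSpectralWeight.posSemidef (hw : IsSpectralWeight w) :
    (Matrix.of (weightedForm w)).PosSemidef := by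
  refine ⟨?_, fun x => ?_⟩
  · ext Φ Ψ
    rw [Matrix.conjTranspose_apply, Matrix.of_apply, Matrix.of_apply, ← hw.inner_vec,
      ← hw.inner_vec, Complex.star_def, inner_conj_symm]
  · have h : (x.sum fun i xi => x.sum fun j xj =>
        star xi * Matrix.of (weightedForm w) i j * xj) =
        inner ℂ (x.sum fun i xi => xi • hw.vec i) (x.sum fun i xi => xi • hw.vec i) := by
      simp only [Finsupp.sum, sum_inner, inner_sum, Matrix.of_apply]
      rw [Finset.sum_comm]
      refine Finset.sum_congr rfl fun i _ => Finset.sum_congr rfl fun j _ => ?_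
      rw [inner_smul_left, inner_smul_right, hw.inner_vec, Complex.star_def]
      ring
    rw [h, inner_self_eq_norm_sq_to_K]
    change (0 : ℂ) ≤ ((‖x.sum fun i xi => xi • hw.vec i‖ : ℝ) : ℂ) ^ 2
    rw [← Complex.ofReal_pow]
    exact Complex.zero_le_real.mpr (sq_nonneg _)

theorem IsSpectralWeight.exists_quasifree (hw : IsSpectralWeight w) :
    ∃ φ, IsQuasifreeWith scriSymp (weightedForm w) φ :=
  _root_.exists_quasifree scriSymp_isAlt hw.isTwoPointFunction hw.posSemidef

theorem weightedForm_scriAct (t : ℝ) (R : Rot) (Φ Ψ : ScriSpace) :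
    weightedForm w (scriAct t R Φ) (scriAct t R Ψ) = weightedForm w Φ Ψ :=
  integral_congr_ae ((spectralDensity_scriAct t R Φ Ψ).mono fun k hk => by simp only [hk])

/-- `w(k) ≤ C (1 + |k|) ≤ 2C (1 + k²)`, and `1 + k²` is the weight of the norm of the space. -/
theorem IsSpectralWeight.isContinuousTwoPoint (hw : IsSpectralWeight w) :
    IsContinuousTwoPoint (weightedForm w) := by
  obtain ⟨C, hC0, hC⟩ := hw.bound
  have hn : ∀ Φ, ‖hw.vec Φ‖ ≤ Real.sqrt (C * 2) * scriNorm Φ := by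
    intro Φ
    rw [scriNorm, ← Real.sqrt_mul (by positivity)]
    refine Real.le_sqrt_of_sq_le ?_
    have h1 : ‖hw.vec Φ‖ ^ 2 = ∫ k, w k * ‖scriFourier Φ k‖ ^ 2 := by
      rw [← hw.realForm_self, hw.realForm_apply, weightedForm]
      simp only [spectralDensity_self, ← Complex.ofReal_mul]
      rw [integral_complex_ofReal, Complex.ofReal_re]
    have hi1 : Integrable fun k => ‖scriFourier Φ k‖ ^ 2 :=
      (memLp_two_iff_integrable_sq_norm (memLp_scriFourier Φ).1).mp (memLp_scriFourier Φ)
    have hi2 : Integrable fun k : ℝ => k ^ 2 * ‖scriFourier Φ k‖ ^ 2 := by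
      have := (memLp_two_iff_integrable_sq_norm (memLp_mul_scriFourier Φ).1).mp
        (memLp_mul_scriFourier Φ)
      refine this.congr (Eventually.of_forall fun k => ?_)
      simp [norm_smul, mul_pow]
    have hi3 : Integrable fun k => w k * ‖scriFourier Φ k‖ ^ 2 := by
      refine (hw.integrable Φ Φ).norm.congr (Eventually.of_forall fun k => ?_)
      simp [spectralDensity_self, abs_of_nonneg (hw.nonneg k)]
    rw [h1, ← integral_norm_sq_scriFourier, ← integral_sq_mul_scriFourier, ← integral_add hi1 hi2,
      ← integral_const_mul]
    refine integral_mono hi3 ((hi1.add hi2).const_mul _) fun k => ?_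
    have h2 := (hC k).trans (mul_le_mul_of_nonneg_left (one_add_abs_le k) hC0)
    calc w k * ‖scriFourier Φ k‖ ^ 2 ≤ C * (2 * (1 + k ^ 2)) * ‖scriFourier Φ k‖ ^ 2 := by gcongr
      _ = _ := by ring
  refine ⟨C * 2, fun Φ Ψ => ?_⟩
  rw [← hw.inner_vec]
  have h0 : ∀ Φ, 0 ≤ scriNorm Φ := fun Φ => Real.sqrt_nonneg _
  calc ‖inner ℂ (hw.vec Φ) (hw.vec Ψ)‖ ≤ ‖hw.vec Φ‖ * ‖hw.vec Ψ‖ := norm_inner_le_norm _ _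
    _ ≤ (Real.sqrt (C * 2) * scriNorm Φ) * (Real.sqrt (C * 2) * scriNorm Ψ) :=
      mul_le_mul (hn Φ) (hn Ψ) (norm_nonneg _) (mul_nonneg (Real.sqrt_nonneg _) (h0 Φ))
    _ = (Real.sqrt (C * 2) * Real.sqrt (C * 2)) * scriNorm Φ * scriNorm Ψ := by ring
    _ = _ := by rw [Real.mul_self_sqrt (by positivity)]

end Weights

/-! ### The thermal weights and their limit -/

section ThermalWeights

/-- The spectral weight of the thermal two-point function. -/
def thermalWeight (β k : ℝ) : ℝ := 2 * k / (1 - Real.exp (-β * k))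

/-- The spectral weight of the ground state. -/
def groundWeight : ℝ → ℝ := Set.indicator (Set.Ioi 0) fun k => 2 * k

theorem thermalTwoPoint_eq (β : ℝ) : thermalTwoPoint β = weightedForm (thermalWeight β) := rfl

theorem groundTwoPoint_eq : groundTwoPoint = weightedForm groundWeight := by
  ext Φ Ψ
  rw [groundTwoPoint, weightedForm, ← integral_indicator measurableSet_Ioi]
  congr 1
  ext k
  by_cases hk : k ∈ Set.Ioi (0 : ℝ) <;> simp [groundWeight, hk, spectralDensity]

theorem isSpectralWeight_groundWeight : IsSpectralWeight groundWeight where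
  measurable := (by fun_prop : Measurable fun k : ℝ => 2 * k).indicator measurableSet_Ioi
  nonneg k := Set.indicator_nonneg (fun k (hk : 0 < k) => by positivity) k
  bound := by
    refine ⟨2, by norm_num, fun k => ?_⟩
    have h0 := abs_nonneg k
    have h1 := le_abs_self k
    by_cases hk : 0 < k
    · simp only [groundWeight, Set.mem_Ioi, hk, Set.indicator_of_mem]
      linarith
    · simp only [groundWeight, Set.mem_Ioi, hk, not_false_eq_true, Set.indicator_of_notMem]
      positivity
  sub_neg k := by
    rcases lt_trichotomy k 0 with hk | rfl | hk
    · simp [groundWeight, hk, hk.le]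
    · simp
    · simp [groundWeight, hk, hk.le]

/-- Detailed balance, the source of the KMS condition. Together with `w(k) - w(-k) = 2k` it fixes
the weight wherever `βk ≠ 0`. -/
theorem thermalWeight_mul_exp (β k : ℝ) :
    thermalWeight β k * Real.exp (-β * k) = thermalWeight β (-k) := by
  simp only [thermalWeight]
  -- Here `βk = 0`, and both sides are `0` by the convention for division by zero.
  by_cases h : 1 - Real.exp (-β * k) = 0
  · have h1 : Real.exp (-β * k) = 1 := by linarith
    have h2 : Real.exp (-β * -k) = 1 := by
      rw [mul_neg, Real.exp_neg, h1, inv_one]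
    rw [h, h2]
    simp
  · have h3 : Real.exp (-β * -k) = (Real.exp (-β * k))⁻¹ := by rw [mul_neg, Real.exp_neg]
    have h4 := (Real.exp_pos (-β * k)).ne'
    have h5 : 1 - (Real.exp (-β * k))⁻¹ ≠ 0 := by
      intro h6
      apply h
      have : (Real.exp (-β * k))⁻¹ = 1 := by linarith
      rw [inv_eq_one.mp this, sub_self]
    rw [h3]
    have h6 : Real.exp (-β * k) - 1 ≠ 0 := fun h7 => h (by linarith)
    rw [mul_neg, div_mul_eq_mul_div, div_eq_div_iff h h5]
    generalize Real.exp (-β * k) = x at *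
    field_simp
    ring

theorem thermalWeight_nonneg {β : ℝ} (hβ : 0 < β) (k : ℝ) : 0 ≤ thermalWeight β k := by
  rcases le_total 0 k with hk | hk
  · have : Real.exp (-β * k) ≤ 1 := Real.exp_le_one_iff.mpr (by nlinarith)
    exact div_nonneg (by linarith) (by linarith)
  · have : 1 ≤ Real.exp (-β * k) := Real.one_le_exp (by nlinarith)
    exact div_nonneg_of_nonpos (by linarith) (by linarith)

theorem thermalWeight_sub_neg {β : ℝ} (hβ : 0 < β) (k : ℝ) :
    thermalWeight β k - thermalWeight β (-k) = 2 * k := by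
  rw [← thermalWeight_mul_exp, ← mul_one_sub, thermalWeight]
  rcases eq_or_ne k 0 with rfl | hk
  · simp
  · refine div_mul_cancel₀ _ fun h => ?_
    have h1 : Real.exp (-β * k) = 1 := by linarith
    rw [Real.exp_eq_one_iff] at h1
    rcases mul_eq_zero.mp h1 with h2 | h2
    · linarith
    · exact hk h2

/-- From `exp(-x) ≤ 1 / (1 + x)` at `x = βk`. -/
theorem thermalWeight_le_of_nonneg {β : ℝ} (hβ : 0 < β) {k : ℝ} (hk : 0 ≤ k) :
    thermalWeight β k ≤ 2 / β + 2 * k := by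
  rcases hk.eq_or_lt with rfl | hk
  · simp only [thermalWeight, mul_zero, zero_div, add_zero]
    positivity
  · have h1 : 0 < β * k := by positivity
    have h2 : (1 + β * k) * Real.exp (-β * k) ≤ 1 := by
      have h3 := Real.add_one_le_exp (β * k)
      have h4 : Real.exp (β * k) * Real.exp (-β * k) = 1 := by
        rw [← Real.exp_add]
        simp
      nlinarith [Real.exp_pos (-β * k)]
    have h5 : 0 < 1 - Real.exp (-β * k) := by nlinarith [Real.exp_pos (-β * k)]
    rw [thermalWeight, div_le_iff₀ h5]
    have h6 : 2 / β + 2 * k = 2 / β * (1 + β * k) := by field_simp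
    rw [h6]
    have h7 : 2 * k = 2 / β * (β * k) := by field_simp
    rw [h7, mul_assoc]
    exact mul_le_mul_of_nonneg_left (by linarith) (by positivity)

theorem thermalWeight_le {β : ℝ} (hβ : 0 < β) (k : ℝ) :
    thermalWeight β k ≤ 2 / β + 2 * |k| := by
  rcases le_total 0 k with hk | hk
  · rw [abs_of_nonneg hk]
    exact thermalWeight_le_of_nonneg hβ hk
  · have h1 := thermalWeight_sub_neg hβ k
    have h2 := thermalWeight_le_of_nonneg hβ (neg_nonneg.mpr hk)
    rw [abs_of_nonpos hk]
    linarith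

theorem isSpectralWeight_thermalWeight {β : ℝ} (hβ : 0 < β) :
    IsSpectralWeight (thermalWeight β) where
  measurable := by unfold thermalWeight; fun_prop
  nonneg := thermalWeight_nonneg hβ
  bound := by
    refine ⟨2 / β + 2, by positivity, fun k => (thermalWeight_le hβ k).trans ?_⟩
    have h1 : 0 ≤ 2 / β * |k| := by positivity
    have h2 := abs_nonneg k
    nlinarith
  sub_neg := thermalWeight_sub_neg hβ

theorem tendsto_thermalWeight {k : ℝ} (hk : k ≠ 0) :
    Tendsto (fun β => thermalWeight β k) atTop (𝓝 (groundWeight k)) := by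
  rcases lt_or_gt_of_ne hk with hk | hk
  · have h1 : Tendsto (fun β : ℝ => -β * k) atTop atTop := by
      simpa using tendsto_id.atTop_mul_const (neg_pos.mpr hk)
    have h2 : Tendsto (fun β : ℝ => 1 - Real.exp (-β * k)) atTop atBot :=
      tendsto_atBot_add_const_left _ _ (tendsto_neg_atTop_atBot.comp (Real.tendsto_exp_atTop.comp h1))
    have h3 : groundWeight k = 0 := by simp [groundWeight, hk.le]
    rw [h3]
    exact h2.const_div_atBot (2 * k)
  · have h1 : Tendsto (fun β : ℝ => -β * k) atTop atBot := by
      simpa using (tendsto_id.atTop_mul_const hk)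
    have h2 : Tendsto (fun β : ℝ => 2 * k / (1 - Real.exp (-β * k))) atTop
        (𝓝 (2 * k / (1 - 0))) :=
      tendsto_const_nhds.div ((Real.tendsto_exp_atBot.comp h1).const_sub 1) (by norm_num)
    have h3 : groundWeight k = 2 * k := by simp [groundWeight, hk]
    rw [h3]
    simpa [thermalWeight] using h2

/-- The thermal two-point functions converge weakly to that of the ground state. -/
theorem tendsto_thermalTwoPoint (Φ Ψ : ScriSpace) :
    Tendsto (fun β : ℝ => thermalTwoPoint β Φ Ψ) atTop (𝓝 (groundTwoPoint Φ Ψ)) := by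
  simp only [thermalTwoPoint_eq, groundTwoPoint_eq, weightedForm]
  -- For `β ≥ 1` the weight is at most `2/β + 2|k| ≤ 2 (1 + |k|) ≤ 4 (1 + k²)`, uniformly in `β`.
  refine tendsto_integral_filter_of_dominated_convergence
    (fun k => 4 * ((1 + k ^ 2) * ‖spectralDensity Φ Ψ k‖)) ?_ ?_
    ((integrable_sq_spectralDensity Φ Ψ).const_mul 4) ?_
  · filter_upwards [eventually_gt_atTop 0] with β hβ
    exact ((isSpectralWeight_thermalWeight hβ).integrable Φ Ψ).1
  · filter_upwards [eventually_ge_atTop 1] with β hβ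
    refine Eventually.of_forall fun k => ?_
    have hβ' : 0 < β := by linarith
    rw [norm_mul, Complex.norm_real, Real.norm_of_nonneg (thermalWeight_nonneg hβ' k), ← mul_assoc]
    refine mul_le_mul_of_nonneg_right ((thermalWeight_le hβ' k).trans ?_) (norm_nonneg _)
    have h1 : 2 / β ≤ 2 := div_le_self (by norm_num) hβ
    linarith [one_add_abs_le k]
  · have h2 : ∀ᵐ k : ℝ, k ≠ 0 := by simp [ae_iff]
    filter_upwards [h2] with k hk
    exact ((Complex.continuous_ofReal.tendsto _).comp (tendsto_thermalWeight hk)).mul_const _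

end ThermalWeights

/-! ### Analytic continuation of the two-point function -/

section StripKernel

variable {w : ℝ → ℝ} {β : ℝ}

/-- The translates of `Φ`. -/
abbrev scriShift (t : ℝ) : ScriSpace ≃ₗ[ℝ] ScriSpace := scriAct t (LinearIsometryEquiv.refl ℝ _)

/-- The analytic continuation of `t ↦ λ(Φ, Ψ_t)`. -/
def stripKernel (w : ℝ → ℝ) (Φ Ψ : ScriSpace) (z : ℂ) : ℂ :=
  ∫ k : ℝ, (w k : ℂ) * Complex.exp (Complex.I * k * z) * spectralDensity Φ Ψ k

theorem stripKernel_ofReal (Φ Ψ : ScriSpace) (t : ℝ) :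
    stripKernel w Φ Ψ t = weightedForm w Φ (scriShift t Ψ) := by
  refine integral_congr_ae ?_
  filter_upwards [spectralDensity_translate t Φ Ψ] with k hk
  rw [hk, mul_assoc]

/-- On the upper edge the exponential contributes `exp(-βk)`. Detailed balance turns `w(k)` into
`w(-k)`, and the reflection `k ↦ -k` exchanges the two arguments. -/
theorem stripKernel_add_mul_I (hw : ∀ k, w k * Real.exp (-β * k) = w (-k)) (Φ Ψ : ScriSpace)
    (t : ℝ) :
    stripKernel w Φ Ψ (t + β * Complex.I) = weightedForm w (scriShift t Ψ) Φ := by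
  rw [weightedForm, ← integral_neg_eq_self, stripKernel]
  refine integral_congr_ae ?_
  filter_upwards [spectralDensity_translate t Φ Ψ,
    spectralDensity_neg (scriShift t Ψ) Φ] with k h1 h2
  rw [h2, h1, ← hw k]
  push_cast
  have h3 : Complex.exp (Complex.I * k * (t + β * Complex.I)) =
      Complex.exp (-β * k) * Complex.exp (Complex.I * k * t) := by
    rw [← Complex.exp_add]
    congr 1
    linear_combination (k * β : ℂ) * Complex.I_mul_I
  rw [h3]
  ring

/-- For `k ≥ 0` the exponential is at most `1`; for `k ≤ 0` it is at most `exp(-βk)`, which detailed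
balance absorbs into `w(-k)`. -/
theorem IsSpectralWeight.norm_exp_le (hw : IsSpectralWeight w)
    (hw' : ∀ k, w k * Real.exp (-β * k) = w (-k)) {C : ℝ} (hC : ∀ k, w k ≤ C * (1 + |k|))
    (k : ℝ) {z : ℂ} (h0 : 0 ≤ z.im) (h1 : z.im ≤ β) :
    ‖(w k : ℂ) * Complex.exp (Complex.I * k * z)‖ ≤ C * (1 + |k|) := by
  have h2 : (Complex.I * k * z).re = -z.im * k := by simp; ring
  rw [norm_mul, Complex.norm_real, Real.norm_of_nonneg (hw.nonneg k), Complex.norm_exp, h2]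
  rcases le_total 0 k with hk | hk
  · have h3 : Real.exp (-z.im * k) ≤ 1 := Real.exp_le_one_iff.mpr (by nlinarith)
    exact (mul_le_of_le_one_right (hw.nonneg k) h3).trans (hC k)
  · have h3 : Real.exp (-z.im * k) ≤ Real.exp (-β * k) := Real.exp_le_exp.mpr (by nlinarith)
    refine (mul_le_mul_of_nonneg_left h3 (hw.nonneg k)).trans ?_
    rw [hw', ← abs_neg]
    exact hC _

/-- Dominated convergence. The symbol grows linearly in `k` and its `z`-derivative quadratically,
just what the second moment of the spectral density allows. -/
theorem IsSpectralWeight.isStripFun_stripKernel (hw : IsSpectralWeight w)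
    (hw' : ∀ k, w k * Real.exp (-β * k) = w (-k)) (Φ Ψ : ScriSpace) :
    IsStripFun β (stripKernel w Φ Ψ) := by
  obtain ⟨C, hC0, hC⟩ := hw.bound
  have hm : ∀ z : ℂ, AEStronglyMeasurable
      (fun k : ℝ => (w k : ℂ) * Complex.exp (Complex.I * k * z) * spectralDensity Φ Ψ k) volume :=
    fun z => ((Complex.measurable_ofReal.comp hw.measurable).mul
      (by fun_prop)).aestronglyMeasurable.mul (aestronglyMeasurable_spectralDensity Φ Ψ)
  have hint : Integrable fun k : ℝ => C * 2 * ((1 + k ^ 2) * ‖spectralDensity Φ Ψ k‖) :=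
    (integrable_sq_spectralDensity Φ Ψ).const_mul _
  have hb : ∀ z : ℂ, 0 ≤ z.im → z.im ≤ β → ∀ k : ℝ,
      ‖(w k : ℂ) * Complex.exp (Complex.I * k * z) * spectralDensity Φ Ψ k‖ ≤
        C * 2 * ((1 + k ^ 2) * ‖spectralDensity Φ Ψ k‖) := by
    intro z h0 h1 k
    rw [norm_mul, ← mul_assoc]
    refine mul_le_mul_of_nonneg_right ((hw.norm_exp_le hw' hC k h0 h1).trans ?_) (norm_nonneg _)
    rw [mul_assoc]
    exact mul_le_mul_of_nonneg_left (one_add_abs_le k) hC0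
  refine ⟨?_, ?_, ?_⟩
  · refine continuousOn_of_dominated (fun z _ => hm z)
      (fun z hz => Eventually.of_forall (hb z hz.1 hz.2)) hint (Eventually.of_forall fun k => ?_)
    fun_prop
  · have ho : IsOpen {z : ℂ | 0 < z.im ∧ z.im < β} :=
      (isOpen_lt continuous_const Complex.continuous_im).inter
        (isOpen_lt Complex.continuous_im continuous_const)
    intro z hz
    refine (hasDerivAt_integral_of_dominated_loc_of_deriv_le (𝕜 := ℂ)
      (F' := fun (z : ℂ) (k : ℝ) => (Complex.I * k) *
        ((w k : ℂ) * Complex.exp (Complex.I * k * z) * spectralDensity Φ Ψ k))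
      (bound := fun k => C * 2 * ((1 + k ^ 2) * ‖spectralDensity Φ Ψ k‖))
      (ho.mem_nhds hz) (Eventually.of_forall hm)
      (hint.mono' (hm z) (Eventually.of_forall (hb z hz.1.le hz.2.le)))
      ((by fun_prop : Continuous fun k : ℝ => Complex.I * (k : ℂ)).aestronglyMeasurable.mul (hm z))
      (Eventually.of_forall fun k y hy => ?_) hint
      (Eventually.of_forall fun k y hy => ?_)).2.differentiableAt.differentiableWithinAt
    · have h1 := hw.norm_exp_le hw' hC k hy.1.le hy.2.le
      rw [norm_mul, norm_mul, norm_mul, Complex.norm_I, one_mul, Complex.norm_real, Real.norm_eq_abs,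
        ← mul_assoc, ← mul_assoc]
      refine mul_le_mul_of_nonneg_right ?_ (norm_nonneg _)
      calc |k| * _ ≤ |k| * (C * (1 + |k|)) := mul_le_mul_of_nonneg_left h1 (abs_nonneg k)
        _ = C * (|k| + |k| ^ 2) := by ring
        _ ≤ C * (2 * (1 + k ^ 2)) := by
          refine mul_le_mul_of_nonneg_left ?_ hC0
          rw [← sq_abs k]
          nlinarith [sq_nonneg (|k| - 1)]
        _ = _ := by ring
    · have h1 : HasDerivAt (fun z : ℂ => Complex.exp (Complex.I * k * z))
          (Complex.exp (Complex.I * k * y) * (Complex.I * k * 1)) y :=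
        ((hasDerivAt_id y).const_mul (Complex.I * (k : ℂ))).cexp
      refine ((h1.const_mul (w k : ℂ)).mul_const (spectralDensity Φ Ψ k)).congr_deriv ?_
      ring
  · refine ⟨∫ k : ℝ, C * 2 * ((1 + k ^ 2) * ‖spectralDensity Φ Ψ k‖), fun z h0 h1 => ?_⟩
    exact norm_integral_le_of_norm_le hint (Eventually.of_forall (hb z h0 h1))

end StripKernel

/-! ### The KMS condition as translation invariance of the ratio -/

section KMSRatio

variable {w : ℝ → ℝ} {β : ℝ}

theorem scriShift_zero (Φ : ScriSpace) : scriShift 0 Φ = Φ := by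
  ext p
  simp [scriAct, scriMotion, sphereMap]
  rfl

theorem norm_weylAut {S : Type*} [AddCommGroup S] [Module ℝ S] {σ : LinearMap.BilinForm ℝ S}
    (T : S ≃ₗ[ℝ] S) (hT : ∀ s t, σ (T s) (T t) = σ s t) (a : WeylAlgebra σ) :
    ‖weylAut T hT a‖ = ‖a‖ :=
  NonUnitalStarAlgHom.norm_map (permAut T) (permAut T).injective (a : SOp S)

theorem scriAut_weylGen (t : ℝ) (R : Rot) (Φ : ScriSpace) :
    scriAut t R (weylGen scriSymp Φ) = weylGen scriSymp (scriAct t R Φ) :=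
  weylAut_weylGen _ _ _

theorem vTranslation_weylGen (t : ℝ) (Φ : ScriSpace) :
    vTranslation t (weylGen scriSymp Φ) = weylGen scriSymp (scriShift t Φ) :=
  weylAut_weylGen _ _ _

theorem IsSpectralWeight.weightedForm_self (hw : IsSpectralWeight w) (Φ : ScriSpace) :
    weightedForm w Φ Φ = ((‖hw.vec Φ‖ ^ 2 : ℝ) : ℂ) := by
  rw [hw.weightedForm_eq, scriSymp_isAlt, hw.realForm_self]
  simp

theorem IsSpectralWeight.weightedForm_add_self (hw : IsSpectralWeight w) (Φ Ψ : ScriSpace) :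
    weightedForm w (Φ + Ψ) (Φ + Ψ) = weightedForm w Φ Φ + weightedForm w Ψ Ψ +
      2 * weightedForm w Φ Ψ + Complex.I * scriSymp Φ Ψ := by
  have h := hw.realForm_symm Φ Ψ
  simp only [hw.weightedForm_eq, map_add, LinearMap.add_apply, scriSymp_isAlt.self_eq_zero,
    ← scriSymp_isAlt.neg_eq Φ Ψ, h]
  push_cast
  ring

/-- The quotient of a functional by the quasifree state on a Weyl generator. -/
def weylRatio (w : ℝ → ℝ) (φ : ScriWeyl →L[ℂ] ℂ) (Φ : ScriSpace) : ℂ :=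
  φ (weylGen scriSymp Φ) * Complex.exp (weightedForm w Φ Φ / 2)

theorem apply_weylGen_eq_weylRatio (w : ℝ → ℝ) (φ : ScriWeyl →L[ℂ] ℂ) (Φ : ScriSpace) :
    φ (weylGen scriSymp Φ) = Complex.exp (-weightedForm w Φ Φ / 2) * weylRatio w φ Φ := by
  rw [weylRatio, mul_left_comm, ← Complex.exp_add, neg_div, neg_add_cancel, Complex.exp_zero,
    mul_one]

/-- The phase of the Weyl relation cancels the `σ` term in the form at `Φ + Ψ`. What remains is the
form at `(Φ, Ψ)`, in the order of the operator product, which is the edge value of `stripKernel`. -/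
theorem IsSpectralWeight.apply_weylGen_mul (hw : IsSpectralWeight w) (φ : ScriWeyl →L[ℂ] ℂ)
    (Φ Ψ : ScriSpace) :
    φ (weylGen scriSymp Φ * weylGen scriSymp Ψ) =
      Complex.exp (-(weightedForm w Φ Φ + weightedForm w Ψ Ψ) / 2) *
        Complex.exp (-weightedForm w Φ Ψ) * weylRatio w φ (Φ + Ψ) := by
  rw [weylGen_mul scriSymp scriSymp_isAlt, map_smul, smul_eq_mul, apply_weylGen_eq_weylRatio w,
    ← mul_assoc, ← Complex.exp_add, ← Complex.exp_add, hw.weightedForm_add_self]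
  congr 2
  ring

/-- For a KMS functional the quotient depends on `Φ` only up to translation of its summands. -/
theorem IsSpectralWeight.weylRatio_add_scriShift (hw : IsSpectralWeight w) (hβ : 0 < β)
    (hw' : ∀ k, w k * Real.exp (-β * k) = w (-k)) {φ : ScriWeyl →L[ℂ] ℂ}
    (hφ : IsKMS vTranslation β φ) (Φ Ψ : ScriSpace) (t : ℝ) :
    weylRatio w φ (Φ + scriShift t Ψ) = weylRatio w φ (Φ + Ψ) := by
  obtain ⟨F, hF, hFt⟩ := isKMS_iff.mp hφ (weylGen scriSymp Φ) (weylGen scriSymp Ψ)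
  -- The factor cancels the order-dependent exponential on each edge, so both edges carry the same
  -- function of `t`.
  set G : ℂ → ℂ := fun z => F z * Complex.exp (stripKernel w Φ Ψ z) with hG
  have hGs : IsStripFun β G := hF.mul (hw.isStripFun_stripKernel hw' Φ Ψ).exp
  set c := Complex.exp (-(weightedForm w Φ Φ + weightedForm w Ψ Ψ) / 2) with hc
  have h1 : ∀ t : ℝ, G t = c * weylRatio w φ (Φ + scriShift t Ψ) := by
    intro t
    simp only [hG]
    rw [(hFt t).1, vTranslation_weylGen, hw.apply_weylGen_mul, stripKernel_ofReal,
      weightedForm_scriAct, Complex.exp_neg]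
    rw [mul_right_comm, mul_assoc c, inv_mul_cancel₀ (Complex.exp_ne_zero _), mul_one]
  have h2 : ∀ t : ℝ, G (t + β * Complex.I) = c * weylRatio w φ (Φ + scriShift t Ψ) := by
    intro t
    simp only [hG]
    rw [(hFt t).2, vTranslation_weylGen, hw.apply_weylGen_mul, stripKernel_add_mul_I hw',
      weightedForm_scriAct, Complex.exp_neg, add_comm (scriShift t Ψ), add_comm (weightedForm w Ψ Ψ)]
    rw [mul_right_comm, mul_assoc c, inv_mul_cancel₀ (Complex.exp_ne_zero _), mul_one]
  have h3 := hGs.eq_of_periodic hβ (fun t => by rw [h1, h2]) t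
  have h4 := h1 0
  rw [scriShift_zero, Complex.ofReal_zero] at h4
  rw [h1, h4] at h3
  exact mul_left_cancel₀ (Complex.exp_ne_zero _) h3

/-- The converse of `IsSpectralWeight.weylRatio_add_scriShift`. -/
theorem IsSpectralWeight.isKMS_of_weylRatio (hw : IsSpectralWeight w) (hβ : 0 < β)
    (hw' : ∀ k, w k * Real.exp (-β * k) = w (-k)) {φ : ScriWeyl →L[ℂ] ℂ}
    (h : ∀ Φ Ψ t, weylRatio w φ (Φ + scriShift t Ψ) = weylRatio w φ (Φ + Ψ)) :
    IsKMS vTranslation β φ := by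
  refine isKMS_of_dense hβ (α := fun t => (scriAut t (LinearIsometryEquiv.refl ℝ _) :
    ScriWeyl →ₐ[ℂ] ScriWeyl).toLinearMap) (fun t a => norm_weylAut _ (scriAct_symp t _) a)
    (X := Set.range (weylGen scriSymp)) ?_ ?_
  · rw [← range_weylSum]
    exact denseRange_weylSum scriSymp_isAlt
  · rintro _ ⟨Φ, rfl⟩ _ ⟨Ψ, rfl⟩
    -- The ratio being constant in `t`, the strip function is this constant times the exponential of
    -- minus the kernel.
    refine ⟨_, (isStripFun_const (Complex.exp (-(weightedForm w Φ Φ + weightedForm w Ψ Ψ) / 2) *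
      weylRatio w φ (Φ + Ψ))).mul
      ((isStripFun_const (-1)).mul (hw.isStripFun_stripKernel hw' Φ Ψ)).exp, fun t => ⟨?_, ?_⟩⟩
    · change _ = φ (weylGen scriSymp Φ * vTranslation t (weylGen scriSymp Ψ))
      rw [vTranslation_weylGen, hw.apply_weylGen_mul, stripKernel_ofReal,
        weightedForm_scriAct, h, neg_one_mul]
      ring
    · change _ = φ (vTranslation t (weylGen scriSymp Ψ) * weylGen scriSymp Φ)
      rw [vTranslation_weylGen, hw.apply_weylGen_mul, stripKernel_add_mul_I hw',
        weightedForm_scriAct, add_comm (scriShift t Ψ), h, neg_one_mul,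
        add_comm (weightedForm w Ψ Ψ)]
      ring

end KMSRatio

/-! ### Averages over translations -/

section Averages

/-- The averages `(1/N) ∑_{j<N} Φ_j` of the translates of `Φ`. -/
def scriAverage (N : ℕ) : ScriSpace →ₗ[ℝ] ScriSpace :=
  (N : ℝ)⁻¹ • ∑ j ∈ Finset.range N, (scriShift j).toLinearMap

theorem scriAverage_apply (N : ℕ) (Φ : ScriSpace) :
    scriAverage N Φ = (N : ℝ)⁻¹ • ∑ j ∈ Finset.range N, scriShift j Φ := by
  simp [scriAverage]

/-- Functions that do not see translations of summands do not see averages. -/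
theorem apply_add_scriAverage {X : Type*} {r : ScriSpace → X}
    (h : ∀ Φ Ψ t, r (Φ + scriShift t Ψ) = r (Φ + Ψ)) {N : ℕ} (hN : N ≠ 0) (Φ Ψ : ScriSpace) :
    r (Φ + scriAverage N Ψ) = r (Φ + Ψ) := by
  -- The translations are removed one summand at a time; then take `Θ = Ψ / N`, so that `N` copies
  -- give back `Ψ`.
  have key : ∀ (n : ℕ) (Φ Θ : ScriSpace),
      r (Φ + ∑ j ∈ Finset.range n, scriShift j Θ) = r (Φ + n • Θ) := by
    intro n
    induction n with
    | zero => simp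
    | succ n ih =>
      intro Φ Θ
      rw [Finset.sum_range_succ, ← add_assoc, h, add_right_comm, ih, succ_nsmul]
      congr 1
      abel
  have h1 := key N Φ ((N : ℝ)⁻¹ • Ψ)
  simp only [map_smul, ← Finset.smul_sum] at h1
  rw [scriAverage_apply, h1]
  congr 2
  rw [← Nat.cast_smul_eq_nsmul ℝ, smul_smul, mul_inv_cancel₀ (by exact_mod_cast hN), one_smul]

/-- The Fourier multiplier of `scriAverage N`. -/
def averageMultiplier (N : ℕ) (k : ℝ) : ℂ :=
  (N : ℂ)⁻¹ * ∑ j ∈ Finset.range N, Complex.exp (Complex.I * k * j)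

theorem norm_averageMultiplier_le (N : ℕ) (k : ℝ) : ‖averageMultiplier N k‖ ≤ 1 := by
  rw [averageMultiplier, norm_mul, norm_inv, Complex.norm_natCast]
  have h1 : ‖∑ j ∈ Finset.range N, Complex.exp (Complex.I * k * j)‖ ≤ N := by
    refine (norm_sum_le _ _).trans (le_of_eq ?_)
    have : ∀ j : ℕ, ‖Complex.exp (Complex.I * k * j)‖ = 1 := fun j => by
      rw [Complex.norm_exp]
      simp
    simp [this]
  rcases N.eq_zero_or_pos with rfl | hN
  · simp
  · rw [inv_mul_le_iff₀ (by exact_mod_cast hN)]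
    simpa using h1

/-- The geometric sum is bounded by `2 / |exp(ik) - 1|`, independently of `N`. -/
theorem tendsto_averageMultiplier {k : ℝ} (hk : Complex.exp (Complex.I * k) ≠ 1) :
    Tendsto (fun N => averageMultiplier N k) atTop (𝓝 0) := by
  have h1 : ∀ N : ℕ, ‖averageMultiplier N k‖ ≤
      (N : ℝ)⁻¹ * (2 / ‖Complex.exp (Complex.I * k) - 1‖) := by
    intro N
    have h2 : ∀ j : ℕ, Complex.exp (Complex.I * k * j) = Complex.exp (Complex.I * k) ^ j := fun j => by
      rw [← Complex.exp_nat_mul, mul_comm]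
    rw [averageMultiplier, norm_mul, norm_inv, Complex.norm_natCast]
    simp only [h2]
    rw [geom_sum_eq hk, norm_div]
    gcongr
    refine (norm_sub_le _ _).trans ?_
    rw [norm_pow, Complex.norm_exp]
    simp
    norm_num
  refine squeeze_zero_norm h1 ?_
  simpa using (tendsto_inv_atTop_nhds_zero_nat (𝕜 := ℝ)).mul_const
    (2 / ‖Complex.exp (Complex.I * k) - 1‖)

theorem ae_exp_I_mul_ne_one : ∀ᵐ k : ℝ, Complex.exp (Complex.I * k) ≠ 1 := by
  have h : {k : ℝ | Complex.exp (Complex.I * k) = 1} ⊆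
      Set.range fun n : ℤ => (n : ℝ) * (2 * Real.pi) := by
    intro k hk
    obtain ⟨n, hn⟩ := Complex.exp_eq_one_iff.mp hk
    refine ⟨n, ?_⟩
    have h1 : Complex.I * ((n : ℝ) * (2 * Real.pi) : ℝ) = Complex.I * k := by
      rw [hn]
      push_cast
      ring
    exact_mod_cast mul_left_cancel₀ Complex.I_ne_zero h1
  rw [ae_iff]
  simp only [not_not]
  exact measure_mono_null h ((Set.countable_range _).measure_zero volume)

theorem scriFourier_scriAverage (N : ℕ) (Φ : ScriSpace) :
    ∀ᵐ k : ℝ, scriFourier (scriAverage N Φ) k = averageMultiplier N k • scriFourier Φ k := by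
  have key : ∀ n : ℕ, ∀ᵐ k : ℝ, scriFourier (∑ j ∈ Finset.range n, scriShift j Φ) k =
      (∑ j ∈ Finset.range n, Complex.exp (Complex.I * k * j)) • scriFourier Φ k := by
    intro n
    induction n with
    | zero =>
      filter_upwards [scriFourier_smul 0 0] with k hk
      simpa using hk
    | succ n ih =>
      filter_upwards [ih, scriFourier_add (∑ j ∈ Finset.range n, scriShift j Φ) (scriShift n Φ),
        scriFourier_scriAct n (LinearIsometryEquiv.refl ℝ _) Φ] with k h1 h2 h3
      rw [Finset.sum_range_succ, h2, h1, h3, rotL2S_refl, Finset.sum_range_succ, add_smul]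
      simp
  filter_upwards [key N, scriFourier_smul (N : ℝ)⁻¹ (∑ j ∈ Finset.range N, scriShift j Φ)]
    with k h1 h2
  rw [scriAverage_apply, h2, h1, smul_smul, averageMultiplier]
  push_cast
  rfl

theorem integrable_sq_scriFourier (Φ : ScriSpace) :
    Integrable fun k : ℝ => (1 + k ^ 2) * ‖scriFourier Φ k‖ ^ 2 := by
  refine (integrable_sq_spectralDensity Φ Φ).congr (Eventually.of_forall fun k => ?_)
  simp [spectralDensity_self]

theorem scriNorm_eq (Φ : ScriSpace) :
    scriNorm Φ = Real.sqrt (∫ k : ℝ, (1 + k ^ 2) * ‖scriFourier Φ k‖ ^ 2) := by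
  have hi1 : Integrable fun k => ‖scriFourier Φ k‖ ^ 2 :=
    (memLp_two_iff_integrable_sq_norm (memLp_scriFourier Φ).1).mp (memLp_scriFourier Φ)
  have hi2 : Integrable fun k : ℝ => k ^ 2 * ‖scriFourier Φ k‖ ^ 2 := by
    refine ((integrable_sq_scriFourier Φ).sub hi1).congr (Eventually.of_forall fun k => ?_)
    simp only [Pi.sub_apply]
    ring
  rw [scriNorm, ← integral_norm_sq_scriFourier, ← integral_sq_mul_scriFourier, ← integral_add hi1 hi2]
  congr 2
  ext k
  ring

/-- The mean ergodic theorem: the multipliers are bounded by `1` and tend to `0` off the null set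
`2πℤ`, so `(1 + k²) ‖Φ̂‖²` dominates. -/
theorem tendsto_scriNorm_scriAverage (Φ : ScriSpace) :
    Tendsto (fun N => scriNorm (scriAverage N Φ)) atTop (𝓝 0) := by
  simp only [scriNorm_eq]
  rw [← Real.sqrt_zero]
  refine (Real.continuous_sqrt.tendsto _).comp ?_
  have h0 : ∫ k : ℝ, (0 : ℝ) = 0 := by simp
  rw [← h0]
  refine tendsto_integral_of_dominated_convergence
    (fun k : ℝ => (1 + k ^ 2) * ‖scriFourier Φ k‖ ^ 2)
    (fun N => (integrable_sq_scriFourier _).1) (integrable_sq_scriFourier Φ) (fun N => ?_) ?_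
  · filter_upwards [scriFourier_scriAverage N Φ] with k hk
    rw [Real.norm_of_nonneg (by positivity), hk, norm_smul]
    have := norm_averageMultiplier_le N k
    gcongr
    exact mul_le_of_le_one_left (norm_nonneg _) this
  · filter_upwards [ae_all_iff.mpr fun N => scriFourier_scriAverage N Φ, ae_exp_I_mul_ne_one]
      with k h1 h2
    simp only [h1, norm_smul]
    have h3 := ((tendsto_averageMultiplier h2).norm.mul_const ‖scriFourier Φ k‖).pow 2
    simpa using h3.const_mul (1 + k ^ 2)

end Averages

/-! ### Perturbing a state by `1 ± W(s)` -/

section Perturbation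

open scoped ComplexOrder

variable {S : Type*} [AddCommGroup S] [Module ℝ S] {σ : LinearMap.BilinForm ℝ S}

theorem IsTwistedPosDef.of_tendsto {f : ℕ → S → ℂ} {g : S → ℂ} (hf : ∀ n, IsTwistedPosDef σ (f n))
    (h : ∀ s, Tendsto (fun n => f n s) atTop (𝓝 (g s))) : IsTwistedPosDef σ g :=
  Matrix.PosSemidef.of_tendsto hf fun _ _ => (h _).const_mul _

theorem IsTwistedPosDef.const_mul {f : S → ℂ} (hf : IsTwistedPosDef σ f) {c : ℝ} (hc : 0 ≤ c) :
    IsTwistedPosDef σ fun s => c * f s := by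
  have h : (0 : ℂ) ≤ c := Complex.zero_le_real.mpr hc
  have h2 := Matrix.PosSemidef.smul hf h
  have h3 : ((c : ℂ) • Matrix.of fun s t => Complex.exp (-(Complex.I / 2 * σ s t)) * f (t - s)) =
      Matrix.of fun s t => Complex.exp (-(Complex.I / 2 * σ s t)) * (c * f (t - s)) := by
    ext s t
    simp
    ring
  rw [h3] at h2
  exact h2

theorem map_conj_perturbation {A : Type*} [Ring A] [StarRing A] [Algebra ℂ A] [StarModule ℂ A]
    (φ : A →ₗ[ℂ] ℂ) {u x : A} {ε : ℝ} (hε : ε ^ 2 = 1) :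
    φ (star (1 + (ε : ℂ) • u) * x * (1 + (ε : ℂ) • u)) =
      φ x + ε * φ (star u * x) + ε * φ (x * u) + φ (star u * x * u) := by
  have h3 : (ε : ℂ) * ε = 1 := by
    rw [← sq]
    exact_mod_cast hε
  have h : star (1 + (ε : ℂ) • u) * x * (1 + (ε : ℂ) • u) =
      x + (ε : ℂ) • (star u * x) + (ε : ℂ) • (x * u) + star u * x * u := by
    rw [star_add, star_one, star_smul, Complex.star_def, Complex.conj_ofReal]
    simp only [add_mul, mul_add, one_mul, mul_one, smul_mul_assoc, mul_smul_comm, smul_add,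
      smul_smul, h3, one_smul]
    abel
  rw [h]
  simp

/-- Used with an average for `s`. Then `σ(t,s) → 0`, all the phases tend to `1`, and the expression
becomes symmetric in `± s`. -/
theorem weylGen_conj_perturbation (hσ : σ.IsAlt) (φ : WeylAlgebra σ →L[ℂ] ℂ) {ε : ℝ}
    (hε : ε ^ 2 = 1) (s t : S) :
    φ (star (1 + (ε : ℂ) • weylGen σ s) * weylGen σ t * (1 + (ε : ℂ) • weylGen σ s)) =
      (1 + Complex.exp (Complex.I * σ t s)) * φ (weylGen σ t) +
        ε * (Complex.exp (Complex.I / 2 * σ t s) *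
          (φ (weylGen σ (t + s)) + φ (weylGen σ (t - s)))) := by
  have h1 : σ s t = -σ t s := by rw [hσ.neg_eq]
  have h2 : star (weylGen σ s) * weylGen σ t * weylGen σ s =
      Complex.exp (Complex.I * σ t s) • weylGen σ t := by
    rw [weylGen_star_mul hσ, smul_mul_assoc, weylGen_mul σ hσ, sub_add_cancel, smul_smul,
      ← Complex.exp_add, map_sub, LinearMap.sub_apply, hσ s, h1]
    congr 2
    push_cast
    ring
  have h4 : φ (star (weylGen σ s) * weylGen σ t) =
      Complex.exp (Complex.I / 2 * σ t s) * φ (weylGen σ (t - s)) := by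
    rw [weylGen_star_mul hσ, map_smul, smul_eq_mul, h1]
    congr 2
    push_cast
    ring
  have h5 : φ (weylGen σ t * weylGen σ s) =
      Complex.exp (Complex.I / 2 * σ t s) * φ (weylGen σ (t + s)) := by
    rw [weylGen_mul σ hσ, map_smul, smul_eq_mul]
  have h6 : φ (star (weylGen σ s) * weylGen σ t * weylGen σ s) =
      Complex.exp (Complex.I * σ t s) * φ (weylGen σ t) := by
    rw [h2, map_smul, smul_eq_mul]
  have h7 : φ (star (1 + (ε : ℂ) • weylGen σ s) * weylGen σ t * (1 + (ε : ℂ) • weylGen σ s)) =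
      φ (weylGen σ t) + ε * φ (star (weylGen σ s) * weylGen σ t) +
        ε * φ (weylGen σ t * weylGen σ s) + φ (star (weylGen σ s) * weylGen σ t * weylGen σ s) :=
    map_conj_perturbation φ.toLinearMap hε
  linear_combination h7 + ε * h4 + ε * h5 + h6

theorem isTwistedPosDef_conj (hσ : σ.IsAlt) {φ : WeylAlgebra σ →L[ℂ] ℂ} (hφ : IsState φ)
    (x : WeylAlgebra σ) : IsTwistedPosDef σ fun s => φ (star x * weylGen σ s * x) := by
  refine IsPositiveOn.isTwistedPosDef hσ
    (g := φ.toLinearMap ∘ₗ LinearMap.mulRight ℂ x ∘ₗ LinearMap.mulLeft ℂ (star x)) fun a _ => ?_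
  have h := hφ.2 (a * x)
  rw [star_mul, mul_assoc, ← mul_assoc (star a), ← mul_assoc (star x)] at h
  exact h

end Perturbation

/-! ### Components of a convex decomposition -/

section Decomposition

variable {A : Type*} [NormedRing A] [StarRing A] [NormedAlgebra ℂ A] [StarModule ℂ A]

/-- Components of a state are close to `1` on isometries on which the state is close to `1`. -/
theorem IsState.norm_sub_one_sq_le {φ φ₁ φ₂ : A →L[ℂ] ℂ} (h1 : IsState φ₁) (h : IsState φ)
    (h2 : IsState φ₂) {p q : ℝ} (hp : 0 < p) (hq : 0 ≤ q) (hpq : p • φ₁ + q • φ₂ = φ) {u : A}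
    (hu : star u * u = 1) : ‖φ₁ u - 1‖ ^ 2 ≤ p⁻¹ * (2 - 2 * (φ u).re) := by
  have hpos : ∀ {ψ : A →L[ℂ] ℂ}, IsState ψ → IsPositiveOn ψ.toLinearMap ⊤ := fun hψ x _ => hψ.2 x
  -- Cauchy-Schwarz for `φ₁` at `u - 1`, together with `p φ₁(x* x) ≤ φ(x* x) = 2 - 2 Re φ(u)`.
  set x : A := u - 1 with hx
  have k2 : ‖φ₁ x‖ ^ 2 ≤ (φ₁ (star x * x)).re :=
    (hpos h1).norm_sq_le h1.1 (StarSubalgebra.mem_top (x := x))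
  have k3 : φ₁ x = φ₁ u - 1 := by rw [hx, map_sub, h1.1]
  have k4 : φ (star x * x) = 2 - φ u - starRingEnd ℂ (φ u) := by
    have k5 : star x * x = (1 - u) - star u + 1 := by
      rw [hx, star_sub, star_one, sub_mul, mul_sub, hu]
      noncomm_ring
    have k6 : φ (star u) = starRingEnd ℂ (φ u) := (hpos h).map_star (StarSubalgebra.mem_top (x := u))
    rw [k5, map_add, map_sub, map_sub, k6, h.1]
    ring
  have k5 : p * (φ₁ (star x * x)).re + q * (φ₂ (star x * x)).re = (φ (star x * x)).re := by
    rw [← hpq]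
    simp
  have k7 : (φ (star x * x)).re = 2 - 2 * (φ u).re := by
    rw [k4]
    simp
    ring
  rw [← k3, le_inv_mul_iff₀ hp, ← k7, ← k5]
  have k8 : 0 ≤ q * (φ₂ (star x * x)).re := mul_nonneg hq (h2.2 x).1
  have k9 := mul_le_mul_of_nonneg_left k2 hp.le
  linarith

end Decomposition

/-! ### Uniqueness and extremality of the thermal state -/

section Uniqueness

variable {w : ℝ → ℝ} {β : ℝ} {φ : ScriWeyl →L[ℂ] ℂ}

theorem IsSpectralWeight.tendsto_vec_scriAverage (hw : IsSpectralWeight w) (Φ : ScriSpace) :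
    Tendsto (fun N => hw.vec (scriAverage N Φ)) atTop (𝓝 0) := by
  obtain ⟨C, hC⟩ := hw.isContinuousTwoPoint
  rw [tendsto_zero_iff_norm_tendsto_zero]
  have h1 : Tendsto (fun N => Real.sqrt (C * scriNorm (scriAverage N Φ) *
      scriNorm (scriAverage N Φ))) atTop (𝓝 0) := by
    have h2 := (((tendsto_scriNorm_scriAverage Φ).const_mul C).mul
      (tendsto_scriNorm_scriAverage Φ)).sqrt
    simpa using h2
  refine squeeze_zero (fun _ => norm_nonneg _) (fun N => Real.le_sqrt_of_sq_le ?_) h1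
  refine le_trans (le_of_eq ?_) (hC _ _)
  rw [hw.weightedForm_self, Complex.norm_real, Real.norm_of_nonneg (by positivity)]

theorem IsSpectralWeight.tendsto_weightedForm_add_scriAverage (hw : IsSpectralWeight w)
    (Φ Ψ : ScriSpace) :
    Tendsto (fun N => weightedForm w (Φ + scriAverage N Ψ) (Φ + scriAverage N Ψ)) atTop
      (𝓝 (weightedForm w Φ Φ)) := by
  simp only [hw.weightedForm_self, hw.vec_add]
  refine (Complex.continuous_ofReal.tendsto _).comp ?_
  have h := ((hw.tendsto_vec_scriAverage Ψ).const_add (hw.vec Φ)).norm.pow 2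
  rwa [add_zero] at h

theorem IsSpectralWeight.tendsto_scriSymp_scriAverage (hw : IsSpectralWeight w) (Φ Ψ : ScriSpace) :
    Tendsto (fun N => scriSymp Φ (scriAverage N Ψ)) atTop (𝓝 0) := by
  have h1 : ∀ Ψ, scriSymp Φ Ψ = -2 * (inner ℂ (hw.vec Φ) (hw.vec Ψ)).im := fun Ψ => by
    rw [hw.inner_vec, hw.im_weightedForm]
    ring
  simp only [h1]
  have h2 := ((Complex.continuous_im.tendsto _).comp
    ((tendsto_const_nhds (x := hw.vec Φ)).inner (𝕜 := ℂ) (hw.tendsto_vec_scriAverage Ψ))).const_mul (-2)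
  simpa using h2

theorem IsQuasifreeWith.weylRatio_eq_one (h : IsQuasifreeWith scriSymp (weightedForm w) φ)
    (Φ : ScriSpace) : weylRatio w φ Φ = 1 := by
  rw [weylRatio, h.2.2, ← Complex.exp_add, neg_div, neg_add_cancel, Complex.exp_zero]

theorem IsSpectralWeight.isKMS_of_isQuasifreeWith (hw : IsSpectralWeight w) (hβ : 0 < β)
    (hw' : ∀ k, w k * Real.exp (-β * k) = w (-k))
    (h : IsQuasifreeWith scriSymp (weightedForm w) φ) : IsKMS vTranslation β φ :=
  hw.isKMS_of_weylRatio hβ hw' fun Φ Ψ t => by rw [h.weylRatio_eq_one, h.weylRatio_eq_one]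

theorem eq_of_weylRatio_eq_one {φ' : ScriWeyl →L[ℂ] ℂ}
    (h : IsQuasifreeWith scriSymp (weightedForm w) φ) (h' : ∀ Φ, weylRatio w φ' Φ = 1) :
    φ' = φ :=
  ext_weylGen scriSymp_isAlt fun Φ => by
    rw [apply_weylGen_eq_weylRatio w, apply_weylGen_eq_weylRatio w φ, h', h.weylRatio_eq_one]

/-- A KMS functional is the thermal state if it tends to `1` along averaged Weyl generators. -/
theorem IsSpectralWeight.eq_of_tendsto_one (hw : IsSpectralWeight w) (hβ : 0 < β)
    (hw' : ∀ k, w k * Real.exp (-β * k) = w (-k))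
    (h : IsQuasifreeWith scriSymp (weightedForm w) φ) {φ' : ScriWeyl →L[ℂ] ℂ}
    (hφ' : IsKMS vTranslation β φ')
    (hlim : ∀ Φ, Tendsto (fun N => φ' (weylGen scriSymp (scriAverage N Φ))) atTop (𝓝 1)) :
    φ' = φ := by
  refine eq_of_weylRatio_eq_one h fun Φ => ?_
  -- Averaging leaves the ratio unchanged for `N ≠ 0`, while the Gaussian factor tends to `1` along
  -- the averages.
  have h1 : ∀ᶠ N in atTop, weylRatio w φ' (scriAverage N Φ) = weylRatio w φ' Φ := by
    filter_upwards [eventually_ne_atTop 0] with N hN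
    simpa using apply_add_scriAverage (hw.weylRatio_add_scriShift hβ hw' hφ') hN 0 Φ
  have h2 : Tendsto (fun N => weylRatio w φ' (scriAverage N Φ)) atTop (𝓝 (1 * Complex.exp (0 / 2))) := by
    refine (hlim Φ).mul ((Complex.continuous_exp.tendsto _).comp (Tendsto.div_const ?_ 2))
    have h3 := hw.tendsto_weightedForm_add_scriAverage 0 Φ
    simpa [hw.weightedForm_eq] using h3
  have h3 := tendsto_nhds_unique (tendsto_const_nhds.congr' (h1.mono fun _ h => h.symm)) h2
  simpa using h3

/-- Continuity is used only to send `lam` to `0` along averages, whose norms tend to `0`. -/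
theorem IsSpectralWeight.eq_of_isContinuousTwoPoint (hw : IsSpectralWeight w) (hβ : 0 < β)
    (hw' : ∀ k, w k * Real.exp (-β * k) = w (-k))
    (h : IsQuasifreeWith scriSymp (weightedForm w) φ) {lam : ScriSpace → ScriSpace → ℂ}
    {φ' : ScriWeyl →L[ℂ] ℂ} (hq : IsQuasifreeWith scriSymp lam φ')
    (hc : IsContinuousTwoPoint lam) (hφ' : IsKMS vTranslation β φ') : φ' = φ := by
  refine hw.eq_of_tendsto_one hβ hw' h hφ' fun Φ => ?_
  obtain ⟨C, hC⟩ := hc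
  have h1 : Tendsto (fun N => lam (scriAverage N Φ) (scriAverage N Φ)) atTop (𝓝 0) := by
    refine squeeze_zero_norm (fun N => hC _ _) ?_
    simpa using ((tendsto_scriNorm_scriAverage Φ).const_mul C).mul (tendsto_scriNorm_scriAverage Φ)
  have h2 := (Complex.continuous_exp.tendsto _).comp (h1.neg.div_const 2)
  simp only [hq.2.2]
  simpa [Function.comp_def] using h2

/-- The thermal state is an extremal KMS state. -/
theorem IsSpectralWeight.mem_extremePoints (hw : IsSpectralWeight w) (hβ : 0 < β)
    (hw' : ∀ k, w k * Real.exp (-β * k) = w (-k))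
    (h : IsQuasifreeWith scriSymp (weightedForm w) φ) :
    φ ∈ (kmsStates vTranslation β).extremePoints ℝ := by
  rw [mem_extremePoints_iff_left]
  refine ⟨⟨h.1, hw.isKMS_of_isQuasifreeWith hβ hw' h⟩, ?_⟩
  rintro φ₁ ⟨hs1, hk1⟩ φ₂ ⟨hs2, -⟩ ⟨p, q, hp, hq, -, hpq⟩
  -- The decomposed state tends to `1` on the unitaries of the averages, and this forces the
  -- component `φ₁` to do the same.
  refine hw.eq_of_tendsto_one hβ hw' h hk1 fun Φ => ?_
  rw [tendsto_iff_norm_sub_tendsto_zero]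
  have h1 : ∀ Ψ, ‖φ₁ (weylGen scriSymp Ψ) - 1‖ ^ 2 ≤
      p⁻¹ * (2 - 2 * (φ (weylGen scriSymp Ψ)).re) := by
    intro Ψ
    exact hs1.norm_sub_one_sq_le h.1 hs2 hp hq.le hpq (star_weylGen_mul_self scriSymp_isAlt Ψ)
  have h2 : Tendsto (fun N => φ (weylGen scriSymp (scriAverage N Φ))) atTop (𝓝 1) := by
    simp only [h.2.2]
    have h3 := (Complex.continuous_exp.tendsto _).comp
      ((hw.tendsto_weightedForm_add_scriAverage 0 Φ).neg.div_const 2)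
    simpa [hw.weightedForm_eq, Function.comp_def] using h3
  have h3 : Tendsto (fun N => Real.sqrt (p⁻¹ * (2 - 2 * (φ (weylGen scriSymp
      (scriAverage N Φ))).re))) atTop (𝓝 0) := by
    have h4 := (((((Complex.continuous_re.tendsto _).comp h2).const_mul 2).const_sub 2).const_mul
      p⁻¹).sqrt
    simpa using h4
  exact squeeze_zero (fun _ => norm_nonneg _) (fun N => Real.le_sqrt_of_sq_le (h1 _)) h3

end Uniqueness

/-! ### Extremal quasifree KMS states, and invariance -/

section QuasifreeExtremal

variable {w : ℝ → ℝ} {β : ℝ} {φ ψ : ScriWeyl →L[ℂ] ℂ}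

/-- The Gaussian factor forgets the averaged summand in the limit, while the ratio keeps it. -/
theorem IsSpectralWeight.tendsto_apply_weylGen_add_scriAverage (hw : IsSpectralWeight w)
    (hψ : ∀ Φ Ψ t, weylRatio w ψ (Φ + scriShift t Ψ) = weylRatio w ψ (Φ + Ψ)) (Φ Ψ : ScriSpace) :
    Tendsto (fun N => ψ (weylGen scriSymp (Φ + scriAverage N Ψ))) atTop
      (𝓝 (Complex.exp (-weightedForm w Φ Φ / 2) * weylRatio w ψ (Φ + Ψ))) := by
  have h1 : Tendsto (fun N => Complex.exp (-weightedForm w (Φ + scriAverage N Ψ)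
      (Φ + scriAverage N Ψ) / 2) * weylRatio w ψ (Φ + Ψ)) atTop
      (𝓝 (Complex.exp (-weightedForm w Φ Φ / 2) * weylRatio w ψ (Φ + Ψ))) :=
    ((Complex.continuous_exp.tendsto _).comp
      ((hw.tendsto_weightedForm_add_scriAverage Φ Ψ).neg.div_const 2)).mul_const _
  refine h1.congr' ?_
  filter_upwards [eventually_ne_atTop 0] with N hN
  have h2 := apply_weylGen_eq_weylRatio w ψ (Φ + scriAverage N Ψ)
  rw [h2, apply_add_scriAverage hψ hN Φ Ψ]

/-- Perturbing a KMS state by averaged Weyl operators gives further KMS states. -/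
theorem IsSpectralWeight.exists_perturbed_kmsState (hw : IsSpectralWeight w) (hβ : 0 < β)
    (hw' : ∀ k, w k * Real.exp (-β * k) = w (-k)) (hψ : ψ ∈ kmsStates vTranslation β)
    {F : ScriSpace} (heven : weylRatio w ψ (-F) = weylRatio w ψ F) {ε c : ℝ} (hε : ε ^ 2 = 1)
    (hc : 0 < c) (hcF : (c : ℂ) = 2 + ε * (2 * weylRatio w ψ F)) :
    ∃ ψ' ∈ kmsStates vTranslation β, ∀ G, (c : ℂ) * weylRatio w ψ' G =
      2 * weylRatio w ψ G + ε * (weylRatio w ψ (G + F) + weylRatio w ψ (G - F)) := by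
  have hinv := hw.weylRatio_add_scriShift hβ hw' hψ.2
  have hc0 : (c : ℂ) ≠ 0 := by exact_mod_cast hc.ne'
  -- The ratio of the perturbed functional before normalisation; the prescribed `c` is its value at
  -- `0`.
  obtain ⟨q, hq⟩ : ∃ q : ScriSpace → ℂ, ∀ G, q G =
    2 * weylRatio w ψ G + ε * (weylRatio w ψ (G + F) + weylRatio w ψ (G - F)) := ⟨_, fun _ => rfl⟩
  obtain ⟨f, hf⟩ : ∃ f : ScriSpace → ℂ, ∀ G, f G =
    Complex.exp (-weightedForm w G G / 2) * q G := ⟨_, fun _ => rfl⟩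
  have hσ : ∀ G, Tendsto (fun N => ((scriSymp G (scriAverage N F) : ℝ) : ℂ)) atTop (𝓝 0) :=
    fun G => by
      have := (Complex.continuous_ofReal.tendsto _).comp (hw.tendsto_scriSymp_scriAverage G F)
      simpa [Function.comp_def] using this
  -- `f` is the pointwise limit of the positive functionals `ψ(x* W(G) x)` with `x = 1 + ε W(A_N
  -- F)`.
  have hpd : IsTwistedPosDef scriSymp f := by
    refine IsTwistedPosDef.of_tendsto (fun N => isTwistedPosDef_conj scriSymp_isAlt hψ.1
      (1 + (ε : ℂ) • weylGen scriSymp (scriAverage N F))) fun G => ?_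
    simp only [weylGen_conj_perturbation scriSymp_isAlt ψ hε]
    have h1 := hw.tendsto_apply_weylGen_add_scriAverage hinv G F
    have h2 := hw.tendsto_apply_weylGen_add_scriAverage hinv G (-F)
    simp only [map_neg, ← sub_eq_add_neg] at h2
    have h3 : ∀ a : ℂ, Tendsto (fun N => Complex.exp (a * (scriSymp G (scriAverage N F) : ℝ))) atTop
        (𝓝 1) := fun a => by
      have := (Complex.continuous_exp.tendsto _).comp ((hσ G).const_mul a)
      simpa [Function.comp_def] using this
    have h4 := ((((h3 Complex.I).const_add 1).mul_const (ψ (weylGen scriSymp G))).add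
      (((h3 (Complex.I / 2)).mul (h1.add h2)).const_mul (ε : ℂ)))
    convert h4 using 2
    have h5 := apply_weylGen_eq_weylRatio w ψ G
    simp only [hf, hq]
    linear_combination -2 * h5
  have h0 : weylRatio w ψ 0 = 1 := by
    have h1 : ψ (weylGen scriSymp 0) = 1 := by
      rw [weylGen_zero]
      exact hψ.1.1
    rw [weylRatio, h1, hw.weightedForm_eq]
    simp
  obtain ⟨ψ', hs, hψ'⟩ := exists_isState scriSymp_isAlt (f := fun G => ((c⁻¹ : ℝ) : ℂ) * f G) (by
    simp only [hf, hq, zero_add, zero_sub, heven, h0]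
    rw [hw.weightedForm_eq]
    simp only [map_zero, Complex.ofReal_zero, mul_zero, sub_zero, neg_zero, zero_div,
      Complex.exp_zero, one_mul, mul_one, ← two_mul]
    rw [← hcF, Complex.ofReal_inv, inv_mul_cancel₀ hc0]) (hpd.const_mul (inv_pos.mpr hc).le)
  have hr : ∀ G, (c : ℂ) * weylRatio w ψ' G = q G := by
    intro G
    have h2 := hψ' G
    rw [weylRatio, h2, hf, Complex.ofReal_inv]
    have h1 : Complex.exp (-weightedForm w G G / 2) * Complex.exp (weightedForm w G G / 2) = 1 := by
      rw [← Complex.exp_add, neg_div, neg_add_cancel, Complex.exp_zero]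
    calc _ = ((c : ℂ) * (c : ℂ)⁻¹) * q G *
        (Complex.exp (-weightedForm w G G / 2) * Complex.exp (weightedForm w G G / 2)) := by ring
      _ = q G := by rw [h1, mul_inv_cancel₀ hc0, one_mul, mul_one]
  refine ⟨ψ', ⟨hs, hw.isKMS_of_weylRatio hβ hw' fun Φ Ψ t => ?_⟩, fun G => (hr G).trans (hq G)⟩
  refine mul_left_cancel₀ hc0 ?_
  -- `q` inherits the invariance of the ratio at the three base points `Φ`, `Φ + F` and `Φ - F`.
  have h1 := hinv Φ Ψ t
  have h2 := hinv (Φ + F) Ψ t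
  have h3 := hinv (Φ - F) Ψ t
  rw [add_right_comm, add_right_comm Φ F] at h2
  rw [← add_sub_right_comm, ← add_sub_right_comm] at h3
  rw [hr (Φ + scriShift t Ψ), hr (Φ + Ψ), hq, hq, h1, h2, h3]

/-- A quasifree extremal KMS state is the thermal state. -/
theorem IsSpectralWeight.eq_of_mem_extremePoints (hw : IsSpectralWeight w) (hβ : 0 < β)
    (hw' : ∀ k, w k * Real.exp (-β * k) = w (-k))
    (h : IsQuasifreeWith scriSymp (weightedForm w) φ) {lam : ScriSpace → ScriSpace → ℂ}
    (hq : IsQuasifreeWith scriSymp lam ψ) (hψ : ψ ∈ (kmsStates vTranslation β).extremePoints ℝ) :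
    ψ = φ := by
  obtain ⟨hk, hext⟩ := mem_extremePoints_iff_left.mp hψ
  obtain ⟨μ, hsymm, hpos, -, hμ⟩ := hq.2.1
  have hinv := hw.weylRatio_add_scriShift hβ hw' hk.2
  -- `μ` may be discontinuous, so averaging does not make `D` vanish; a nonzero `D` has to be
  -- excluded by extremality.
  set D : LinearMap.BilinForm ℝ ScriSpace := μ - hw.realForm
  have hlam : ∀ Φ, lam Φ Φ = μ Φ Φ := fun Φ => by
    rw [hμ, scriSymp_isAlt]
    simp
  have hDΦ : ∀ Φ, D Φ Φ = μ Φ Φ - ‖hw.vec Φ‖ ^ 2 := fun Φ => by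
    rw [← hw.realForm_self]
    rfl
  clear_value D
  have hr : ∀ Φ, weylRatio w ψ Φ = (Real.exp (-(D Φ Φ) / 2) : ℝ) := by
    intro Φ
    rw [weylRatio, hq.2.2, ← Complex.exp_add, hlam, hw.weightedForm_self, hDΦ]
    push_cast
    congr 1
    ring
  -- `D` takes the same value at `Φ` and at its averages, where it is at least `-‖vec‖²`, and this
  -- tends to `0`.
  have hnonneg : ∀ Φ, 0 ≤ D Φ Φ := by
    intro Φ
    have h1 : Tendsto (fun N => -‖hw.vec (scriAverage N Φ)‖ ^ 2) atTop (𝓝 0) := by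
      simpa using ((hw.tendsto_vec_scriAverage Φ).norm.pow 2).neg
    refine le_of_tendsto h1 ?_
    filter_upwards [eventually_ne_atTop 0] with N hN
    have h2 := apply_add_scriAverage hinv hN 0 Φ
    rw [zero_add, zero_add, hr, hr, Complex.ofReal_inj, Real.exp_eq_exp] at h2
    have h3 : 0 ≤ μ (scriAverage N Φ) (scriAverage N Φ) := by
      rcases eq_or_ne (scriAverage N Φ) 0 with h0 | h0
      · rw [h0]
        simp
      · exact (hpos _ h0).le
    have h4 := hDΦ (scriAverage N Φ)
    linarith
  refine eq_of_weylRatio_eq_one h fun F => ?_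
  by_contra hF
  have hDF : 0 < D F F := by
    refine (hnonneg F).lt_of_ne fun h0 => hF ?_
    rw [hr, ← h0]
    simp
  obtain ⟨x, hx⟩ : ∃ x : ℝ, x = Real.exp (-(D F F) / 2) := ⟨_, rfl⟩
  have hx0 : 0 < x := hx ▸ Real.exp_pos _
  have hx1 : x < 1 := by
    rw [hx, ← Real.exp_zero]
    exact Real.exp_lt_exp.mpr (by linarith)
  have hrF : weylRatio w ψ F = x := by rw [hr F, hx]
  have heven : weylRatio w ψ (-F) = weylRatio w ψ F := by
    rw [hr, hr]
    simp
  -- The normalisations are `2 ± 2x`; the second one is positive because `x < 1`.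
  obtain ⟨ψ₁, hk1, h1⟩ := hw.exists_perturbed_kmsState hβ hw' hk heven (ε := 1) (c := 2 + 2 * x)
    (by norm_num) (by linarith) (by rw [hrF]; push_cast; ring)
  obtain ⟨ψ₂, hk2, h2⟩ := hw.exists_perturbed_kmsState hβ hw' hk heven (ε := -1) (c := 2 - 2 * x)
    (by norm_num) (by linarith) (by rw [hrF]; push_cast; ring)
  -- Weighted in this way, the terms with `G ± F` cancel and `4 r(G) / 4` remains.
  have hdec : ((2 + 2 * x) / 4) • ψ₁ + ((2 - 2 * x) / 4) • ψ₂ = ψ := by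
    refine ext_weylGen scriSymp_isAlt fun G => ?_
    have h3 : (((2 + 2 * x) / 4) • ψ₁ + ((2 - 2 * x) / 4) • ψ₂) (weylGen scriSymp G) =
        (((2 + 2 * x) / 4 : ℝ) : ℂ) * ψ₁ (weylGen scriSymp G) +
          (((2 - 2 * x) / 4 : ℝ) : ℂ) * ψ₂ (weylGen scriSymp G) := by
      simp [Complex.real_smul]
    have h4 := h1 G
    have h5 := h2 G
    have h6 := apply_weylGen_eq_weylRatio w ψ₁ G
    have h7 := apply_weylGen_eq_weylRatio w ψ₂ G
    have h8 := apply_weylGen_eq_weylRatio w ψ G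
    push_cast at h3 h4 h5
    linear_combination h3 + (2 + 2 * x) / 4 * h6 + (2 - 2 * x) / 4 * h7 - h8 +
      (Complex.exp (-weightedForm w G G / 2) / 4) * (h4 + h5)
  have heq : ψ₁ = ψ := hext ψ₁ hk1 ψ₂ hk2
    ⟨(2 + 2 * x) / 4, (2 - 2 * x) / 4, by linarith, by linarith, by ring, hdec⟩
  -- At `G = F`, with `r(2F) = x⁴` and `r(0) = 1`, the equality `ψ₁ = ψ` reads `(2 + 2x) x = 2x + x⁴
  -- + 1`, that is `(1 - x²)² = 0`, against `0 < x < 1`.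
  have h3 := h1 F
  have h4 : D (F + F) (F + F) = 4 * D F F := by
    simp only [map_add, LinearMap.add_apply]
    ring
  have h5 : Real.exp (-(4 * D F F) / 2) = x ^ 4 := by
    rw [hx, ← Real.exp_nat_mul]
    congr 1
    push_cast
    ring
  have h2F : weylRatio w ψ (F + F) = (x ^ 4 : ℝ) := by rw [hr, h4, h5]
  have h0 : weylRatio w ψ 0 = 1 := by
    rw [hr]
    simp
  rw [heq, sub_self, hrF, h2F, h0] at h3
  have h6 : (2 + 2 * x) * x = 2 * x + 1 * (x ^ 4 + 1) := by exact_mod_cast h3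
  have h7 : (1 - x ^ 2) ^ 2 = 0 := by linear_combination -h6
  have h8 : 0 < 1 - x ^ 2 := sub_pos.mpr (pow_lt_one₀ hx0.le hx1 two_ne_zero)
  exact (pow_pos h8 2).ne' h7

/-- The thermal states are invariant under the motions of `Scri`. -/
theorem apply_scriAut_of_isQuasifreeWith (h : IsQuasifreeWith scriSymp (weightedForm w) φ) (t : ℝ)
    (R : Rot) (a : ScriWeyl) : φ (scriAut t R a) = φ a := by
  have hcont : Continuous (scriAut t R : ScriWeyl → ScriWeyl) :=
    (AddMonoidHomClass.isometry_of_norm (scriAut t R)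
      (norm_weylAut _ (scriAct_symp t R))).continuous
  refine DFunLike.congr_fun (ext_weylGen scriSymp_isAlt (ψ := φ)
    (φ := φ.comp ⟨(scriAut t R : ScriWeyl →ₐ[ℂ] ScriWeyl).toLinearMap, hcont⟩) fun Φ => ?_) a
  have h1 := h.2.2 (scriAct t R Φ)
  rw [weightedForm_scriAct t R Φ Φ] at h1
  exact (congrArg φ (scriAut_weylGen t R Φ)).trans (h1.trans (h.2.2 Φ).symm)

end QuasifreeExtremal

/-! ### The proposition -/

theorem mainTheorem6 :
    (∀ β : ℝ, 0 < β → ∃ φ : ScriWeyl →L[ℂ] ℂ,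
      -- `μ_β` is the two-point function of a quasifree state, determined by its values on the `W(Φ)`
      (IsQuasifreeWith scriSymp (thermalTwoPoint β) φ ∧
        ∀ φ' : ScriWeyl →L[ℂ] ℂ,
          (∀ Φ, φ' (weylGen scriSymp Φ) = Complex.exp (-thermalTwoPoint β Φ Φ / 2)) → φ' = φ) ∧
      -- a) it is a KMS state
      IsKMS vTranslation β φ ∧
      -- the only quasifree one with a continuous two-point function
      (IsContinuousTwoPoint (thermalTwoPoint β) ∧
        ∀ (lam : ScriSpace → ScriSpace → ℂ) (φ' : ScriWeyl →L[ℂ] ℂ),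
          IsQuasifreeWith scriSymp lam φ' → IsContinuousTwoPoint lam →
            IsKMS vTranslation β φ' → φ' = φ) ∧
      -- and the only quasifree one that is extremal among the KMS states
      (φ ∈ (kmsStates vTranslation β).extremePoints ℝ ∧
        ∀ (lam : ScriSpace → ScriSpace → ℂ) (φ' : ScriWeyl →L[ℂ] ℂ),
          IsQuasifreeWith scriSymp lam φ' →
            φ' ∈ (kmsStates vTranslation β).extremePoints ℝ → φ' = φ) ∧
      -- b) invariance under `v`-translations and rotations
      (∀ (t : ℝ) (R : Rot), LinearMap.det (R.toLinearEquiv.toLinearMap) = 1 →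
        ∀ a : ScriWeyl, φ (scriAut t R a) = φ a)) ∧
    -- c) weak convergence to the two-point function of the quasifree ground state
    (∃ φ₀ : ScriWeyl →L[ℂ] ℂ, IsQuasifreeWith scriSymp groundTwoPoint φ₀) ∧
    ∀ Φ Ψ : ScriSpace,
      Tendsto (fun β : ℝ => thermalTwoPoint β Φ Ψ) atTop (𝓝 (groundTwoPoint Φ Ψ)) := by
  refine ⟨fun β hβ => ?_, ?_, tendsto_thermalTwoPoint⟩
  · have hw := isSpectralWeight_thermalWeight hβ
    have hw' := thermalWeight_mul_exp β
    obtain ⟨φ, hφ⟩ := hw.exists_quasifree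
    have hu : ∀ φ' : ScriWeyl →L[ℂ] ℂ, (∀ Φ, φ' (weylGen scriSymp Φ) =
        Complex.exp (-thermalTwoPoint β Φ Φ / 2)) → φ' = φ := fun φ' h =>
      ext_weylGen scriSymp_isAlt fun Φ => (h Φ).trans (hφ.2.2 Φ).symm
    refine ⟨φ, ⟨hφ, hu⟩, hw.isKMS_of_isQuasifreeWith hβ hw' hφ,
      ⟨hw.isContinuousTwoPoint, fun lam φ' => hw.eq_of_isContinuousTwoPoint hβ hw' hφ⟩,
      ⟨hw.mem_extremePoints hβ hw' hφ, fun lam φ' => hw.eq_of_mem_extremePoints hβ hw' hφ⟩,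
      fun t R _ a => apply_scriAut_of_isQuasifreeWith hφ t R a⟩
  · rw [groundTwoPoint_eq]
    exact isSpectralWeight_groundWeight.exists_quasifree

end
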